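/- **Theorem (Blagovestchenskii identity).** Let $(\mathcal M,g)$ be a compact or complete conic Riemannian manifold with group action, of dimension $n$. This means: $\mathcal M=\mathcal M^{reg}\cup\mathcal M^{sing}$, where $\mathcal M^{reg}$ is open and dense in $\mathcal M$ and is a smooth $n$-dimensional Riemannian manifold with metric $g$, and each point of $\mathcal M^{sing}$ (which may be empty, in which case $\mathcal M$ is a smooth Riemannian manifold) lies in the image of a conic coordinate system $(\tilde U,\Gamma,\pi)$. Here $\tilde U=W\times B(0,R_0)\subset\mathbb R^k\times\mathbb R^{n-k}$, $n-k\ge2$, $W$ is open, $\Gamma\subset SO(n-k)$ is a finite group acting on the second factor, and $\pi$ induces a homeomorphism of $\Gamma\backslash\tilde U$ onto an open set $U\subset\mathcal M$ such that $U\cap\mathcal M^{reg}=\pi(\{(y,z)\in \tilde U: z\ne0\})$. On $\{z\neq0\}$ the map $\pi$ is a local diffeomorphism, and, with $z=r\omega$, $|\omega|=1$, $$\pi^*g=dr^2+\sum a_{jk}\,dy^jdy^k+\sum r^2b_{\alpha\beta}\,d\omega^\alpha d\omega^\beta+\sum r\,h_{j\alpha}\,dy^jd\omega^\alpha ,$$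 where, as $r\to0$, $a\to\hat a(y)$, $b\to\hat b(y,\omega)$ and $h\to0$ uniformly on compact subsets of $W\times S^{n-k-1}$, $\hat a(y)$ is positive definite, and $c_0\,g_{S}\le\hat b(y,\cdot)\le T(y)^2g_{S}$ with $c_0>0$, $0<T(y)\le c_1$, $g_S$ being the standard metric of $S^{n-k-1}$. The distance $d_{\mathcal M}(x,y)$ is the infimum of the $g$-lengths of $\mu\cap\mathcal M^{reg}$ over the paths $\mu$ in $\mathcal M$ from $x$ to $y$ that are piecewise $C^1$ in the (lifted) coordinates and meet $\mathcal M^{sing}$ only finitely many times; the distance is finite, it induces the topology of $\mathcal M$, and completeness and boundedness refer to it. Let $dV$ be the Riemannian volume on $\mathcal M^{reg}$, with $\mathcal M^{sing}$ having measure zero, let $L^2(\mathcal M)=L^2(\mathcal M,dV)$ with $\langle u,w\rangle=\int u\overline w\,dV$ (real or complex scalars), let $H^1(\mathcal M)$ be the space of $u\in L^2(\mathcal M)$ whose weak differential on $\mathcal M^{reg}$ is square integrable, and let $Q(u,w)=\int_{\mathcal M^{reg}}g^{ij}\,\partial_iu\,\overline{\partial_jw}\,dV$. Let $\mathcal O\subset\mathcal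 M$ be open and bounded, $T>0$, and $\mathbb R_+=(0,\infty)$. Let $C_0^\infty(\mathcal O\times\mathbb R_+)$ be the space of functions with compact support in $\mathcal O\times\mathbb R_+$ that are smooth on $\mathcal M^{reg}\times\mathbb R$ and smooth in the lifted conic coordinates. For $f\in C_0^\infty(\mathcal O\times\mathbb R_+)$ let $u^f\in C^1([0,\infty);L^2(\mathcal M))\cap C([0,\infty);H^1(\mathcal M))$ be the finite energy solution of $$\partial_t^2u-\Delta_gu=f\ \text{ in }\mathcal M\times\mathbb R_+,\qquad u|_{t=0}=\partial_tu|_{t=0}=0,$$ that is, for all $w\in H^1(\mathcal M)$ and $t\ge0$, $\frac{d}{dt}\langle\partial_tu(t),w\rangle+Q(u(t),w)=\langle f(t),w\rangle$. Let $V^{2T}_{\mathcal O,+}f=u^f|_{\mathcal O\times(0,2T)}$ and $$J\phi(x,t)=\frac12\int_t^{2T-t}\phi(x,s)\,ds,\qquad J:L^2(\mathcal O\times(0,2T))\to L^2(\mathcal O\times(0,T)).$$ (i) For all $f,h\in C_0^\infty(\mathcal O\times\mathbb R_+)$, $$\langle u^f(\cdot,T),u^h(\cdot,T)\rangle_{L^2(\mathcal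 M)}=\langle f,J V^{2T}_{\mathcal O,+}h\rangle_{L^2(\mathcal O\times(0,T))}-\langle V^{2T}_{\mathcal O,+}f,Jh\rangle_{L^2(\mathcal O\times(0,T))}.$$ (ii) For all $f\in C_0^\infty(\mathcal O\times\mathbb R_+)$ and $t\ge0$, the function $u^f(\cdot,t)$ is integrable on $\mathcal M$ and $$\langle u^f(t),1\rangle_{L^2(\mathcal M)}=\int_{\mathcal M}u^f(x,t)\,dV(x)=\int_0^t\int_0^{t'}\langle f(t''),1\rangle_{L^2(\mathcal O)}\,dt''\,dt'.$$ -/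

import Mathlib

open Set Filter Topology MeasureTheory Bundle Manifold
open scoped Manifold ContDiff

noncomputable section

namespace ConicWave

/-- Euclidean space `ℝⁿ`. -/
abbrev E (n : ℕ) : Type := EuclideanSpace ℝ (Fin n)

/-! ### Conic metrics on `W × B(0,R) ⊆ ℝᵏ × ℝᵐ` -/

/-- The lifted coordinate domain `Ũ = W × B(0,R)`, with points written `p = (y,z)`. -/
def conicDomain {k m : ℕ} (W : Set (E k)) (R : ℝ) : Set (E k × E m) :=
  W ×ˢ Metric.ball 0 R

/-- The regular part `W × (B(0,R) \ {0})` of the lifted coordinate domain. -/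
def conicDomainReg {k m : ℕ} (W : Set (E k)) (R : ℝ) : Set (E k × E m) :=
  {p ∈ conicDomain W R | p.2 ≠ 0}

/-- `g p v w` is the value at `p = (y, z)`, `z = r ω ≠ 0, |ω| = 1`, of a metric tensor on the vectors `v, w`.
The structure says that in the coordinates `(y, r, ω)`
`g = dr² + ∑ a dy dy + ∑ r² b dω dω + ∑ r h dy dω`
with `a → â(y)`, `b → b̂(y, ω)`, `h → 0` as `r → 0`, uniformly for `(y, ω)` in compact sets, with
`â(y)` positive definite and `c₀ g_S ≤ b̂ ≤ T(y)² g_S`, `0 < T(y) ≤ c₁`.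
The angular vector `∂/∂ω` in a direction `θ ⊥ ω` is the vector `(0, r θ)`, so that
`b(θ, θ') = g ((0, θ), (0, θ'))` and `h(η, θ) = 2 g ((η, 0), (0, θ))`; the absence of the terms
`dr dy`, `dr dω` and the coefficient `1` of `dr²` mean that `g (∂_r, ·) = dr`. -/
structure IsConicMetric {k m : ℕ} (W : Set (E k)) (R : ℝ)
    (g : E k × E m → E k × E m → E k × E m → ℝ) : Prop where
  radial : ∀ p ∈ conicDomainReg (m := m) W R, ∀ v : E k × E m,
    g p (0, ‖p.2‖⁻¹ • p.2) v = inner ℝ (‖p.2‖⁻¹ • p.2) v.2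
  mixed : ∀ K ⊆ W, IsCompact K → ∀ ε > 0, ∃ δ ∈ Ioc 0 R, ∀ y ∈ K, ∀ σ : E m, ‖σ‖ = 1 →
    ∀ r ∈ Ioo 0 δ, ∀ (η : E k) (θ : E m), inner ℝ σ θ = 0 →
      |g (y, r • σ) (η, 0) (0, θ)| ≤ ε * ‖η‖ * ‖θ‖
  limit_a : ∃ a : E k → E k → E k → ℝ,
    (∀ K ⊆ W, IsCompact K → ∀ ε > 0, ∃ δ ∈ Ioc 0 R, ∀ y ∈ K, ∀ σ : E m, ‖σ‖ = 1 →
      ∀ r ∈ Ioo 0 δ, ∀ η η' : E k,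
        |g (y, r • σ) (η, 0) (η', 0) - a y η η'| ≤ ε * ‖η‖ * ‖η'‖) ∧
    (∀ y ∈ W, ∀ η : E k, η ≠ 0 → 0 < a y η η)
  limit_b : ∃ b : E k → E m → E m → E m → ℝ,
    (∀ K ⊆ W, IsCompact K → ∀ ε > 0, ∃ δ ∈ Ioc 0 R, ∀ y ∈ K, ∀ σ : E m, ‖σ‖ = 1 →
      ∀ r ∈ Ioo 0 δ, ∀ θ θ' : E m, inner ℝ σ θ = 0 → inner ℝ σ θ' = 0 →
        |g (y, r • σ) (0, θ) (0, θ') - b y σ θ θ'| ≤ ε * ‖θ‖ * ‖θ'‖) ∧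
    (∃ c₀ > 0, ∃ c₁ > 0, ∃ T : E k → ℝ, ∀ y ∈ W, (0 < T y ∧ T y ≤ c₁) ∧
      ∀ σ : E m, ‖σ‖ = 1 → ∀ θ : E m, inner ℝ σ θ = 0 →
        c₀ * ‖θ‖ ^ 2 ≤ b y σ θ θ ∧ b y σ θ θ ≤ T y ^ 2 * ‖θ‖ ^ 2)

/-! ### Conic manifolds with group action

`M` is the whole space, the open set `Mreg` is its regular part, a smooth Riemannian manifold
of dimension `n`; the complement of `Mreg` is the singular part. -/

section Geometry

variable {n : ℕ} {M : Type*} [MetricSpace M]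

/-- Conic coordinates `(Ũ, Γ, proj)`: `Ũ = W × B(0,R) ⊆ ℝᵏ × ℝᵐ` with `k + m = n`, `m ≥ 2`, a finite
group `Γ ⊆ SO(m)` acting by `γ (y, z) = (y, γ z)`, and a map `proj` that induces a homeomorphism
of `Γ \ Ũ` onto an open subset of `M`. The regular points of the image are those with `z ≠ 0`; over
them `proj` (then written `projReg`) is a local diffeomorphism, and the pulled back metric is conic. -/
structure ConicChart (n : ℕ) (Mreg : TopologicalSpace.Opens M) [ChartedSpace (E n) Mreg]
    [RiemannianBundle (fun x : Mreg => TangentSpace (𝓡 n) x)] where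
  k : ℕ
  m : ℕ
  dim_eq : k + m = n
  two_le : 2 ≤ m
  W : Set (E k)
  isOpen_W : IsOpen W
  R : ℝ
  R_pos : 0 < R
  Γ : Subgroup (E m ≃ₗᵢ[ℝ] E m)
  finite : Finite Γ
  det_eq_one : ∀ γ ∈ Γ, LinearMap.det (γ.toLinearEquiv : E m →ₗ[ℝ] E m) = 1
  proj : E k × E m → M
  continuousOn : ContinuousOn proj (conicDomain W R)
  isOpen_image : ∀ V ⊆ conicDomain W R, IsOpen V → IsOpen (proj '' V)
  fiber : ∀ p ∈ conicDomain W R, ∀ q ∈ conicDomain W R,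
    proj p = proj q ↔ ∃ γ ∈ Γ, q = (p.1, γ p.2)
  mem_reg : ∀ p ∈ conicDomain W R, proj p ∈ Mreg ↔ p.2 ≠ 0
  projReg : E k × E m → Mreg
  coe_projReg : ∀ p ∈ conicDomainReg W R, (projReg p : M) = proj p
  localDiffeo : IsLocalDiffeomorphOn 𝓘(ℝ, E k × E m) (𝓡 n) ∞ projReg (conicDomainReg W R)
  conic : IsConicMetric W R (fun p v w =>
    inner ℝ (mfderiv 𝓘(ℝ, E k × E m) (𝓡 n) projReg p v) (mfderiv 𝓘(ℝ, E k × E m) (𝓡 n) projReg p w))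

/-- A path in a manifold that is piecewise `C¹` on `[a,b]`, the breakpoints being the points of a
finite set `P`. -/
def PiecewiseC1On {F : Type*} [NormedAddCommGroup F] [NormedSpace ℝ F]
    {N : Type*} [TopologicalSpace N] [ChartedSpace F N] (γ : ℝ → N) (a b : ℝ) : Prop :=
  ∃ P : Set ℝ, P.Finite ∧ ∀ s t, a ≤ s → s < t → t ≤ b → Disjoint (Ioo s t) P →
    ContMDiffOn 𝓘(ℝ, ℝ) 𝓘(ℝ, F) 1 γ (Icc s t)

variable {Mreg : TopologicalSpace.Opens M} [ChartedSpace (E n) Mreg]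
  [RiemannianBundle (fun x : Mreg => TangentSpace (𝓡 n) x)]

/-- A path `μ : [0,1] → M` that is piecewise `C¹` on the lifted coordinates and meets the singular
part only at finitely many times; `ν` is the same path seen in the regular part (its values at
the finitely many singular times are irrelevant). -/
structure IsAdmissiblePath (𝒜 : Set (ConicChart n Mreg)) (μ : ℝ → M) (ν : ℝ → Mreg) : Prop where
  continuousOn : ContinuousOn μ (Icc 0 1)
  finite : {t ∈ Icc (0 : ℝ) 1 | μ t ∉ Mreg}.Finite
  regular : ∀ t ∈ Icc (0 : ℝ) 1, μ t ∈ Mreg → (ν t : M) = μ t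
  piecewise : ∀ a b, 0 ≤ a → a ≤ b → b ≤ 1 → (∀ t ∈ Icc a b, μ t ∈ Mreg) →
    PiecewiseC1On (F := E n) ν a b
  lift : ∀ c ∈ 𝒜, ∀ a b, 0 ≤ a → a ≤ b → b ≤ 1 →
    (∀ t ∈ Icc a b, μ t ∈ c.proj '' conicDomain c.W c.R) →
    ∃ γ : ℝ → E c.k × E c.m, PiecewiseC1On (F := E c.k × E c.m) γ a b ∧
      ∀ t ∈ Icc a b, γ t ∈ conicDomain c.W c.R ∧ c.proj (γ t) = μ t

/-- The distance `d_M(x,y)`: the infimum of the lengths of the regular parts of the admissible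
paths from `x` to `y`. -/
def conicEDist (𝒜 : Set (ConicChart n Mreg)) (x y : M) : ENNReal :=
  ⨅ (μ : ℝ → M) (ν : ℝ → Mreg) (_ : IsAdmissiblePath 𝒜 μ ν) (_ : μ 0 = x) (_ : μ 1 = y),
    pathELength (𝓡 n) ν 0 1

/-- `M` with the regular part `Mreg` and the family `𝒜` of conic coordinates is a conic Riemannian
manifold with group action. (The smooth structure and the smooth Riemannian metric of `Mreg` are
given by type classes. If `Mreg = M` this is a smooth Riemannian manifold.) -/
structure IsConicManifold (𝒜 : Set (ConicChart n Mreg)) : Prop where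
  dense : Dense (Mreg : Set M)
  cover : ∀ x : M, x ∉ Mreg → ∃ c ∈ 𝒜, x ∈ c.proj '' conicDomain c.W c.R
  edist_eq : ∀ x y : M, edist x y = conicEDist 𝒜 x y

/-! ### The Riemannian volume -/

/-- The coordinate vector field `∂ᵢ` of the chart at `x₀`, at the point with coordinates `y`. -/
def coordVec (x₀ : Mreg) (i : Fin n) (y : E n) :
    TangentSpace (𝓡 n) ((chartAt (E n) x₀).symm y) :=
  mfderiv 𝓘(ℝ, E n) (𝓡 n) (chartAt (E n) x₀).symm y (EuclideanSpace.single i (1 : ℝ))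

/-- The matrix `(g_ij)` in the chart at `x₀`, at the point with coordinates `y`. -/
def chartGram (x₀ : Mreg) (y : E n) : Matrix (Fin n) (Fin n) ℝ :=
  Matrix.of fun i j => inner ℝ (coordVec x₀ i y) (coordVec x₀ j y)

variable [MeasurableSpace M]

/-- The measure `det(g)^{1/2} dx` on the domain of the chart at `x₀`. -/
def chartVolume (x₀ : Mreg) : Measure Mreg :=
  ((volume.restrict (chartAt (E n) x₀).target).withDensity
    (fun y => ENNReal.ofReal (Real.sqrt (chartGram x₀ y).det))).map (chartAt (E n) x₀).symm

variable (n Mreg) in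
/-- The Riemannian volume on the regular part: the least measure that dominates `det(g)^{1/2} dx` on
each chart domain (on which it is then equal to it, as these measures agree on overlaps). -/
def regVolume : Measure Mreg := ⨆ x₀ : Mreg, chartVolume (n := n) x₀

variable (n Mreg) in
/-- The volume measure `dV` on `M`; the singular part has measure zero. -/
def vol : Measure M := (regVolume n Mreg).map Subtype.val

/-! ### The Sobolev space `H¹(M)` and the Dirichlet form -/

variable {𝕜 : Type*} [RCLike 𝕜]

variable (n Mreg 𝕜) in
/-- `𝕜`-valued covector fields on the regular part. -/
abbrev CovectorField : Type _ := (x : Mreg) → (TangentSpace (𝓡 n) x →L[ℝ] 𝕜)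

/-- The standard basis of `T_xM = ℝⁿ`. -/
def tangentBasis (x : Mreg) (i : Fin n) : TangentSpace (𝓡 n) x :=
  (EuclideanSpace.single i (1 : ℝ) : E n)

/-- The matrix `(g_ij)` at `x`. -/
def gram (x : Mreg) : Matrix (Fin n) (Fin n) ℝ :=
  Matrix.of fun i j => inner ℝ (tangentBasis x i) (tangentBasis x j)

/-- The pairing `g^{ij} α_i conj(β_j)` of covectors at `x`. -/
def cometric (x : Mreg) (α β : TangentSpace (𝓡 n) x →L[ℝ] 𝕜) : 𝕜 :=
  ∑ i : Fin n, ∑ j : Fin n,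
    (algebraMap ℝ 𝕜 ((gram x)⁻¹ i j)) * α (tangentBasis x i) *
      (starRingEnd 𝕜) (β (tangentBasis x j))

/-- `A` is the weak differential of `u` on the regular part: in each chart, `A(∂ᵢ)` is the
weak (distributional) `i`-th partial derivative of `u`. -/
def HasWeakDifferential (u : M → 𝕜) (A : CovectorField n Mreg 𝕜) : Prop :=
  ∀ x₀ : Mreg,
    LocallyIntegrableOn (fun y => u ((chartAt (E n) x₀).symm y)) (chartAt (E n) x₀).target volume ∧
    ∀ i : Fin n,
      LocallyIntegrableOn (fun y => A ((chartAt (E n) x₀).symm y) (coordVec x₀ i y))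
        (chartAt (E n) x₀).target volume ∧
      ∀ ψ : E n → ℝ, ContDiff ℝ ∞ ψ → HasCompactSupport ψ →
        tsupport ψ ⊆ (chartAt (E n) x₀).target →
        ∫ y, (fderiv ℝ ψ y (EuclideanSpace.single i (1 : ℝ))) • u ((chartAt (E n) x₀).symm y) =
          - ∫ y, ψ y • A ((chartAt (E n) x₀).symm y) (coordVec x₀ i y)

/-- The squared norm `∫ g^{ij} A_i conj(A_j) dV`. -/
def energy (A : CovectorField n Mreg 𝕜) : ENNReal :=
  ∫⁻ x, ENNReal.ofReal (RCLike.re (cometric x (A x) (A x))) ∂(regVolume n Mreg)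

/-- The form `Q(u,w) = ∫ g^{ij} ∂ᵢu conj(∂ⱼw) dV`, in terms of the differentials of `u` and `w`. -/
def dirichletForm (A B : CovectorField n Mreg 𝕜) : 𝕜 :=
  ∫ x, cometric x (A x) (B x) ∂(regVolume n Mreg)

/-- `u ∈ H¹(M)`, with weak differential `A`. -/
def IsH1 (u : Lp 𝕜 2 (vol n Mreg)) (A : CovectorField n Mreg 𝕜) : Prop :=
  HasWeakDifferential (u : M → 𝕜) A ∧ energy A < ⊤

end Geometry

/-! ### Sources, waves, and the operators of the identity -/

section L2

variable {X : Type*} [MeasurableSpace X] {𝕜 : Type*} [RCLike 𝕜] {μ : Measure X}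

/-- `⟨u, w⟩ = ∫ u conj(w) dμ`, linear in the first argument. -/
def l2Inner (u w : Lp 𝕜 2 μ) : 𝕜 := inner 𝕜 w u

variable (μ) in
open Classical in
/-- The class in `L²` of a square integrable function. -/
def toL2 (f : X → 𝕜) : Lp 𝕜 2 μ := if hf : MemLp f 2 μ then hf.toLp f else 0

/-- The inner product of `L²(X × (0,T)) = L²((0,T); L²(X))`. -/
def spaceTimeInner (T : ℝ) (φ ψ : ℝ → Lp 𝕜 2 μ) : 𝕜 := ∫ t in (0 : ℝ)..T, l2Inner (φ t) (ψ t)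

/-- `(J φ)(x,t) = ½ ∫_t^{2T-t} φ(x,s) ds`. -/
def timeAverage (T : ℝ) (φ : ℝ → Lp 𝕜 2 μ) (t : ℝ) : Lp 𝕜 2 μ :=
  (1 / 2 : ℝ) • ∫ s in t..(2 * T - t), φ s

end L2

section Waves

variable {n : ℕ} {M : Type*} [MetricSpace M] {Mreg : TopologicalSpace.Opens M}
  [ChartedSpace (E n) Mreg] [RiemannianBundle (fun x : Mreg => TangentSpace (𝓡 n) x)]
  {𝕜 : Type*} [RCLike 𝕜]

/-- `f ∈ C₀^∞(O × ℝ₊)`, `ℝ₊ = (0,∞)`: compactly supported in `O × ℝ₊`, smooth on the regular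
part and smooth in the lifted coordinates. -/
structure IsTestSource (𝒜 : Set (ConicChart n Mreg)) (O : Set M) (f : M × ℝ → 𝕜) : Prop where
  hasCompactSupport : HasCompactSupport f
  tsupport_subset : tsupport f ⊆ O ×ˢ Ioi (0 : ℝ)
  smooth_reg : ContMDiff ((𝓡 n).prod 𝓘(ℝ, ℝ)) 𝓘(ℝ, 𝕜) ∞ (fun p : Mreg × ℝ => f (p.1, p.2))
  smooth_lift : ∀ c ∈ 𝒜, ContDiffOn ℝ ∞ (fun q : (E c.k × E c.m) × ℝ => f (c.proj q.1, q.2))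
    (conicDomain c.W c.R ×ˢ univ)

variable [MeasurableSpace M]

/-- `u ∈ C¹([0,∞); L²(M)) ∩ C([0,∞); H¹(M))` is the finite energy solution of
`∂ₜ²u - Δ_g u = f` in `M × ℝ₊`, `u = ∂ₜu = 0` at `t = 0`: for every `w ∈ H¹(M)`,
`d/dt ⟨∂ₜu(t), w⟩ + Q(u(t), w) = ⟨f(t), w⟩`. Here `v = ∂ₜu`, and `A t` is the differential of
`u t`. -/
def IsWave (f : M × ℝ → 𝕜) (u : ℝ → Lp 𝕜 2 (vol n Mreg)) : Prop :=
  ∃ (v : ℝ → Lp 𝕜 2 (vol n Mreg)) (A : ℝ → CovectorField n Mreg 𝕜),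
    (∀ t ≥ 0, HasDerivWithinAt u (v t) (Ici 0) t) ∧
    ContinuousOn v (Ici 0) ∧
    (∀ t ≥ 0, IsH1 (u t) (A t)) ∧
    (∀ t ≥ 0, Tendsto (fun s => energy (fun x => A s x - A t x)) (𝓝[Ici 0] t) (𝓝 0)) ∧
    u 0 = 0 ∧ v 0 = 0 ∧
    ∀ (w : Lp 𝕜 2 (vol n Mreg)) (B : CovectorField n Mreg 𝕜), IsH1 w B → ∀ t ≥ 0,
      HasDerivWithinAt (fun s => l2Inner (v s) w)
        (l2Inner (toL2 (vol n Mreg) (fun x => f (x, t))) w - dirichletForm (A t) B) (Ici 0) t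

/-- The restriction to `O` of a source, as a curve in `L²(O)`. -/
def sourceOn (n : ℕ) (Mreg : TopologicalSpace.Opens M) [ChartedSpace (E n) Mreg]
    [RiemannianBundle (fun x : Mreg => TangentSpace (𝓡 n) x)]
    (O : Set M) (f : M × ℝ → 𝕜) (t : ℝ) : Lp 𝕜 2 ((vol n Mreg).restrict O) :=
  toL2 ((vol n Mreg).restrict O) (fun x => f (x, t))

/-- The restriction to `O` of a wave, as a curve in `L²(O)`; if `u = u^f` this is the value `V f`
of the source-to-solution map. -/
def waveOn (O : Set M) (u : ℝ → Lp 𝕜 2 (vol n Mreg)) (t : ℝ) :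
    Lp 𝕜 2 ((vol n Mreg).restrict O) :=
  LpToLpRestrictCLM M 𝕜 𝕜 (vol n Mreg) 2 O (u t)

end Waves

end ConicWave

end

open ConicWave

/-!
Both parts are consequences of the weak wave equation, tested against suitable elements of `H¹`.

*Inner products of waves.* A finite energy solution is a curve in a Hilbert space: the state lies in
`L²`, its differential in the space of square integrable covector fields, and the pair lies in the
graph `gradGraph` of the gradient (`IsWave.exists_energyWave`). For two such waves `u` and `u'` put
`Y t = ∫ u'` over `[t, 2T - t]` and
`S t = ⟪Y t, ∂ₜu t⟫ + ⟪u' t, u t⟫ + ⟪u' (2T - t), u t⟫`.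
Then `S 0 = 0` and `S T = 2 ⟪u' T, u T⟫`. The time average `Y t` is an admissible test function for
the equation of `u`, with gradient the time average of the gradients, and `u t` is one for the
equation of `u'` integrated over `[t, 2T - t]`. The two gradient terms cancel, so `S' t` contains
only pairings with the sources (`EnergyWave.blagovestchenskii`). As the sources are supported in
`O`, these pairings only involve the restrictions of the waves to `O` (`IsWave.inner_eq`).

*The mean of a wave.* Formally the test function is the constant `1`, which need not belong to `H¹`.
It is replaced by a cutoff function equal to `1` near the support of the wave at all times up to `t`
(`IsWave.integrable_and_integral_eq`). That this support is bounded is finite speed of propagation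
(`EnergyWave.ae_eq_zero_of_lt`): if a weight `a` satisfies `|da| ≤ λ a`, the energy with weight `a`
grows at most like `exp ((λ + 1) t)` (`EnergyWave.weighted_energy_le`). The weight
`exp (λ min ((d(x, x₀) - r)⁺, R))` equals `1` on the source and `exp (λ R)` at distance `R` from it,
so the energy there is of order `exp (-λ (R - t))` and vanishes for `t < R` as `λ → ∞`.

*The geometry behind this.* The distance comes from curves that may cross the singular part, so the
following facts about it have to be proved.
* A function with Lipschitz constant `κ` satisfies `|df| ≤ κ` on the regular part
  (`IsConicManifold.abs_regDiff_le`), since a `C¹` path in the regular part is an admissible path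
  (`IsAdmissiblePath.of_contMDiffOn`). The point is that it lifts to conic coordinate systems.
* Multiplication by Lipschitz functions acts on weakly differentiable functions by the product rule
  (`HasWeakDeriv.lipschitz_mul`), by mollification and Rademacher's theorem. Hence such functions
  give weights (`IsConicManifold.isWeight_mulLp`).
* Completeness implies that closed balls are compact (`IsConicManifold.properSpace`), as in the
  Hopf–Rinow theorem: admissible paths can be cut (`IsAdmissiblePath.subpath`), so there are points
  at a prescribed distance almost on the way to any other point.
* Compact sets have finite volume (`IsConicManifold.isLocallyFiniteMeasure_vol`), because the
  differential of a conic coordinate system stays bounded towards the singular part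
  (`ConicChart.norm_mfderiv_projReg_le`). So cutoff functions belong to `H¹`
  (`IsConicManifold.exists_isH1_cutoff`).

Square integrable covector fields are identified with square integrable functions into `𝕜ⁿ` through
a measurable orthonormal frame (`orthoFrame`), which is obtained by Gram–Schmidt orthogonalization
of coordinate frames.
-/

open Set Filter Topology MeasureTheory Bundle Manifold
open scoped Manifold ContDiff

noncomputable section

namespace ConicWave

set_option linter.unusedSectionVars false

/-! ### Waves in Hilbert space -/

section AbstractWave

variable {𝕜 H G : Type*} [RCLike 𝕜]
  [NormedAddCommGroup H] [InnerProductSpace 𝕜 H] [CompleteSpace H] [NormedSpace ℝ H]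
  [IsScalarTower ℝ 𝕜 H]
  [NormedAddCommGroup G] [InnerProductSpace 𝕜 G] [CompleteSpace G] [NormedSpace ℝ G]
  [IsScalarTower ℝ 𝕜 G]

/-- A finite energy wave in integrated form. The submodule `D` is the graph of the gradient, the
wave is `u t = ∫₀ᵗ v` with gradient `A t`, and the weak wave equation is integrated once in time.
The curves are continuous on the whole line, but only nonnegative times carry information. -/
structure EnergyWave (D : Submodule 𝕜 (H × G)) (f v : ℝ → H) (A : ℝ → G) : Prop where
  cont_f : Continuous f
  cont_v : Continuous v
  cont_A : Continuous A
  A_zero : A 0 = 0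
  mem : ∀ t ≥ 0, (∫ s in (0 : ℝ)..t, v s, A t) ∈ D
  weak : ∀ w ∈ D, ∀ t ≥ 0,
    inner 𝕜 w.1 (v t) = inner 𝕜 w.1 (∫ s in (0 : ℝ)..t, f s) - inner 𝕜 w.2 (∫ s in (0 : ℝ)..t, A s)

theorem hasDerivAt_primitive {g : ℝ → H} (hg : Continuous g) (a t : ℝ) :
    HasDerivAt (fun t => ∫ s in a..t, g s) (g t) t :=
  intervalIntegral.integral_hasDerivAt_right (hg.intervalIntegrable _ _)
    hg.stronglyMeasurable.stronglyMeasurableAtFilter hg.continuousAt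

theorem integral_comp_max_zero {a b : ℝ} (ha : 0 ≤ a) (hb : 0 ≤ b) (g : ℝ → H) :
    ∫ t in a..b, g (max t 0) = ∫ t in a..b, g t :=
  intervalIntegral.integral_congr fun t ht => by
    have : 0 ≤ t := (le_min ha hb).trans ht.1
    simp [this]

/-- The Steklov average of `g` over `[t, t + ε]`, as a difference quotient of the primitive. -/
def timeMean (g : ℝ → H) (ε t : ℝ) : H :=
  ε⁻¹ • ((∫ s in (0 : ℝ)..(t + ε), g s) - ∫ s in (0 : ℝ)..t, g s)

theorem timeMean_eq {g : ℝ → H} (hg : Continuous g) (ε t : ℝ) :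
    timeMean g ε t = ε⁻¹ • ∫ s in t..(t + ε), g s := by
  simp only [timeMean]
  rw [intervalIntegral.integral_interval_sub_left] <;> exact hg.intervalIntegrable _ _

theorem hasDerivAt_timeMean {g : ℝ → H} (hg : Continuous g) (ε t : ℝ) :
    HasDerivAt (timeMean g ε) (ε⁻¹ • (g (t + ε) - g t)) t :=
  (((hasDerivAt_primitive hg 0 (t + ε)).comp_add_const t ε).sub
    (hasDerivAt_primitive hg 0 t)).const_smul _

theorem tendsto_timeMean {g : ℝ → H} (hg : Continuous g) (t : ℝ) :
    Tendsto (fun ε => timeMean g ε t) (𝓝[>] 0) (𝓝 (g t)) :=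
  (hasDerivAt_primitive hg 0 t).tendsto_slope_zero_right

/-- The product rule for `⟪Y, v⟫` where `v` is differentiable only when tested against `Y t`. -/
theorem HasDerivAt.inner_of_weak {Y v : ℝ → H} {y : H} {d : 𝕜} {t : ℝ}
    (hY : HasDerivAt Y y t) (hv : ContinuousAt v t)
    (hd : HasDerivAt (fun s => inner 𝕜 (Y t) (v s)) d t) :
    HasDerivAt (fun s => inner 𝕜 (Y s) (v s)) (inner 𝕜 y (v t) + d) t := by
  have h1 : HasDerivAt (fun s => inner 𝕜 (Y s - Y t) (v s)) (inner 𝕜 y (v t)) t := by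
    rw [hasDerivAt_iff_tendsto_slope]
    have := (hasDerivAt_iff_tendsto_slope.1 hY).inner (𝕜 := 𝕜)
      (hv.tendsto.mono_left (nhdsWithin_le_nhds (s := {t}ᶜ)))
    refine this.congr fun s => ?_
    simp only [slope, vsub_eq_sub, sub_self, inner_zero_left, sub_zero]
    rw [← algebraMap_smul 𝕜 (s - t)⁻¹ (Y s - Y t), inner_smul_left, RCLike.algebraMap_eq_ofReal,
      RCLike.conj_ofReal, RCLike.real_smul_eq_coe_mul]
  refine (h1.add hd).congr_of_eventuallyEq (Eventually.of_forall fun s => ?_)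
  simp [inner_sub_left]

namespace EnergyWave

variable {D : Submodule 𝕜 (H × G)} {f v f' v' : ℝ → H} {A A' : ℝ → G}

/-- The integrated equation is continuous in the test pair, so test pairs may be taken from the
closure of the graph. -/
theorem weak_closure (hu : EnergyWave D f v A) {w : H × G} (hw : w ∈ D.topologicalClosure)
    {t : ℝ} (ht : 0 ≤ t) :
    inner 𝕜 w.1 (v t) =
      inner 𝕜 w.1 (∫ s in (0 : ℝ)..t, f s) - inner 𝕜 w.2 (∫ s in (0 : ℝ)..t, A s) := by
  have hcl : IsClosed {w : H × G | inner 𝕜 w.1 (v t) =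
      inner 𝕜 w.1 (∫ s in (0 : ℝ)..t, f s) - inner 𝕜 w.2 (∫ s in (0 : ℝ)..t, A s)} :=
    isClosed_eq (by fun_prop) (by fun_prop)
  have hsub : (D.topologicalClosure : Set (H × G)) ⊆ _ :=
    closure_minimal (fun w hw => hu.weak w hw t ht) hcl
  exact hsub hw

/-- Between two times the momentum changes by the integrated force. -/
theorem inner_sub (hu : EnergyWave D f v A) {w : H × G} (hw : w ∈ D.topologicalClosure)
    {a b : ℝ} (ha : 0 ≤ a) (hb : 0 ≤ b) :
    inner 𝕜 w.1 (v b - v a) =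
      inner 𝕜 w.1 (∫ s in a..b, f s) - inner 𝕜 w.2 (∫ s in a..b, A s) := by
  rw [inner_sub_right, hu.weak_closure hw ha, hu.weak_closure hw hb,
    ← intervalIntegral.integral_add_adjacent_intervals (hu.cont_f.intervalIntegrable 0 a)
      (hu.cont_f.intervalIntegrable a b),
    ← intervalIntegral.integral_add_adjacent_intervals (hu.cont_A.intervalIntegrable 0 a)
      (hu.cont_A.intervalIntegrable a b), inner_add_right, inner_add_right]
  ring

/-- The momentum, tested against a fixed element of the closed graph, is differentiable and satisfies
the weak wave equation pointwise in time. -/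
theorem hasDerivAt_inner (hu : EnergyWave D f v A) {w : H × G} (hw : w ∈ D.topologicalClosure)
    {t : ℝ} (ht : 0 < t) :
    HasDerivAt (fun s => inner 𝕜 w.1 (v s)) (inner 𝕜 w.1 (f t) - inner 𝕜 w.2 (A t)) t := by
  have h1 : HasDerivAt (fun s => inner 𝕜 w.1 (∫ r in (0 : ℝ)..s, f r)) (inner 𝕜 w.1 (f t)) t := by
    simpa using (hasDerivAt_const t w.1).inner 𝕜 (hasDerivAt_primitive hu.cont_f 0 t)
  have h2 : HasDerivAt (fun s => inner 𝕜 w.2 (∫ r in (0 : ℝ)..s, A r)) (inner 𝕜 w.2 (A t)) t := by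
    simpa using (hasDerivAt_const t w.2).inner 𝕜 (hasDerivAt_primitive hu.cont_A 0 t)
  refine (h1.sub h2).congr_of_eventuallyEq ?_
  filter_upwards [Ioi_mem_nhds ht] with s hs using hu.weak_closure hw (le_of_lt hs)

/-- Time averages of a wave stay in the closure of the graph of the gradient. -/
theorem integral_mem_closure (hu : EnergyWave D f v A) {a b : ℝ} (ha : 0 ≤ a) (hb : 0 ≤ b) :
    (∫ t in a..b, ∫ s in (0 : ℝ)..t, v s, ∫ t in a..b, A t) ∈ D.topologicalClosure := by
  -- the curve has values in the closed subspace `K`, hence so does its integral; composing with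
  -- `max t 0` makes the curve continuous into `K` on the whole line
  set K := D.topologicalClosure
  have hK : IsClosed (K : Set (H × G)) := D.isClosed_topologicalClosure
  have : CompleteSpace K := hK.completeSpace_coe
  have hcu : Continuous fun t => ∫ s in (0 : ℝ)..t, v s :=
    continuous_iff_continuousAt.2 fun t => (hasDerivAt_primitive hu.cont_v 0 t).continuousAt
  have hq : ∀ t, (∫ s in (0 : ℝ)..max t 0, v s, A (max t 0)) ∈ K := fun t =>
    D.le_topologicalClosure (hu.mem _ (le_max_right _ _))
  let q : ℝ → K := fun t => ⟨_, hq t⟩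
  have hqc : Continuous q := by
    refine Continuous.subtype_mk (Continuous.prodMk ?_ ?_) _
    · exact hcu.comp (continuous_id.max continuous_const)
    · exact hu.cont_A.comp (continuous_id.max continuous_const)
  let L : K →L[ℝ] H × G := (K.subtypeL).restrictScalars ℝ
  have hfst := ((ContinuousLinearMap.fst ℝ H G).comp L).intervalIntegral_comp_comm
    (hqc.intervalIntegrable (μ := volume) a b)
  have hsnd := ((ContinuousLinearMap.snd ℝ H G).comp L).intervalIntegral_comp_comm
    (hqc.intervalIntegrable (μ := volume) a b)
  have e : (∫ t in a..b, ∫ s in (0 : ℝ)..t, v s, ∫ t in a..b, A t) = L (∫ t in a..b, q t) := by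
    refine Prod.ext ?_ ?_
    · rw [← integral_comp_max_zero ha hb (fun t => ∫ s in (0 : ℝ)..t, v s)]; exact hfst
    · rw [← integral_comp_max_zero ha hb A]; exact hsnd
  rw [e]
  exact (∫ t in a..b, q t).2

/-- Blagovestchenskii's identity for two waves in Hilbert space. With `Y t = ∫ u'` over
`[t, 2T - t]`, the function `⟪Y, v⟫ + ⟪u' t, u t⟫ + ⟪u' (2T - t), u t⟫` vanishes at `0`, is twice
the left side at `T`, and its derivative is the integrand on the right. -/
theorem blagovestchenskii (hu : EnergyWave D f v A) (hu' : EnergyWave D f' v' A')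
    (hv0 : v 0 = 0) {T : ℝ} (hT : 0 < T) :
    2 * inner 𝕜 (∫ s in (0 : ℝ)..T, v' s) (∫ s in (0 : ℝ)..T, v s) =
      ∫ t in (0 : ℝ)..T, (inner 𝕜 (∫ r in t..(2 * T - t), ∫ s in (0 : ℝ)..r, v' s) (f t) -
        inner 𝕜 (∫ r in t..(2 * T - t), f' r) (∫ s in (0 : ℝ)..t, v s)) := by
  set u : ℝ → H := fun t => ∫ s in (0 : ℝ)..t, v s with hu_def
  set u' : ℝ → H := fun t => ∫ s in (0 : ℝ)..t, v' s with hu'_def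
  have du : ∀ t, HasDerivAt u (v t) t := hasDerivAt_primitive hu.cont_v 0
  have du' : ∀ t, HasDerivAt u' (v' t) t := hasDerivAt_primitive hu'.cont_v 0
  have cu : Continuous u := continuous_iff_continuousAt.2 fun t => (du t).continuousAt
  have cu' : Continuous u' := continuous_iff_continuousAt.2 fun t => (du' t).continuousAt
  have href : ∀ t, HasDerivAt (fun s : ℝ => 2 * T - s) (-1) t := fun t => by
    simpa using (hasDerivAt_id t).const_sub (2 * T)
  have primY : ∀ {g : ℝ → H}, Continuous g → ∀ t, (∫ r in t..(2 * T - t), g r) =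
        (∫ r in (0:ℝ)..(2 * T - t), g r) - ∫ r in (0:ℝ)..t, g r := fun hg t => by
    rw [intervalIntegral.integral_interval_sub_left] <;> exact hg.intervalIntegrable _ _
  set Y : ℝ → H := fun t => ∫ r in t..(2 * T - t), u' r with hY
  have dY : ∀ t, HasDerivAt Y (-u' (2 * T - t) - u' t) t := by
    intro t
    have h1 : HasDerivAt (fun t => ∫ r in (0:ℝ)..(2 * T - t), u' r) (-u' (2 * T - t)) t := by
      simpa [Function.comp_def] using (hasDerivAt_primitive cu' 0 (2 * T - t)).scomp t (href t)
    have := h1.sub (hasDerivAt_primitive cu' 0 t)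
    exact this.congr_of_eventuallyEq (Eventually.of_forall fun t => primY cu' t)
  have cY : Continuous Y := continuous_iff_continuousAt.2 fun t => (dY t).continuousAt
  have cZ : Continuous fun t => ∫ r in t..(2 * T - t), f' r := by
    have h0 : Continuous fun t => ∫ r in (0:ℝ)..t, f' r :=
      continuous_iff_continuousAt.2 fun t => (hasDerivAt_primitive hu'.cont_f 0 t).continuousAt
    simp_rw [primY hu'.cont_f]
    exact (h0.comp (by fun_prop)).sub h0
  set S : ℝ → 𝕜 := fun t => inner 𝕜 (Y t) (v t) + inner 𝕜 (u' t) (u t) +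
    inner 𝕜 (u' (2 * T - t)) (u t) with hS
  have cS : Continuous S := by
    have := hu.cont_v
    exact ((cY.inner this).add (cu'.inner cu)).add ((cu'.comp (by fun_prop)).inner cu)
  have dS : ∀ t ∈ Ioo 0 T, HasDerivAt S (inner 𝕜 (Y t) (f t) -
      inner 𝕜 (∫ r in t..(2 * T - t), f' r) (u t)) t := by
    intro t ht
    have h2 : 0 ≤ 2 * T - t := by linarith [ht.2]
    have hmem := hu'.integral_mem_closure (a := t) (b := 2 * T - t) ht.1.le h2
    have d1 := HasDerivAt.inner_of_weak (dY t) hu.cont_v.continuousAt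
      (hu.hasDerivAt_inner hmem ht.1)
    have d2 := (du' t).inner 𝕜 (du t)
    have d3 : HasDerivAt (fun t => u' (2 * T - t)) (-v' (2 * T - t)) t := by
      simpa [Function.comp_def] using (du' (2 * T - t)).scomp t (href t)
    have d4 := d3.inner 𝕜 (du t)
    -- the equation of the second wave, tested against `(u t, A t)`, cancels the gradient term of `d1`
    have key := congrArg (starRingEnd 𝕜)
      (hu'.inner_sub (D.le_topologicalClosure (hu.mem t ht.1.le)) ht.1.le h2)
    simp only [map_sub, inner_conj_symm, inner_sub_left] at key
    refine ((d1.add d2).add d4).congr_deriv ?_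
    simp only [inner_sub_left, inner_neg_left]
    change _ = _ - inner 𝕜 (∫ r in t..(2 * T - t), f' r) (∫ s in (0:ℝ)..t, v s)
    have key' : inner 𝕜 (∫ r in t..(2 * T - t), f' r) (∫ s in (0:ℝ)..t, v s) =
      inner 𝕜 (v' (2 * T - t)) (u t) - inner 𝕜 (v' t) (u t) +
        inner 𝕜 (∫ r in t..(2 * T - t), A' r) (A t) := by rw [key]; ring
    rw [key']
    ring
  have hftc := intervalIntegral.integral_eq_sub_of_hasDerivAt_of_le hT.le cS.continuousOn dS
    (Continuous.intervalIntegrable ((cY.inner hu.cont_f).sub (cZ.inner cu)) _ _)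
  have e0 : u 0 = 0 := by simp [hu_def]
  have eT : Y T = 0 := by simp only [hY]; rw [show 2 * T - T = T by ring]; simp
  rw [hftc]
  simp only [hS, e0, hv0, eT, show 2 * T - T = T by ring, inner_zero_left, inner_zero_right]
  ring

/-- A weight `m` on `H` and `M` on `G` is compatible with the gradient with slope `lam`: the
product rule holds, the commutator being small compared with the weights themselves. -/
structure IsWeight (D : Submodule 𝕜 (H × G)) (m : H →L[𝕜] H) (M : G →L[𝕜] G) (lam : ℝ) : Prop where
  m_symm : ∀ x y, inner 𝕜 (m x) y = inner 𝕜 x (m y)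
  M_symm : ∀ x y, inner 𝕜 (M x) y = inner 𝕜 x (M y)
  m_nonneg : ∀ x, 0 ≤ RCLike.re (inner 𝕜 (m x) x)
  M_nonneg : ∀ x, 0 ≤ RCLike.re (inner 𝕜 (M x) x)
  mul_mem : ∀ w ∈ D, ∃ C : G, (m w.1, M w.2 + C) ∈ D ∧ ∀ A : G,
    2 * ‖inner 𝕜 C A‖ ≤ lam * (RCLike.re (inner 𝕜 (M A) A) + RCLike.re (inner 𝕜 (m w.1) w.1))

theorem two_re_inner_le {m : H →L[𝕜] H} (hs : ∀ x y, inner 𝕜 (m x) y = inner 𝕜 x (m y))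
    (hp : ∀ x, 0 ≤ RCLike.re (inner 𝕜 (m x) x)) (x y : H) :
    2 * RCLike.re (inner 𝕜 (m x) y) ≤
      RCLike.re (inner 𝕜 (m x) x) + RCLike.re (inner 𝕜 (m y) y) := by
  have h := hp (x - y)
  have h2 : RCLike.re (inner 𝕜 (m y) x) = RCLike.re (inner 𝕜 (m x) y) := by
    rw [hs, ← inner_conj_symm, RCLike.conj_re]
  simp only [map_sub, inner_sub_left, inner_sub_right] at h
  linarith

theorem hasDerivAt_re_inner {m : H →L[𝕜] H}
    (hs : ∀ x y, inner 𝕜 (m x) y = inner 𝕜 x (m y))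
    {x : ℝ → H} {x' : H} {t : ℝ} (hx : HasDerivAt x x' t) :
    HasDerivAt (fun s => RCLike.re (inner 𝕜 (m (x s)) (x s)))
      (2 * RCLike.re (inner 𝕜 (m (x t)) x')) t := by
  have hm : HasDerivAt (fun s => m (x s)) (m x') t :=
    (m.restrictScalars ℝ).hasFDerivAt.comp_hasDerivAt t hx
  have := (RCLike.reCLM (K := 𝕜)).hasFDerivAt.comp_hasDerivAt t (hm.inner 𝕜 hx)
  refine this.congr_deriv ?_
  have h2 : RCLike.re (inner 𝕜 (m x') (x t)) = RCLike.re (inner 𝕜 (m (x t)) x') := by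
    rw [hs, ← inner_conj_symm, RCLike.conj_re]
  simp only [map_add, RCLike.reCLM_apply, h2]
  ring

/-- Gronwall bounds depend continuously on the initial value. -/
theorem continuous_gronwallBound_left (K ε x : ℝ) : Continuous fun δ => gronwallBound δ K ε x := by
  by_cases hK : K = 0
  · simp only [hK, gronwallBound_K0]; fun_prop
  · simp only [gronwallBound_of_K_ne_0 hK]; fun_prop

/-- The weighted energy of a wave grows at most exponentially, at a rate given by the slope of the
weight. The momentum `v` is not an admissible test function, so the energy identity is derived for
the Steklov averages over `[t, t + ε]`, whose momentum is a difference quotient of the wave. -/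
theorem weighted_energy_le (hu : EnergyWave D f v A) (hv0 : v 0 = 0)
    {m : H →L[𝕜] H} {M : G →L[𝕜] G} {lam F : ℝ} (hw : IsWeight D m M lam)
    (hf : ∀ t, m (f t) = f t) (hF : ∀ t, ‖f t‖ ≤ F) {t : ℝ} (ht : 0 ≤ t) :
    RCLike.re (inner 𝕜 (m (v t)) (v t)) + RCLike.re (inner 𝕜 (M (A t)) (A t)) ≤
      gronwallBound 0 (lam + 1) (F ^ 2) t := by
  let En : ℝ → ℝ → ℝ := fun ε t => RCLike.re (inner 𝕜 (m (timeMean v ε t)) (timeMean v ε t)) +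
    RCLike.re (inner 𝕜 (M (timeMean A ε t)) (timeMean A ε t))
  let Bε : ℝ → ℝ → G := fun ε t => ε⁻¹ • (A (t + ε) - A t)
  let aε : ℝ → ℝ → H := fun ε t => ε⁻¹ • (v (t + ε) - v t)
  have dE : ∀ ε t, HasDerivAt (En ε) (2 * RCLike.re (inner 𝕜 (m (timeMean v ε t)) (aε ε t)) +
      2 * RCLike.re (inner 𝕜 (M (timeMean A ε t)) (Bε ε t))) t := fun ε t =>
    (hasDerivAt_re_inner hw.m_symm (hasDerivAt_timeMean hu.cont_v ε t)).add
      (hasDerivAt_re_inner hw.M_symm (hasDerivAt_timeMean hu.cont_A ε t))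
  -- the averaged source is still fixed by the weight
  have hfm : ∀ ε t, m (timeMean f ε t) = timeMean f ε t := fun ε t => by
    rw [timeMean_eq hu.cont_f, ← algebraMap_smul 𝕜 ε⁻¹, map_smul]
    congr 1
    have := (m.restrictScalars ℝ).intervalIntegral_comp_comm
      (hu.cont_f.intervalIntegrable (μ := volume) t (t + ε))
    simp only [ContinuousLinearMap.coe_restrictScalars', hf] at this
    exact this.symm
  have hfF : ∀ ε > 0, ∀ t, ‖timeMean f ε t‖ ≤ F := fun ε hε t => by
    rw [timeMean_eq hu.cont_f, norm_smul, norm_inv, Real.norm_of_nonneg hε.le, inv_mul_le_iff₀ hε]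
    have := intervalIntegral.norm_integral_le_of_norm_le_const (a := t) (b := t + ε) (f := f)
      (C := F) fun x _ => hF x
    simpa [abs_of_pos hε, mul_comm] using this
  -- the averaged momentum is a difference quotient of the wave, so it has the gradient `Bε`
  have hmem : ∀ ε ≥ 0, ∀ t ≥ 0, (timeMean v ε t, Bε ε t) ∈ D := fun ε hε t ht => by
    have := D.smul_mem ((ε⁻¹ : ℝ) : 𝕜) (D.sub_mem (hu.mem (t + ε) (by positivity)) (hu.mem t ht))
    simp only [timeMean, Bε, RCLike.real_smul_eq_coe_smul (K := 𝕜)]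
    exact this
  have bound : ∀ ε > 0, ∀ t ≥ 0, 2 * RCLike.re (inner 𝕜 (m (timeMean v ε t)) (aε ε t)) +
      2 * RCLike.re (inner 𝕜 (M (timeMean A ε t)) (Bε ε t)) ≤ (lam + 1) * En ε t + F ^ 2 := by
    intro ε hε t ht
    -- test the equation against the weighted averaged momentum: the terms with `M (Bε ε t)` cancel,
    -- and the commutator `C` is absorbed by the energy
    obtain ⟨C, hC, hCb⟩ := hw.mul_mem _ (hmem ε hε.le t ht)
    have h1 : inner 𝕜 (m (timeMean v ε t)) (aε ε t) =
        inner 𝕜 (m (timeMean v ε t)) (timeMean f ε t) - inner 𝕜 (M (Bε ε t) + C) (timeMean A ε t) := by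
      have := hu.inner_sub (D.le_topologicalClosure hC) ht (b := t + ε) (by positivity)
      simp only [aε, timeMean_eq hu.cont_f, timeMean_eq hu.cont_A, RCLike.real_smul_eq_coe_smul (K := 𝕜),
        inner_smul_right] at this ⊢
      rw [this]; ring
    have h2 : RCLike.re (inner 𝕜 (M (timeMean A ε t)) (Bε ε t)) =
        RCLike.re (inner 𝕜 (M (Bε ε t)) (timeMean A ε t)) := by
      rw [hw.M_symm, ← inner_conj_symm, RCLike.conj_re]
    have h3 := two_re_inner_le hw.m_symm hw.m_nonneg (timeMean v ε t) (timeMean f ε t)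
    have h4 := hCb (timeMean A ε t)
    have h5 := (abs_le.1 (RCLike.abs_re_le_norm (inner 𝕜 C (timeMean A ε t)))).1
    have h6 : RCLike.re (inner 𝕜 (m (timeMean f ε t)) (timeMean f ε t)) ≤ F ^ 2 := by
      rw [hfm, inner_self_eq_norm_sq]
      exact pow_le_pow_left₀ (norm_nonneg _) (hfF ε hε t) 2
    have h7 := hw.M_nonneg (timeMean A ε t)
    rw [h1, h2]
    simp only [map_sub, inner_add_left, map_add, En]
    linarith
  have hE : ∀ ε > 0, En ε t ≤ gronwallBound (En ε 0) (lam + 1) (F ^ 2) t := by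
    intro ε hε
    have := le_gronwallBound_of_liminf_deriv_right_le (f := En ε) (a := 0) (b := t)
      (fun x _ => (dE ε x).continuousAt.continuousWithinAt)
      (fun x hx r hr => (dE ε x).hasDerivWithinAt.liminf_right_slope_le hr) le_rfl
      (fun x hx => bound ε hε x hx.1) t ⟨ht, le_rfl⟩
    simpa using this
  have lim : ∀ t, Tendsto (fun ε => En ε t) (𝓝[>] 0)
      (𝓝 (RCLike.re (inner 𝕜 (m (v t)) (v t)) + RCLike.re (inner 𝕜 (M (A t)) (A t)))) := by
    intro t
    have h1 : Tendsto (fun ε => timeMean v ε t) (𝓝[>] 0) (𝓝 (v t)) :=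
      tendsto_timeMean hu.cont_v t
    have h2 : Tendsto (fun ε => timeMean A ε t) (𝓝[>] 0) (𝓝 (A t)) :=
      tendsto_timeMean hu.cont_A t
    exact ((RCLike.continuous_re.tendsto _).comp
      (((m.continuous.tendsto _).comp h1).inner h1)).add
      ((RCLike.continuous_re.tendsto _).comp (((M.continuous.tendsto _).comp h2).inner h2))
  have lim0 : Tendsto (fun ε => gronwallBound (En ε 0) (lam + 1) (F ^ 2) t) (𝓝[>] 0)
      (𝓝 (gronwallBound 0 (lam + 1) (F ^ 2) t)) := by
    have := lim 0
    simp only [hv0, hu.A_zero, map_zero, inner_zero_left, add_zero] at this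
    exact ((continuous_gronwallBound_left (lam + 1) (F ^ 2) t).tendsto 0).comp this
  exact le_of_tendsto_of_tendsto (lim t) lim0
    (eventually_nhdsWithin_of_forall fun ε hε => hE ε hε)

end EnergyWave

end AbstractWave

/-! ### Weak derivatives and Lipschitz multipliers in Euclidean space -/

section Euclidean

variable {n : ℕ} {F : Type*} [NormedAddCommGroup F] [NormedSpace ℝ F]

open scoped Convolution in
/-- Mollification commutes with the (almost everywhere defined) derivative of a Lipschitz
function. -/
theorem fderiv_convolution_lipschitz {C : NNReal} {b : E n → ℝ} (hb : LipschitzWith C b)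
    (φ : ContDiffBump (0 : E n)) (x v : E n) :
    fderiv ℝ (φ.normed volume ⋆[ContinuousLinearMap.lsmul ℝ ℝ] b) x v =
      (φ.normed volume ⋆[ContinuousLinearMap.lsmul ℝ ℝ] fun y => lineDeriv ℝ b y v) x := by
  have hsm : ContDiff ℝ 1 (φ.normed volume ⋆[ContinuousLinearMap.lsmul ℝ ℝ] b) :=
    φ.hasCompactSupport_normed.contDiff_convolution_left _ φ.contDiff_normed
      hb.continuous.locallyIntegrable
  have hd := (hsm.differentiable one_ne_zero x).hasFDerivAt.hasLineDerivAt v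
  have h1 := hd.tendsto_slope_zero_right
  have hint : Integrable (fun y => φ.normed volume (x - y)) := by
    exact (φ.integrable_normed (μ := volume)).comp_sub_left x
  have h2 := hb.integral_inv_smul_sub_mul_tendsto_integral_lineDeriv_mul hint v
  have e : ∀ t : ℝ, (φ.normed volume ⋆[ContinuousLinearMap.lsmul ℝ ℝ] b) (x + t • v) =
      ∫ y, b (y + t • v) * φ.normed volume (x - y) := by
    intro t
    rw [convolution_def, ← integral_sub_left_eq_self _ volume x]
    refine integral_congr_ae (Eventually.of_forall fun y => ?_)
    simp only [ContinuousLinearMap.lsmul_apply, smul_eq_mul]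
    rw [mul_comm]; congr 2; abel
  have hi : ∀ t : ℝ, Integrable (fun y => b (y + t • v) * φ.normed volume (x - y)) := by
    intro t
    refine Continuous.integrable_of_hasCompactSupport ?_ ?_
    · have := hb.continuous
      have := φ.continuous_normed (μ := volume)
      fun_prop
    · refine HasCompactSupport.mul_left ?_
      exact φ.hasCompactSupport_normed.comp_homeomorph (Homeomorph.subLeft x)
  refine tendsto_nhds_unique h1 ?_
  have e3 : (φ.normed volume ⋆[ContinuousLinearMap.lsmul ℝ ℝ] fun y => lineDeriv ℝ b y v) x =
      ∫ y, lineDeriv ℝ b y v * φ.normed volume (x - y) := by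
    rw [convolution_eq_swap]
    exact integral_congr_ae (Eventually.of_forall fun y => mul_comm _ _)
  rw [e3]
  refine h2.congr fun t => ?_
  have e0 := e 0
  simp only [zero_smul, add_zero] at e0
  have hi0 := hi 0
  simp only [zero_smul, add_zero] at hi0
  rw [e t, e0, ← integral_sub (hi t) hi0, smul_eq_mul, ← integral_const_mul]
  refine integral_congr_ae (Eventually.of_forall fun y => ?_)
  simp only [smul_eq_mul]; ring

/-- `A` is the weak derivative of `u` in the direction `v` on the open set `U`. -/
structure HasWeakDeriv (U : Set (E n)) (u : E n → F) (v : E n) (A : E n → F) : Prop where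
  locallyIntegrableOn : LocallyIntegrableOn u U volume
  locallyIntegrableOn_deriv : LocallyIntegrableOn A U volume
  integral_eq : ∀ ψ : E n → ℝ, ContDiff ℝ ∞ ψ → HasCompactSupport ψ → tsupport ψ ⊆ U →
    ∫ y, fderiv ℝ ψ y v • u y = - ∫ y, ψ y • A y

theorem setIntegral_smul_eq_of_support {K : Set (E n)} {c : E n → ℝ} {u : E n → F}
    (hc : ∀ y ∉ K, c y = 0) : ∫ y in K, c y • u y = ∫ y, c y • u y :=
  setIntegral_eq_integral_of_forall_compl_eq_zero fun y hy => by simp [hc y hy]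

theorem lineDeriv_eq_zero_of_notMem_tsupport {b : E n → ℝ} {y v : E n} (hy : y ∉ tsupport b) :
    lineDeriv ℝ b y v = 0 := by
  have h : b =ᶠ[𝓝 y] fun _ => 0 := notMem_tsupport_iff_eventuallyEq.1 hy
  rw [h.lineDeriv_eq]; simp [lineDeriv]

open scoped Convolution in
/-- A weak derivative may be tested against Lipschitz functions of compact support. -/
theorem HasWeakDeriv.integral_lineDeriv_smul {U : Set (E n)} (hU : IsOpen U) {u A : E n → F}
    {v : E n} (h : HasWeakDeriv U u v A) {C : NNReal} {b : E n → ℝ} (hb : LipschitzWith C b)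
    (hbc : HasCompactSupport b) (hbU : tsupport b ⊆ U) :
    ∫ y, lineDeriv ℝ b y v • u y = - ∫ y, b y • A y := by
  obtain ⟨δ, hδ, hδU⟩ := hbc.isCompact.exists_cthickening_subset_open hU hbU
  set K := Metric.cthickening δ (tsupport b) with hK
  have hKc : IsCompact K := hbc.isCompact.cthickening
  -- the mollified functions `bk k` are test functions supported in `K`; they and their derivatives
  -- are uniformly bounded and converge almost everywhere to those of `b`
  let φ : ℕ → ContDiffBump (0 : E n) := fun k =>
    { rIn := δ / (2 * (k + 1)), rOut := δ / (k + 1), rIn_pos := by positivity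
      rIn_lt_rOut := by
        rw [div_lt_div_iff_of_pos_left hδ (by positivity) (by positivity)]
        have : (0 : ℝ) < k + 1 := by positivity
        linarith }
  have hφ0 : Tendsto (fun k => (φ k).rOut) atTop (𝓝 0) := by
    have := (tendsto_one_div_add_atTop_nhds_zero_nat (𝕜 := ℝ)).const_mul δ
    simpa [φ, div_eq_mul_inv] using this
  have hφK : ∀ᶠ k in atTop, (φ k).rOut ≤ 2 * (φ k).rIn := Eventually.of_forall fun k => by
    simp only [φ]
    apply le_of_eq
    field_simp
  let bk : ℕ → E n → ℝ := fun k => (φ k).normed volume ⋆[ContinuousLinearMap.lsmul ℝ ℝ] b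
  have hsm : ∀ k, ContDiff ℝ ∞ (bk k) := fun k =>
    (φ k).hasCompactSupport_normed.contDiff_convolution_left _ (φ k).contDiff_normed
      hb.continuous.locallyIntegrable
  have hsupp : ∀ k, tsupport (bk k) ⊆ K := fun k => by
    refine closure_minimal ((support_convolution_subset _).trans ?_) Metric.isClosed_cthickening
    rw [(φ k).support_normed_eq]
    rintro _ ⟨s, hs, t, ht, rfl⟩
    refine Metric.mem_cthickening_of_dist_le _ t δ _ (subset_tsupport _ ht) ?_
    have : ‖s‖ < δ / (k + 1) := by simpa [φ] using hs
    simp only [dist_eq_norm, add_sub_cancel_right]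
    refine this.le.trans (div_le_self hδ.le ?_)
    have : (0 : ℝ) ≤ k := by positivity
    linarith
  have hcs : ∀ k, HasCompactSupport (bk k) := fun k =>
    hKc.of_isClosed_subset (isClosed_tsupport _) (hsupp k)
  have hbz : ∀ k, ∀ y ∉ K, bk k y = 0 := fun k y hy =>
    image_eq_zero_of_notMem_tsupport fun h' => hy (hsupp k h')
  have hdz : ∀ k, ∀ y ∉ K, fderiv ℝ (bk k) y v = 0 := fun k y hy => by
    rw [fderiv_of_notMem_tsupport (𝕜 := ℝ) fun h' => hy (hsupp k h')]; rfl
  have hsub : tsupport b ⊆ K := Metric.self_subset_cthickening _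
  have hbz' : ∀ y ∉ K, b y = 0 := fun y hy =>
    image_eq_zero_of_notMem_tsupport fun h' => hy (hsub h')
  have hdz' : ∀ y ∉ K, lineDeriv ℝ b y v = 0 := fun y hy =>
    lineDeriv_eq_zero_of_notMem_tsupport fun h' => hy (hsub h')
  have hconv : ∀ (k : ℕ) (g : E n → ℝ) (R : ℝ), (∀ y, |g y| ≤ R) → ∀ x,
      |((φ k).normed volume ⋆[ContinuousLinearMap.lsmul ℝ ℝ] g) x| ≤ R := by
    intro k g R hg x
    rw [convolution_def]
    have h1 := norm_integral_le_of_norm_le (f := fun t => (ContinuousLinearMap.lsmul ℝ ℝ)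
      ((φ k).normed volume t) (g (x - t))) (μ := volume)
      (((φ k).integrable_normed (μ := volume)).mul_const R) (Eventually.of_forall fun t => by
        simp only [ContinuousLinearMap.lsmul_apply, smul_eq_mul, norm_mul, Real.norm_eq_abs,
          abs_of_nonneg ((φ k).nonneg_normed (μ := volume) t)]
        exact mul_le_mul_of_nonneg_left (hg _) ((φ k).nonneg_normed t))
    rwa [integral_mul_const, (φ k).integral_normed, one_mul] at h1
  have hdb : ∀ k y, |fderiv ℝ (bk k) y v| ≤ C * ‖v‖ := fun k y => by
    simp only [bk]
    rw [fderiv_convolution_lipschitz hb]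
    exact hconv k _ _ (fun z => norm_lineDeriv_le_of_lipschitz ℝ hb) y
  obtain ⟨R, hR⟩ := hbc.exists_bound_of_continuous hb.continuous
  have huK := h.locallyIntegrableOn.integrableOn_compact_subset hδU hKc
  have hAK := h.locallyIntegrableOn_deriv.integrableOn_compact_subset hδU hKc
  have lim1 : Tendsto (fun k => ∫ y in K, fderiv ℝ (bk k) y v • u y) atTop
      (𝓝 (∫ y in K, lineDeriv ℝ b y v • u y)) := by
    refine tendsto_integral_of_dominated_convergence (fun y => C * ‖v‖ * ‖u y‖) ?_
      (huK.norm.const_mul _) ?_ ?_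
    · intro k
      refine AEStronglyMeasurable.smul ?_ huK.aestronglyMeasurable
      exact (((hsm k).continuous_fderiv (by simp)).clm_apply continuous_const).aestronglyMeasurable
    · intro k
      refine Eventually.of_forall fun y => ?_
      rw [norm_smul]
      exact mul_le_mul_of_nonneg_right (hdb k y) (norm_nonneg _)
    · refine ae_restrict_of_ae ?_
      filter_upwards [ContDiffBump.ae_convolution_tendsto_right_of_locallyIntegrable
        (μ := volume) hφ0 hφK (hb.locallyIntegrable_lineDeriv v)] with y hy
      refine Tendsto.smul_const ?_ _
      refine hy.congr fun k => ?_
      exact (fderiv_convolution_lipschitz hb _ _ _).symm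
  have lim2 : Tendsto (fun k => ∫ y in K, bk k y • A y) atTop (𝓝 (∫ y in K, b y • A y)) := by
    refine tendsto_integral_of_dominated_convergence (fun y => R * ‖A y‖) ?_
      (hAK.norm.const_mul _) ?_ ?_
    · exact fun k => AEStronglyMeasurable.smul (hsm k).continuous.aestronglyMeasurable
        hAK.aestronglyMeasurable
    · intro k
      refine Eventually.of_forall fun y => ?_
      rw [norm_smul]
      exact mul_le_mul_of_nonneg_right (hconv k _ _ hR y) (norm_nonneg _)
    · refine Eventually.of_forall fun y => Tendsto.smul_const ?_ _
      exact ContDiffBump.convolution_tendsto_right_of_continuous hφ0 hb.continuous y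
  rw [setIntegral_smul_eq_of_support hdz'] at lim1
  rw [setIntegral_smul_eq_of_support hbz'] at lim2
  refine tendsto_nhds_unique lim1 (lim2.neg.congr fun k => ?_)
  rw [setIntegral_smul_eq_of_support (hdz k), setIntegral_smul_eq_of_support (hbz k)]
  exact (h.integral_eq _ (hsm k) (hcs k) ((hsupp k).trans hδU)).symm

/-- Compactly supported locally Lipschitz functions are globally Lipschitz. -/
theorem LocallyLipschitz.exists_lipschitzWith_of_hasCompactSupport {b : E n → ℝ}
    (hb : LocallyLipschitz b) (hc : HasCompactSupport b) : ∃ C, LipschitzWith C b := by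
  obtain ⟨r, hr⟩ := hc.isCompact.isBounded.subset_closedBall (0 : E n)
  obtain ⟨C, hC⟩ := LocallyLipschitzOn.exists_lipschitzOnWith_of_compact
    (isCompact_closedBall (0 : E n) (r + 1)) hb.locallyLipschitzOn
  obtain ⟨R, hR⟩ := hc.exists_bound_of_continuous hb.continuous
  have hR0 : 0 ≤ R := (norm_nonneg _).trans (hR 0)
  have hz : ∀ y, r < ‖y‖ → b y = 0 := fun y hy => by
    by_contra h
    have := hr (subset_tsupport _ h)
    simp at this
    linarith
  refine ⟨C + R.toNNReal, LipschitzWith.of_dist_le_mul fun x y => ?_⟩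
  -- a point of the support and a point of norm larger than `r + 1` are at distance at least `1`
  have aux : ∀ x y : E n, r + 1 < ‖y‖ → dist (b x) (b y) ≤ R * dist x y := fun x y hy => by
    rw [hz y (by linarith), dist_zero_right]
    rcases le_or_gt ‖x‖ r with hx | hx
    · have h1 : 1 ≤ dist x y := by
        rw [dist_comm, dist_eq_norm]
        have := norm_sub_norm_le y x
        linarith
      exact (hR x).trans (le_mul_of_one_le_right hR0 h1)
    · rw [hz x hx, norm_zero]; positivity
  rw [NNReal.coe_add, Real.coe_toNNReal R hR0, add_mul]
  have hC0 : 0 ≤ (C : ℝ) * dist x y := by positivity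
  have hR1 : 0 ≤ R * dist x y := by positivity
  rcases le_or_gt ‖y‖ (r + 1) with hy | hy
  · rcases le_or_gt ‖x‖ (r + 1) with hx | hx
    · have := hC.dist_le_mul x (by simpa using hx) y (by simpa using hy)
      linarith
    · have := aux y x hx
      rw [dist_comm, dist_comm y x] at this
      linarith
  · have := aux x y hy
    linarith

/-- A test function times a locally Lipschitz function on `U`, extended by zero, is Lipschitz on the
whole space. -/
theorem exists_lipschitzWith_mul {U : Set (E n)} (hU : IsOpen U) {ψ a : E n → ℝ}
    (hψ : ContDiff ℝ ∞ ψ) (hψc : HasCompactSupport ψ) (hψU : tsupport ψ ⊆ U)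
    (ha : LocallyLipschitzOn U a) : ∃ C, LipschitzWith C (fun y => ψ y * a y) := by
  refine LocallyLipschitz.exists_lipschitzWith_of_hasCompactSupport ?_ hψc.mul_right
  intro x
  by_cases hx : x ∈ U
  · obtain ⟨C₁, s, hs, h1⟩ := ha hx
    rw [hU.nhdsWithin_eq hx] at hs
    obtain ⟨C₂, t, ht, h2⟩ := (hψ.of_le (by simp) : ContDiff ℝ 1 ψ).locallyLipschitz x
    have hac : ContinuousAt a x := (ha.continuousOn x hx).continuousAt (hU.mem_nhds hx)
    have e1 : ∀ᶠ y in 𝓝 x, |a y| < |a x| + 1 := hac.abs.eventually (gt_mem_nhds (by linarith))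
    have e2 : ∀ᶠ y in 𝓝 x, |ψ y| < |ψ x| + 1 :=
      hψ.continuous.continuousAt.abs.eventually (gt_mem_nhds (by linarith))
    refine ⟨(|ψ x| + 1).toNNReal * C₁ + (|a x| + 1).toNNReal * C₂,
      _, inter_mem (inter_mem hs ht) (e1.and e2), ?_⟩
    refine LipschitzOnWith.of_dist_le_mul fun y hy z hz => ?_
    have d1 := h1.dist_le_mul y hy.1.1 z hz.1.1
    have d2 := h2.dist_le_mul y hy.1.2 z hz.1.2
    rw [Real.dist_eq] at d1 d2 ⊢
    have e : ψ y * a y - ψ z * a z = ψ y * (a y - a z) + a z * (ψ y - ψ z) := by ring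
    rw [e]
    refine (abs_add_le _ _).trans ?_
    rw [abs_mul, abs_mul]
    rw [NNReal.coe_add, NNReal.coe_mul, NNReal.coe_mul, Real.coe_toNNReal _ (by positivity),
      Real.coe_toNNReal _ (by positivity), add_mul, mul_assoc, mul_assoc]
    refine add_le_add ?_ ?_
    · exact mul_le_mul hy.2.2.le d1 (abs_nonneg _) (by positivity)
    · exact mul_le_mul hz.2.1.le d2 (abs_nonneg _) (by positivity)
  · have hx' : x ∉ tsupport ψ := fun h => hx (hψU h)
    have h0 := notMem_tsupport_iff_eventuallyEq.1 hx'
    refine ⟨0, _, h0, LipschitzOnWith.of_dist_le_mul fun y hy z hz => ?_⟩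
    have hy : ψ y = 0 := hy
    have hz : ψ z = 0 := hz
    simp [hy, hz]

/-- The product rule for weak derivatives and locally Lipschitz multipliers. -/
theorem HasWeakDeriv.lipschitz_mul {U : Set (E n)} (hU : IsOpen U) {u A : E n → F} {v : E n}
    (h : HasWeakDeriv U u v A) {a da : E n → ℝ} (ha : LocallyLipschitzOn U a)
    (hda : ∀ᵐ y, y ∈ U → HasLineDerivAt ℝ a (da y) y v) :
    HasWeakDeriv U (fun y => a y • u y) v (fun y => a y • A y + da y • u y) := by
  have hau := h.locallyIntegrableOn.continuousOn_smul hU.isLocallyClosed ha.continuousOn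
  have haA := h.locallyIntegrableOn_deriv.continuousOn_smul hU.isLocallyClosed ha.continuousOn
  -- near each point `da` agrees with the derivative of a globally Lipschitz function
  have hdu : LocallyIntegrableOn (fun y => da y • u y) U := by
    intro x hx
    obtain ⟨r, hr, hrU⟩ := Metric.nhds_basis_closedBall.mem_iff.1 (hU.mem_nhds hx)
    let ψ : ContDiffBump x := ⟨r / 2, r, by positivity, by linarith⟩
    obtain ⟨C, hC⟩ := exists_lipschitzWith_mul hU ψ.contDiff ψ.hasCompactSupport
      (by rw [ψ.tsupport_eq]; exact hrU) ha
    set s := Metric.ball x (r / 2) with hs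
    have hsU : s ⊆ U := (Metric.ball_subset_closedBall.trans
      (Metric.closedBall_subset_closedBall (by linarith))).trans hrU
    have hus : IntegrableOn u s := (h.locallyIntegrableOn.integrableOn_compact_subset
      hrU (isCompact_closedBall x r)).mono_set
        (Metric.ball_subset_closedBall.trans (Metric.closedBall_subset_closedBall (by linarith)))
    refine ⟨s, mem_nhdsWithin_of_mem_nhds (Metric.ball_mem_nhds x (by positivity)), ?_⟩
    have hae : ∀ᵐ y ∂volume.restrict s, lineDeriv ℝ (fun y => ψ y * a y) y v = da y := by
      filter_upwards [ae_restrict_of_ae hda, ae_restrict_mem Metric.isOpen_ball.measurableSet]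
        with y hy hys
      have : (fun y => ψ y * a y) =ᶠ[𝓝 y] a := by
        filter_upwards [Metric.isOpen_ball.mem_nhds hys] with z hz
        have : ψ z = 1 := ψ.one_of_mem_closedBall (Metric.ball_subset_closedBall hz)
        rw [this, one_mul]
      rw [this.lineDeriv_eq, (hy (hsU hys)).lineDeriv]
    have hi := hus.bdd_smul (C * ‖v‖)
      (aestronglyMeasurable_lineDeriv (v := v) hC.continuous (volume.restrict s))
      (Eventually.of_forall fun y => norm_lineDeriv_le_of_lipschitz ℝ hC)
    refine hi.congr ?_
    filter_upwards [hae] with y hy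
    simp [hy]
  refine ⟨hau, haA.add hdu, fun ψ hψ hψc hψU => ?_⟩
  obtain ⟨C, hC⟩ := exists_lipschitzWith_mul hU hψ hψc hψU ha
  have hbsub : tsupport (fun y => ψ y * a y) ⊆ tsupport ψ :=
    closure_mono (Function.support_mul_subset_left _ _)
  -- test the weak derivative of `u` against the Lipschitz function `ψ * a`, and expand its derivative
  have key := h.integral_lineDeriv_smul hU hC hψc.mul_right (hbsub.trans hψU)
  have hK : IsCompact (tsupport ψ) := hψc
  have hau' := hau.integrableOn_compact_subset hψU hK
  have haA' := haA.integrableOn_compact_subset hψU hK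
  have hdu' := hdu.integrableOn_compact_subset hψU hK
  obtain ⟨R, hR⟩ := hψc.exists_bound_of_continuous hψ.continuous
  have hψz : ∀ y ∉ tsupport ψ, ψ y = 0 := fun y hy => image_eq_zero_of_notMem_tsupport hy
  have hψz' : ∀ y ∉ tsupport ψ, fderiv ℝ ψ y v = 0 := fun y hy => by
    rw [fderiv_of_notMem_tsupport (𝕜 := ℝ) hy]; rfl
  have hcd : Continuous fun y => fderiv ℝ ψ y v :=
    (hψ.continuous_fderiv (by simp)).clm_apply continuous_const
  obtain ⟨R', hR'⟩ := (hψc.fderiv_apply (𝕜 := ℝ) v).exists_bound_of_continuous hcd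
  have I : ∀ {w : E n → F}, IntegrableOn w (tsupport ψ) → Integrable (fun y => ψ y • w y) :=
    fun hw => by
      rw [← integrableOn_iff_integrable_of_support_subset (s := tsupport ψ)]
      · exact hw.bdd_smul R hψ.continuous.aestronglyMeasurable
          (Eventually.of_forall hR)
      · intro y hy
        by_contra hy'
        exact hy (by simp [hψz y hy'])
  have I' : Integrable (fun y => fderiv ℝ ψ y v • (a y • u y)) := by
    rw [← integrableOn_iff_integrable_of_support_subset (s := tsupport ψ)]
    · exact hau'.bdd_smul R' hcd.aestronglyMeasurable
        (Eventually.of_forall hR')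
    · intro y hy
      by_contra hy'
      exact hy (by simp [hψz' y hy'])
  have e1 : (fun y => lineDeriv ℝ (fun y => ψ y * a y) y v • u y) =ᵐ[volume]
      fun y => fderiv ℝ ψ y v • (a y • u y) + ψ y • (da y • u y) := by
    filter_upwards [hda] with y hy
    by_cases hyK : y ∈ tsupport ψ
    · have h1 := ((hψ.differentiable (by simp) y).hasFDerivAt.hasLineDerivAt v)
      have h2 : HasLineDerivAt ℝ (fun y => ψ y * a y)
          (fderiv ℝ ψ y v * a y + ψ y * da y) y v := by
        have := HasDerivAt.mul (h1 : HasDerivAt _ _ _) (hy (hψU hyK) : HasDerivAt _ _ _)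
        have h3 : HasDerivAt (fun t : ℝ => ψ (y + t • v) * a (y + t • v)) _ 0 := this
        simpa only [HasLineDerivAt, zero_smul, add_zero] using h3
      rw [h2.lineDeriv, add_smul, mul_smul, mul_smul]
    · rw [lineDeriv_eq_zero_of_notMem_tsupport fun h' => hyK (hbsub h'), hψz y hyK, hψz' y hyK]
      simp
  rw [integral_congr_ae e1, integral_add I' (I hdu')] at key
  have e2 : ∫ y, ψ y • (a y • A y + da y • u y) =
      (∫ y, (ψ y * a y) • A y) + ∫ y, ψ y • (da y • u y) := by
    simp only [smul_add, mul_smul]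
    exact integral_add (I haA') (I hdu')
  rw [e2, neg_add, ← key]
  abel

end Euclidean

/-! ### Piecewise smooth paths and their lifts -/

section Piecewise

variable {F : Type*} [NormedAddCommGroup F] [NormedSpace ℝ F]
    {N : Type*} [TopologicalSpace N] [ChartedSpace F N]

theorem PiecewiseC1On.of_contMDiffOn {γ : ℝ → N} {a b : ℝ}
    (h : ContMDiffOn 𝓘(ℝ, ℝ) 𝓘(ℝ, F) 1 γ (Icc a b)) : PiecewiseC1On (F := F) γ a b :=
  ⟨∅, finite_empty, fun _ _ hs _ ht _ => h.mono (Icc_subset_Icc hs ht)⟩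

theorem PiecewiseC1On.congr {γ γ' : ℝ → N} {a b : ℝ} (h : PiecewiseC1On (F := F) γ a b)
    (he : EqOn γ' γ (Icc a b)) : PiecewiseC1On (F := F) γ' a b := by
  obtain ⟨P, hP, h⟩ := h
  exact ⟨P, hP, fun s t hs hst ht hd => (h s t hs hst ht hd).congr
    fun x hx => he (Icc_subset_Icc hs ht hx)⟩

theorem PiecewiseC1On.trans {γ : ℝ → N} {a b c : ℝ} (h : PiecewiseC1On (F := F) γ a b)
    (h' : PiecewiseC1On (F := F) γ b c) : PiecewiseC1On (F := F) γ a c := by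
  obtain ⟨P, hP, h⟩ := h
  obtain ⟨P', hP', h'⟩ := h'
  refine ⟨insert b (P ∪ P'), (hP.union hP').insert b, fun s t hs hst ht hd => ?_⟩
  have hb : b ∉ Ioo s t := fun hb => hd.le_bot ⟨hb, mem_insert _ _⟩
  have hd1 : Disjoint (Ioo s t) P :=
    hd.mono_right (subset_union_left.trans (subset_insert _ _))
  have hd2 : Disjoint (Ioo s t) P' :=
    hd.mono_right (subset_union_right.trans (subset_insert _ _))
  rcases le_or_gt t b with htb | htb
  · exact h s t hs hst htb hd1
  · have : b ≤ s := by
      by_contra hbs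
      exact hb ⟨not_le.1 hbs, htb⟩
    exact h' s t this hst ht hd2

/-- The constant `c` and factor `d` describe the reparametrization `t ↦ c + d * t`. -/
theorem PiecewiseC1On.comp_affine {γ : ℝ → N} {a b c d : ℝ} (hd : 0 < d)
    (h : PiecewiseC1On (F := F) γ (c + d * a) (c + d * b)) :
    PiecewiseC1On (F := F) (fun t => γ (c + d * t)) a b := by
  obtain ⟨P, hP, h⟩ := h
  have hinj : Function.Injective fun t : ℝ => c + d * t := fun x y hxy => by
    simpa [hd.ne'] using hxy
  refine ⟨(fun t => c + d * t) ⁻¹' P, hP.preimage hinj.injOn, fun s t hs hst ht hdis => ?_⟩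
  have h1 := h (c + d * s) (c + d * t) (by gcongr) (by gcongr) (by gcongr) ?_
  · refine h1.comp (t := Icc (c + d * s) (c + d * t)) ?_ ?_
    · exact (contMDiff_iff_contDiff.2 (by fun_prop : ContDiff ℝ 1 fun t : ℝ => c + d * t)).contMDiffOn
    · intro x hx
      exact ⟨by have := hx.1; dsimp only; gcongr, by have := hx.2; dsimp only; gcongr⟩
  · rw [Set.disjoint_left] at hdis ⊢
    intro x hx hxP
    have e : c + d * ((x - c) / d) = x := by field_simp; ring
    refine hdis (a := (x - c) / d) ⟨?_, ?_⟩ (by simpa [e] using hxP)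
    · rw [lt_div_iff₀ hd]; linarith [hx.1]
    · rw [div_lt_iff₀ hd]; linarith [hx.2]

end Piecewise

section Geometry

variable {n : ℕ} {M : Type*} [MetricSpace M] {Mreg : TopologicalSpace.Opens M}
  [ChartedSpace (E n) Mreg]
  [RiemannianBundle (fun x : Mreg => TangentSpace (𝓡 n) x)]

namespace ConicChart

variable (c : ConicChart n Mreg)

theorem isOpen_domain : IsOpen (conicDomain (m := c.m) c.W c.R) :=
  c.isOpen_W.prod Metric.isOpen_ball

theorem isOpen_domainReg : IsOpen (conicDomainReg (m := c.m) c.W c.R) := by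
  have : conicDomainReg (m := c.m) c.W c.R = conicDomain c.W c.R ∩ {p | p.2 ≠ 0} := rfl
  rw [this]
  exact c.isOpen_domain.inter (isOpen_ne_fun continuous_snd continuous_const)

/-- Near a time at which a path is regular, the path lifts through a local inverse of `projReg`. -/
theorem exists_local_lift {ν : ℝ → Mreg} {t₀ : ℝ}
    (him : (ν t₀ : M) ∈ c.proj '' conicDomain c.W c.R) :
    ∃ (V : Set Mreg) (σ : Mreg → E c.k × E c.m), IsOpen V ∧ ν t₀ ∈ V ∧
      (∀ x ∈ V, σ x ∈ conicDomain c.W c.R ∧ c.proj (σ x) = x) ∧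
      ContMDiffOn (𝓡 n) 𝓘(ℝ, E c.k × E c.m) 1 σ V := by
  obtain ⟨p, hp, hpν⟩ := him
  have hpr : p ∈ conicDomainReg c.W c.R :=
    ⟨hp, (c.mem_reg p hp).1 (hpν ▸ (ν t₀).2)⟩
  have hproj : c.projReg p = ν t₀ := Subtype.ext ((c.coe_projReg p hpr).trans hpν)
  obtain ⟨Φ, hΦp, hΦ⟩ := c.localDiffeo ⟨p, hpr⟩
  have hcont : ContinuousOn Φ.symm Φ.target := Φ.contMDiffOn_invFun.continuousOn
  refine ⟨Φ.target ∩ Φ.symm ⁻¹' (conicDomainReg c.W c.R), Φ.symm,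
    hcont.isOpen_inter_preimage Φ.open_target c.isOpen_domainReg, ⟨?_, ?_⟩, ?_, ?_⟩
  · rw [← hproj, hΦ hΦp]; exact Φ.map_source' hΦp
  · rw [mem_preimage, ← hproj, hΦ hΦp]
    have : Φ.symm (Φ p) = p := Φ.left_inv' hΦp
    rw [this]; exact hpr
  · rintro x ⟨hx, hx'⟩
    refine ⟨hx'.1, ?_⟩
    rw [← c.coe_projReg _ hx']
    exact congrArg Subtype.val ((hΦ (Φ.map_target' hx)).trans (Φ.right_inv' hx))
  · exact (Φ.contMDiffOn_invFun.of_le (by simp)).mono inter_subset_left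

/-- A `C¹` path in the regular part that stays in the image of a conic chart has a piecewise `C¹`
lift: the local lifts are matched at the breakpoints by elements of the group. -/
theorem exists_lift {ν : ℝ → Mreg} {a b : ℝ} (hab : a ≤ b)
    (hν : ContMDiffOn 𝓘(ℝ, ℝ) (𝓡 n) 1 ν (Icc a b))
    (him : ∀ t ∈ Icc a b, (ν t : M) ∈ c.proj '' conicDomain c.W c.R) :
    ∃ γ : ℝ → E c.k × E c.m, PiecewiseC1On (F := E c.k × E c.m) γ a b ∧
      ∀ t ∈ Icc a b, γ t ∈ conicDomain c.W c.R ∧ c.proj (γ t) = ν t := by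
  choose! V σ hVo hVt hσ hσC using
    fun t (ht : t ∈ Icc a b) => c.exists_local_lift (him t ht)
  have hcν : Continuous fun t : Icc a b => ν t := hν.continuousOn.domRestrict
  obtain ⟨τ, hτ0, hτm, ⟨k, hk⟩, hτ⟩ := exists_monotone_Icc_subset_open_cover_Icc hab
    (c := fun t : Icc a b => (fun s : Icc a b => ν s) ⁻¹' V t)
    (fun t => (hVo t t.2).preimage hcν)
    (fun t _ => mem_iUnion.2 ⟨t, hVt t t.2⟩)
  -- the subdivision `τ` is fine enough for a local lift to exist on each piece; lift up to `τ j`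
  have main : ∀ j, ∃ γ : ℝ → E c.k × E c.m, PiecewiseC1On (F := E c.k × E c.m) γ a (τ j) ∧
      ∀ t ∈ Icc a (τ j : ℝ), γ t ∈ conicDomain c.W c.R ∧ c.proj (γ t) = ν t := by
    have hloc : ∀ j, ∃ s ∈ Icc a b, ∀ t ∈ Icc (τ j : ℝ) (τ (j + 1)), ν t ∈ V s := by
      intro j
      obtain ⟨s, hs⟩ := hτ j
      refine ⟨s, s.2, fun t ht => ?_⟩
      have htab : t ∈ Icc a b := ⟨(τ j).2.1.trans ht.1, ht.2.trans (τ (j + 1)).2.2⟩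
      exact hs (show (⟨t, htab⟩ : Icc a b) ∈ _ from ⟨ht.1, ht.2⟩)
    intro j
    induction j with
    | zero =>
      refine ⟨fun _ => σ a (ν a), PiecewiseC1On.of_contMDiffOn contMDiffOn_const, ?_⟩
      intro t ht
      rw [hτ0] at ht
      have : t = a := le_antisymm ht.2 ht.1
      subst this
      exact hσ t (left_mem_Icc.2 hab) _ (hVt t (left_mem_Icc.2 hab))
    | succ j ih =>
      obtain ⟨γ, hγ, hγl⟩ := ih
      obtain ⟨s, hs, hsV⟩ := hloc j
      have hjj : (τ j : ℝ) ≤ τ (j + 1) := hτm (Nat.le_succ j)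
      have haj : a ≤ τ j := (τ j).2.1
      have h1 := hγl (τ j) (right_mem_Icc.2 haj)
      have h2 := hσ s hs _ (hsV (τ j) (left_mem_Icc.2 hjj))
      -- the lift so far and the next local lift end over the same point, so an element `g` of the
      -- group carries one to the other
      obtain ⟨g, hgΓ, hg⟩ := (c.fiber _ h2.1 _ h1.1).1 (h2.2.trans h1.2.symm)
      let L : E c.k × E c.m →L[ℝ] E c.k × E c.m :=
        (ContinuousLinearMap.id ℝ (E c.k)).prodMap (g : E c.m ≃ₗᵢ[ℝ] E c.m).toContinuousLinearEquiv
      have hL : ∀ q, L q = (q.1, g q.2) := fun q => rfl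
      have hLd : ∀ q ∈ conicDomain (m := c.m) c.W c.R,
          L q ∈ conicDomain c.W c.R ∧ c.proj (L q) = c.proj q := by
        intro q hq
        have : L q ∈ conicDomain c.W c.R := by
          refine ⟨hq.1, ?_⟩
          have := hq.2
          simpa [hL] using this
        exact ⟨this, ((c.fiber q hq _ this).2 ⟨g, hgΓ, rfl⟩).symm⟩
      let γ' : ℝ → E c.k × E c.m := fun t => if t ≤ τ j then γ t else L (σ s (ν t))
      have e1 : EqOn γ' γ (Icc a (τ j)) := fun t ht => if_pos ht.2
      have e2 : EqOn γ' (fun t => L (σ s (ν t))) (Icc (τ j) (τ (j + 1))) := by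
        intro t ht
        rcases ht.1.eq_or_lt with h | h
        · subst h
          simp only [γ', le_refl, if_true]
          rw [hg, hL]
        · exact if_neg (not_le.2 h)
      refine ⟨γ', (hγ.congr e1).trans (PiecewiseC1On.congr ?_ e2), ?_⟩
      · refine PiecewiseC1On.of_contMDiffOn ?_
        have hc1 := (hσC s hs).comp (hν.mono (Icc_subset_Icc haj (τ (j + 1)).2.2))
          (fun t ht => hsV t ht)
        exact (L.contMDiff (n := 1)).comp_contMDiffOn hc1
      · intro t ht
        rcases le_or_gt t (τ j) with h | h
        · rw [e1 ⟨ht.1, h⟩]; exact hγl t ⟨ht.1, h⟩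
        · have ht' : t ∈ Icc (τ j : ℝ) (τ (j + 1)) := ⟨h.le, ht.2⟩
          rw [e2 ht']
          have h3 := hσ s hs _ (hsV t ht')
          exact ⟨(hLd _ h3.1).1, (hLd _ h3.1).2.trans h3.2⟩
  have := main k
  rwa [hk k le_rfl] at this

end ConicChart

/-- A `C¹` path in the regular part is admissible. -/
theorem IsAdmissiblePath.of_contMDiffOn (𝒜 : Set (ConicChart n Mreg)) {ν : ℝ → Mreg}
    (hν : ContMDiffOn 𝓘(ℝ, ℝ) (𝓡 n) 1 ν (Icc 0 1)) :
    IsAdmissiblePath 𝒜 (fun t => (ν t : M)) ν where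
  continuousOn := continuous_subtype_val.comp_continuousOn hν.continuousOn
  finite := by simp
  regular _ _ _ := rfl
  piecewise a b ha _ hb _ := PiecewiseC1On.of_contMDiffOn (hν.mono (Icc_subset_Icc ha hb))
  lift c _ a b ha hab hb him := c.exists_lift hab (hν.mono (Icc_subset_Icc ha hb)) him

/-- The restriction of an admissible path to `[s, t]`, reparametrized affinely by `[0, 1]`, is
admissible. -/
theorem IsAdmissiblePath.subpath {𝒜 : Set (ConicChart n Mreg)} {μ : ℝ → M} {ν : ℝ → Mreg}
    (h : IsAdmissiblePath 𝒜 μ ν) {s t : ℝ} (hs : 0 ≤ s) (hst : s < t) (ht : t ≤ 1) :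
    IsAdmissiblePath 𝒜 (fun τ => μ (s + (t - s) * τ)) (fun τ => ν (s + (t - s) * τ)) := by
  have hd : 0 < t - s := sub_pos.2 hst
  have hmaps : MapsTo (fun τ => s + (t - s) * τ) (Icc 0 1) (Icc (0 : ℝ) 1) := fun τ hτ => by
    constructor
    · have := hτ.1; positivity
    · have := mul_le_mul_of_nonneg_left hτ.2 hd.le
      dsimp only; linarith
  have hsub : ∀ {a b : ℝ}, ∀ x ∈ Icc (s + (t - s) * a) (s + (t - s) * b),
      ∃ y ∈ Icc a b, s + (t - s) * y = x := fun x hx =>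
    ⟨(x - s) / (t - s), ⟨by rw [le_div_iff₀ hd]; linarith [hx.1],
      by rw [div_le_iff₀ hd]; linarith [hx.2]⟩, by field_simp; ring⟩
  have hinj : Function.Injective fun τ : ℝ => s + (t - s) * τ := fun x y hxy => by
    simpa [hd.ne'] using hxy
  refine ⟨h.continuousOn.comp (by fun_prop) hmaps, ?_, fun τ hτ => h.regular _ (hmaps hτ), ?_, ?_⟩
  · exact (h.finite.preimage hinj.injOn).subset fun τ hτ => ⟨hmaps hτ.1, hτ.2⟩
  · intro a b ha hab hb hreg
    refine PiecewiseC1On.comp_affine hd (h.piecewise _ _ (hmaps ⟨ha, hab.trans hb⟩).1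
      (by gcongr) (hmaps ⟨ha.trans hab, hb⟩).2 fun x hx => ?_)
    obtain ⟨y, hy, rfl⟩ := hsub x hx
    exact hreg y hy
  · intro c hc a b ha hab hb him
    obtain ⟨γ, hγ, hγl⟩ := h.lift c hc _ _ (hmaps ⟨ha, hab.trans hb⟩).1
      (by dsimp only; gcongr) (hmaps ⟨ha.trans hab, hb⟩).2 (fun x hx => by
        obtain ⟨y, hy, rfl⟩ := hsub x hx
        exact him y hy)
    refine ⟨_, PiecewiseC1On.comp_affine hd hγ, fun τ hτ => hγl _ ⟨?_, ?_⟩⟩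
    · have := hτ.1; dsimp only; gcongr
    · have := hτ.2; dsimp only; gcongr

/-- No differentiability is needed: where one of the two sides is not differentiable, neither is the
other, and both derivatives are zero by convention. -/
theorem mfderiv_comp_affine (ν : ℝ → Mreg) (s : ℝ) {d : ℝ} (hd : 0 < d) (τ : ℝ) :
    (mfderiv 𝓘(ℝ, ℝ) (𝓡 n) (fun τ => ν (s + d * τ)) τ (1 : ℝ) :
      TangentSpace (𝓡 n) (ν (s + d * τ))) =
    d • mfderiv 𝓘(ℝ, ℝ) (𝓡 n) ν (s + d * τ) (1 : ℝ) := by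
  have hη : ∀ τ : ℝ, HasDerivAt (fun τ => s + d * τ) d τ := fun τ => by
    simpa using ((hasDerivAt_id τ).const_mul d).const_add s
  by_cases h : MDifferentiableAt 𝓘(ℝ, ℝ) (𝓡 n) ν (s + d * τ)
  · have h1 := mfderiv_comp (I' := 𝓘(ℝ, ℝ)) τ h (hη τ).differentiableAt.mdifferentiableAt
    have h2 : (mfderiv 𝓘(ℝ, ℝ) 𝓘(ℝ, ℝ) (fun τ => s + d * τ) τ : ℝ →L[ℝ] ℝ) (1 : ℝ) = d := by
      have e : (mfderiv 𝓘(ℝ, ℝ) 𝓘(ℝ, ℝ) (fun τ => s + d * τ) τ : ℝ →L[ℝ] ℝ) =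
          ContinuousLinearMap.toSpanSingleton ℝ d := by
        rw [mfderiv_eq_fderiv]
        exact (hη τ).hasFDerivAt.fderiv
      exact (congrArg (fun L : ℝ →L[ℝ] ℝ => L 1) e).trans (by simp)
    have h3 := congrArg (fun L : ℝ →L[ℝ] E n => L (1 : ℝ)) h1
    refine h3.trans ?_
    change (mfderiv 𝓘(ℝ, ℝ) (𝓡 n) ν (s + d * τ) : ℝ →L[ℝ] E n)
      ((mfderiv 𝓘(ℝ, ℝ) 𝓘(ℝ, ℝ) (fun τ => s + d * τ) τ : ℝ →L[ℝ] ℝ) (1 : ℝ)) = _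
    rw [h2]
    have := (mfderiv 𝓘(ℝ, ℝ) (𝓡 n) ν (s + d * τ) : ℝ →L[ℝ] E n).map_smul d (1 : ℝ)
    exact (congrArg (mfderiv 𝓘(ℝ, ℝ) (𝓡 n) ν (s + d * τ) : ℝ →L[ℝ] E n)
      (by simp : d = d • (1 : ℝ))).trans this
  · have h' : ¬ MDifferentiableAt 𝓘(ℝ, ℝ) (𝓡 n) (fun τ => ν (s + d * τ)) τ := by
      intro h'
      apply h
      have hi : DifferentiableAt ℝ (fun x : ℝ => (x - s) / d) (s + d * τ) := by fun_prop
      have e : (s + d * τ - s) / d = τ := by field_simp; ring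
      have := MDifferentiableAt.comp (I' := 𝓘(ℝ, ℝ)) (s + d * τ)
        (g := fun τ => ν (s + d * τ)) (f := fun x : ℝ => (x - s) / d) (by rw [e]; exact h')
        hi.mdifferentiableAt
      refine this.congr_of_eventuallyEq (Eventually.of_forall fun x => ?_)
      simp only [Function.comp]
      congr 1; field_simp; ring
    rw [mfderiv_zero_of_not_mdifferentiableAt h, mfderiv_zero_of_not_mdifferentiableAt h']
    exact (smul_zero d).symm

theorem pathELength_subpath (ν : ℝ → Mreg) {s t : ℝ} (hst : s < t) :
    pathELength (𝓡 n) (fun τ => ν (s + (t - s) * τ)) 0 1 = pathELength (𝓡 n) ν s t := by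
  have hd : 0 < t - s := sub_pos.2 hst
  have him : (fun τ => s + (t - s) * τ) '' Icc 0 1 = Icc s t := by
    ext x
    constructor
    · rintro ⟨τ, hτ, rfl⟩
      refine ⟨?_, ?_⟩
      · have := mul_nonneg hd.le hτ.1; dsimp only; linarith
      · have := mul_le_mul_of_nonneg_left hτ.2 hd.le; dsimp only; linarith
    · intro hx
      exact ⟨(x - s) / (t - s), ⟨div_nonneg (by linarith [hx.1]) hd.le,
        by rw [div_le_one hd]; linarith [hx.2]⟩, by field_simp; ring⟩
  rw [pathELength_eq_lintegral_mfderiv_Icc, pathELength_eq_lintegral_mfderiv_Icc, ← him,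
    lintegral_image_eq_lintegral_deriv_mul_of_monotoneOn measurableSet_Icc
      (f' := fun _ => t - s) (fun x _ => by
        simpa using ((hasDerivWithinAt_id x _).const_mul (t - s)).const_add s)
      (fun x _ y _ hxy => by gcongr)]
  refine lintegral_congr fun τ => ?_
  refine (congrArg enorm (mfderiv_comp_affine ν s hd τ)).trans ?_
  refine (enorm_smul _ _).trans ?_
  rw [Real.enorm_of_nonneg hd.le]
  rfl

end Geometry

/-! ### Complete conic manifolds are proper -/

/-- The Hopf–Rinow theorem for complete locally compact metric spaces in which points at a
prescribed distance can be found almost on the way to any other point. -/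
theorem properSpace_of_approximate_geodesics {M : Type*} [MetricSpace M] [CompleteSpace M]
    [LocallyCompactSpace M]
    (hL : ∀ x y : M, ∀ r, 0 ≤ r → r ≤ dist x y → ∀ ε > 0,
      ∃ z, dist x z = r ∧ dist z y < dist x y - r + ε) : ProperSpace M := by
  refine ⟨fun x r => ?_⟩
  -- let `R` be the supremum of the radii of compact balls around `x`: the ball of radius `R` is
  -- compact, being totally bounded, and so is a slightly larger one
  set A : Set ℝ := {r | 0 ≤ r ∧ IsCompact (Metric.closedBall x r)} with hA
  have h0 : (0 : ℝ) ∈ A := ⟨le_rfl, by simp⟩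
  by_contra hr
  have hbdd : BddAbove A := by
    refine ⟨r, fun s hs => ?_⟩
    by_contra hsr
    exact hr (hs.2.of_isClosed_subset Metric.isClosed_closedBall
      (Metric.closedBall_subset_closedBall (not_le.1 hsr).le))
  set R := sSup A with hR
  have hR0 : 0 ≤ R := le_csSup hbdd h0
  have hRc : IsCompact (Metric.closedBall x R) := by
    refine TotallyBounded.isCompact_of_isClosed ?_ Metric.isClosed_closedBall
    rw [Metric.totallyBounded_iff]
    intro ε hε
    obtain ⟨s, hs, hsR⟩ := exists_lt_of_lt_csSup ⟨0, h0⟩ (show R - ε / 3 < sSup A by linarith)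
    obtain ⟨t, ht, hst⟩ := Metric.totallyBounded_iff.1 hs.2.totallyBounded (ε / 3) (by positivity)
    refine ⟨t, ht, fun y hy => ?_⟩
    rw [Metric.mem_closedBall, dist_comm] at hy
    have hz : ∃ z, dist x z ≤ s ∧ dist z y < 2 * (ε / 3) := by
      rcases le_or_gt (dist x y) s with h | h
      · exact ⟨y, h, by rw [dist_self]; positivity⟩
      · obtain ⟨z, hz1, hz2⟩ := hL x y s hs.1 h.le (ε / 3) (by positivity)
        exact ⟨z, hz1.le, by linarith⟩
    obtain ⟨z, hz1, hz2⟩ := hz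
    have hzt := hst (show z ∈ Metric.closedBall x s by rwa [Metric.mem_closedBall, dist_comm])
    simp only [mem_iUnion, Metric.mem_ball] at hzt ⊢
    obtain ⟨w, hw, hzw⟩ := hzt
    refine ⟨w, hw, ?_⟩
    have := dist_triangle y z w
    rw [dist_comm y z] at this
    linarith
  obtain ⟨δ, hδ, hδc⟩ := hRc.exists_isCompact_cthickening
  have : R + δ / 2 ∈ A := by
    refine ⟨by positivity, hδc.of_isClosed_subset Metric.isClosed_closedBall fun y hy => ?_⟩
    rw [Metric.mem_closedBall, dist_comm] at hy
    rcases le_or_gt (dist x y) R with h | h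
    · exact Metric.self_subset_cthickening _ (by rwa [Metric.mem_closedBall, dist_comm])
    · obtain ⟨z, hz1, hz2⟩ := hL x y R hR0 h.le (δ / 2) (by positivity)
      refine Metric.mem_cthickening_of_dist_le y z δ _ ?_ ?_
      · rw [Metric.mem_closedBall, dist_comm, hz1]
      · rw [dist_comm]; linarith
  have := le_csSup hbdd this
  linarith

section Geometry

variable {n : ℕ} {M : Type*} [MetricSpace M] {Mreg : TopologicalSpace.Opens M}
  [ChartedSpace (E n) Mreg]
  [RiemannianBundle (fun x : Mreg => TangentSpace (𝓡 n) x)]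
  {𝒜 : Set (ConicChart n Mreg)}

namespace IsConicManifold

/-- The distance of two points of an admissible path is at most the length of the path between
them. -/
theorem edist_le_pathELength (hM : IsConicManifold 𝒜) {μ : ℝ → M} {ν : ℝ → Mreg}
    (h : IsAdmissiblePath 𝒜 μ ν) {s t : ℝ} (hs : 0 ≤ s) (hst : s ≤ t) (ht : t ≤ 1) :
    edist (μ s) (μ t) ≤ pathELength (𝓡 n) ν s t := by
  rcases hst.eq_or_lt with rfl | hst
  · simp
  · rw [hM.edist_eq, ← pathELength_subpath ν hst]
    refine iInf_le_of_le _ (iInf_le_of_le _ (iInf_le_of_le (h.subpath hs hst ht)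
      (iInf_le_of_le ?_ (iInf_le_of_le ?_ le_rfl)))) <;> simp

/-- The point is chosen by continuity on an admissible path of almost minimal length. -/
theorem exists_intermediate (hM : IsConicManifold 𝒜) (x y : M) {r : ℝ} (hr : 0 ≤ r)
    (hrD : r ≤ dist x y) {ε : ℝ} (hε : 0 < ε) :
    ∃ z, dist x z = r ∧ dist z y < dist x y - r + ε := by
  have h1 : conicEDist 𝒜 x y < ENNReal.ofReal (dist x y + ε) := by
    rw [← hM.edist_eq, edist_dist]
    exact (ENNReal.ofReal_lt_ofReal_iff (by positivity)).2 (by linarith)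
  simp only [conicEDist, iInf_lt_iff] at h1
  obtain ⟨μ, ν, h, rfl, rfl, hlen⟩ := h1
  have hc : ContinuousOn (fun t => dist (μ 0) (μ t)) (Icc 0 1) :=
    (by fun_prop : Continuous fun z => dist (μ 0) z).comp_continuousOn h.continuousOn
  obtain ⟨τ, hτ, hτr⟩ := intermediate_value_Icc (zero_le_one' ℝ) hc
    (show r ∈ Icc _ _ by simpa using ⟨hr, hrD⟩)
  refine ⟨μ τ, hτr, ?_⟩
  have h2 := add_le_add (hM.edist_le_pathELength h le_rfl hτ.1 hτ.2)
    (hM.edist_le_pathELength h hτ.1 hτ.2 le_rfl)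
  rw [pathELength_add hτ.1 hτ.2] at h2
  have h3 := h2.trans_lt hlen
  rw [edist_dist, edist_dist, ← ENNReal.ofReal_add dist_nonneg dist_nonneg,
    ENNReal.ofReal_lt_ofReal_iff (by positivity)] at h3
  dsimp only at hτr
  linarith

/-- Near singular points this holds because conic coordinate systems are continuous open maps. -/
theorem locallyCompactSpace (hM : IsConicManifold 𝒜) : LocallyCompactSpace M := by
  have hw : WeaklyLocallyCompactSpace M := by
    refine ⟨fun x => ?_⟩
    by_cases hx : x ∈ Mreg
    · have : LocallyCompactSpace Mreg := ChartedSpace.locallyCompactSpace (E n) Mreg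
      obtain ⟨K, hK, hKx⟩ := exists_compact_mem_nhds (⟨x, hx⟩ : Mreg)
      exact ⟨_, hK.image continuous_subtype_val,
        Mreg.isOpen.isOpenEmbedding_subtypeVal.image_mem_nhds.2 hKx⟩
    · obtain ⟨c, -, p, hp, rfl⟩ := hM.cover x hx
      obtain ⟨K, hK, hpK, hKd⟩ := exists_compact_subset c.isOpen_domain hp
      refine ⟨_, hK.image_of_continuousOn (c.continuousOn.mono hKd), ?_⟩
      exact mem_of_superset ((c.isOpen_image _ (interior_subset.trans hKd)
        isOpen_interior).mem_nhds (mem_image_of_mem _ hpK)) (image_mono interior_subset)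
  infer_instance

/-- Closed balls of a complete conic manifold are compact. -/
theorem properSpace (hM : IsConicManifold 𝒜) [CompleteSpace M] : ProperSpace M :=
  have := hM.locallyCompactSpace
  properSpace_of_approximate_geodesics fun x y _ hr hrD _ hε => hM.exists_intermediate x y hr hrD hε

end IsConicManifold

/-! ### Lipschitz functions on the regular part -/

/-- The coefficients of the pulled back metric are continuous. -/
theorem continuousOn_inner_mfderiv [IsManifold (𝓡 n) ∞ Mreg]
    [IsContMDiffRiemannianBundle (𝓡 n) ∞ (E n) (fun x : Mreg => TangentSpace (𝓡 n) x)]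
    {X : Type*} [NormedAddCommGroup X] [NormedSpace ℝ X]
    {U : Set X} (hU : IsOpen U) {F : X → Mreg} (hF : ContMDiffOn 𝓘(ℝ, X) (𝓡 n) 1 F U) (v w : X) :
    ContinuousOn (fun y => (inner ℝ (mfderiv 𝓘(ℝ, X) (𝓡 n) F y v)
      (mfderiv 𝓘(ℝ, X) (𝓡 n) F y w) : ℝ)) U := by
  have : IsManifold (𝓡 n) 1 Mreg := IsManifold.of_le (n := ∞) (by simp)
  have : IsContinuousRiemannianBundle (E n) (fun x : Mreg => TangentSpace (𝓡 n) x) := by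
    obtain ⟨g, hg, hg'⟩ := IsContMDiffRiemannianBundle.exists_contMDiff (IB := 𝓡 n) (n := ∞)
      (F := E n) (E := fun x : Mreg => TangentSpace (𝓡 n) x)
    exact ⟨g, hg.continuous, hg'⟩
  have key : ∀ v : X, ContinuousOn (fun y => (⟨F y, mfderiv 𝓘(ℝ, X) (𝓡 n) F y v⟩ :
      TangentBundle (𝓡 n) Mreg)) U := by
    intro v
    have h1 := hF.continuousOn_tangentMapWithin le_rfl hU.uniqueMDiffOn
    have h2 : Continuous fun y : X => (⟨y, v⟩ : TangentBundle 𝓘(ℝ, X) X) :=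
      (tangentBundleModelSpaceHomeomorph 𝓘(ℝ, X)).symm.continuous.comp
        (continuous_id.prodMk continuous_const)
    refine (h1.comp h2.continuousOn fun y hy => hy).congr fun y hy => ?_
    simp only [Function.comp, tangentMapWithin]
    rw [mfderivWithin_of_isOpen hU hy]
  exact ContinuousOn.inner_bundle (F := E n) (E := fun x : Mreg => TangentSpace (𝓡 n) x)
    (b := F) (key v) (key w)

section Smooth

variable [IsManifold (𝓡 n) ∞ Mreg]
  [IsContMDiffRiemannianBundle (𝓡 n) ∞ (E n) (fun x : Mreg => TangentSpace (𝓡 n) x)]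

theorem continuousOn_norm_mfderiv
    {X : Type*} [NormedAddCommGroup X] [NormedSpace ℝ X]
    {U : Set X} (hU : IsOpen U) {F : X → Mreg} (hF : ContMDiffOn 𝓘(ℝ, X) (𝓡 n) 1 F U) (v : X) :
    ContinuousOn (fun y => ‖mfderiv 𝓘(ℝ, X) (𝓡 n) F y v‖) U := by
  simp only [norm_eq_sqrt_real_inner]
  exact (continuousOn_inner_mfderiv hU hF v v).sqrt

theorem contMDiffOn_chartSymm (x₀ : Mreg) :
    ContMDiffOn 𝓘(ℝ, E n) (𝓡 n) 1 (chartAt (E n) x₀).symm (chartAt (E n) x₀).target :=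
  (contMDiffOn_chart_symm (I := 𝓡 n) (n := ∞)).of_le (by simp)

theorem contMDiffOn_chart' (x₀ : Mreg) :
    ContMDiffOn (𝓡 n) 𝓘(ℝ, E n) 1 (chartAt (E n) x₀) (chartAt (E n) x₀).source :=
  (contMDiffOn_chart (I := 𝓡 n) (n := ∞)).of_le (by simp)

theorem injective_mfderiv_chartSymm (x₀ : Mreg) {y : E n} (hy : y ∈ (chartAt (E n) x₀).target) :
    Function.Injective (mfderiv 𝓘(ℝ, E n) (𝓡 n) (chartAt (E n) x₀).symm y : E n → E n) := by
  set φ := chartAt (E n) x₀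
  have h1 : MDifferentiableAt 𝓘(ℝ, E n) (𝓡 n) φ.symm y :=
    ((contMDiffOn_chartSymm x₀).contMDiffAt (φ.open_target.mem_nhds hy)).mdifferentiableAt
      one_ne_zero
  have h2 : MDifferentiableAt (𝓡 n) 𝓘(ℝ, E n) φ (φ.symm y) :=
    ((contMDiffOn_chart' x₀).contMDiffAt
      (φ.open_source.mem_nhds (φ.map_target hy))).mdifferentiableAt one_ne_zero
  have hc := mfderiv_comp (I' := 𝓡 n) y h2 h1
  have hee : (φ ∘ φ.symm) =ᶠ[𝓝 y] id := by
    filter_upwards [φ.open_target.mem_nhds hy] with z hz using φ.right_inv hz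
  rw [hee.mfderiv_eq, mfderiv_id] at hc
  refine Function.LeftInverse.injective (g := (mfderiv (𝓡 n) 𝓘(ℝ, E n) φ (φ.symm y) : E n → E n))
    fun w => ?_
  exact (congrArg (fun L : E n →L[ℝ] E n => L w) hc).symm

theorem surjective_mfderiv_chartSymm (x₀ : Mreg) {y : E n} (hy : y ∈ (chartAt (E n) x₀).target) :
    Function.Surjective (mfderiv 𝓘(ℝ, E n) (𝓡 n) (chartAt (E n) x₀).symm y : E n → E n) :=
  (LinearMap.injective_iff_surjective (f := (show E n →L[ℝ] E n from mfderiv 𝓘(ℝ, E n) (𝓡 n)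
    (chartAt (E n) x₀).symm y).toLinearMap)).1
    (injective_mfderiv_chartSymm x₀ hy)

/-- The distance between the images of the endpoints of a segment is at most the length of its
image. -/
theorem IsConicManifold.dist_le_of_segment (hM : IsConicManifold 𝒜)
    {X : Type*} [NormedAddCommGroup X] [NormedSpace ℝ X]
    {U : Set X} (hU : IsOpen U) {F : X → Mreg} (hF : ContMDiffOn 𝓘(ℝ, X) (𝓡 n) 1 F U)
    {y y' : X} (hseg : segment ℝ y y' ⊆ U) {L : ℝ}
    (hL : ∀ z ∈ segment ℝ y y', ‖mfderiv 𝓘(ℝ, X) (𝓡 n) F z (y' - y)‖ ≤ L) :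
    dist (F y : M) (F y') ≤ L := by
  have hL0 : 0 ≤ L := (norm_nonneg _).trans (hL y (left_mem_segment ℝ y y'))
  let η : ℝ → X := fun t => y + t • (y' - y)
  have hη : ∀ t ∈ Icc (0 : ℝ) 1, η t ∈ segment ℝ y y' := fun t ht => by
    rw [segment_eq_image']
    exact ⟨t, ht, rfl⟩
  have hηd : ∀ t, HasDerivAt η (y' - y) t := fun t => by
    have := ((hasDerivAt_id t).smul_const (y' - y)).const_add y
    rwa [one_smul] at this
  have hν : ContMDiffOn 𝓘(ℝ, ℝ) (𝓡 n) 1 (F ∘ η) (Icc 0 1) :=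
    hF.comp (contMDiff_iff_contDiff.2 (by fun_prop : ContDiff ℝ 1 η)).contMDiffOn
      fun t ht => hseg (hη t ht)
  have h1 := hM.edist_le_pathELength (IsAdmissiblePath.of_contMDiffOn 𝒜 hν)
    le_rfl zero_le_one le_rfl
  have e : ∀ t ∈ Icc (0 : ℝ) 1, (mfderiv 𝓘(ℝ, ℝ) (𝓡 n) (F ∘ η) t (1 : ℝ) :
      TangentSpace (𝓡 n) (F (η t))) = mfderiv 𝓘(ℝ, X) (𝓡 n) F (η t) (y' - y) := by
    intro t ht
    have hFd : MDifferentiableAt 𝓘(ℝ, X) (𝓡 n) F (η t) :=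
      (hF.contMDiffAt (hU.mem_nhds (hseg (hη t ht)))).mdifferentiableAt one_ne_zero
    have hc := mfderiv_comp (I' := 𝓘(ℝ, X)) t hFd (hηd t).differentiableAt.mdifferentiableAt
    have h2 : (mfderiv 𝓘(ℝ, ℝ) 𝓘(ℝ, X) η t : ℝ →L[ℝ] X) =
        ContinuousLinearMap.toSpanSingleton ℝ (y' - y) := by
      rw [mfderiv_eq_fderiv]
      exact (hηd t).hasFDerivAt.fderiv
    have h3 : (mfderiv 𝓘(ℝ, ℝ) 𝓘(ℝ, X) η t : ℝ →L[ℝ] X) (1 : ℝ) = y' - y :=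
      (congrArg (fun L : ℝ →L[ℝ] X => L 1) h2).trans (by simp)
    exact (congrArg (fun L : ℝ →L[ℝ] E n => L (1 : ℝ)) hc).trans
      (congrArg (mfderiv 𝓘(ℝ, X) (𝓡 n) F (η t) : X →L[ℝ] E n) h3)
  have h2 : pathELength (𝓡 n) (F ∘ η) 0 1 ≤ ENNReal.ofReal L := by
    rw [pathELength_eq_lintegral_mfderiv_Icc]
    calc _ ≤ ∫⁻ _ in Icc (0 : ℝ) 1, ENNReal.ofReal L := by
          refine setLIntegral_mono' measurableSet_Icc fun t ht => ?_
          refine (congrArg enorm (e t ht)).trans_le ?_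
          rw [← ofReal_norm]
          exact ENNReal.ofReal_le_ofReal (hL _ (hη t ht))
      _ = _ := by simp
  have h3 := h1.trans h2
  simp only [Function.comp, η, zero_smul, add_zero, one_smul, add_sub_cancel] at h3
  rw [edist_dist] at h3
  exact (ENNReal.ofReal_le_ofReal_iff hL0).1 h3

/-- In a chart the distance of the conic manifold is locally bounded by the Euclidean one. -/
theorem IsConicManifold.exists_lipschitzOnWith_chartSymm (hM : IsConicManifold 𝒜) (x₀ : Mreg) :
    LocallyLipschitzOn (chartAt (E n) x₀).target
      (fun y => ((chartAt (E n) x₀).symm y : M)) := by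
  intro y hy
  set φ := chartAt (E n) x₀
  have hev : ∀ᶠ z in 𝓝 y, z ∈ φ.target ∧ ∀ i : Fin n,
      ‖mfderiv 𝓘(ℝ, E n) (𝓡 n) φ.symm z (EuclideanSpace.single i (1 : ℝ))‖ <
      ‖mfderiv 𝓘(ℝ, E n) (𝓡 n) φ.symm y (EuclideanSpace.single i (1 : ℝ))‖ + 1 := by
    refine (φ.open_target.eventually_mem hy).and (eventually_all.2 fun i => ?_)
    exact ((continuousOn_norm_mfderiv φ.open_target (contMDiffOn_chartSymm x₀) _).continuousAt
      (φ.open_target.mem_nhds hy)).eventually (gt_mem_nhds (by linarith))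
  obtain ⟨r, hr, hball⟩ := Metric.eventually_nhds_iff_ball.1 hev
  set C : ℝ := ∑ i : Fin n,
    (‖mfderiv 𝓘(ℝ, E n) (𝓡 n) φ.symm y (EuclideanSpace.single i (1 : ℝ))‖ + 1) with hC
  have hC0 : 0 ≤ C := Finset.sum_nonneg fun i _ => by positivity
  refine ⟨C.toNNReal, Metric.ball y r, mem_nhdsWithin_of_mem_nhds (Metric.ball_mem_nhds y hr),
    LipschitzOnWith.of_dist_le_mul fun z hz z' hz' => ?_⟩
  have hseg : segment ℝ z z' ⊆ Metric.ball y r := (convex_ball y r).segment_subset hz hz'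
  refine hM.dist_le_of_segment φ.open_target (contMDiffOn_chartSymm x₀)
    (fun w hw => (hball w (hseg hw)).1) fun w hw => ?_
  rw [Real.coe_toNNReal _ hC0, dist_comm, dist_eq_norm]
  have hsum : z' - z = ∑ i : Fin n, (z' - z) i • EuclideanSpace.single i (1 : ℝ) := by
    simpa using ((EuclideanSpace.basisFun (Fin n) ℝ).sum_repr (z' - z)).symm
  set D := (mfderiv 𝓘(ℝ, E n) (𝓡 n) φ.symm w : E n →L[ℝ] TangentSpace (𝓡 n) (φ.symm w))
  have hDs : D (z' - z) = ∑ i : Fin n, (z' - z) i • D (EuclideanSpace.single i (1 : ℝ)) := by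
    refine (congrArg (D : E n → E n) hsum).trans ?_
    refine (map_sum (D : E n →L[ℝ] E n) _ _).trans ?_
    exact Finset.sum_congr rfl fun i _ => (D : E n →L[ℝ] E n).map_smul _ _
  rw [hDs, hC, Finset.sum_mul]
  refine (norm_sum_le _ _).trans (Finset.sum_le_sum fun i _ => ?_)
  rw [norm_smul, mul_comm]
  exact mul_le_mul ((hball w (hseg hw)).2 i).le (PiLp.norm_apply_le _ i)
    (norm_nonneg _) (by positivity)

/-- The differential of a function on `M`, at a regular point; it is zero where the function
is not differentiable. -/
def regDiff (f : M → ℝ) (x : Mreg) : TangentSpace (𝓡 n) x →L[ℝ] ℝ :=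
  mfderiv (𝓡 n) 𝓘(ℝ, ℝ) (fun x : Mreg => f x) x

/-- The chain rule for `regDiff` in a chart. -/
theorem hasFDerivAt_regDiff {f : M → ℝ} {x₀ : Mreg} {y : E n}
    (hy : y ∈ (chartAt (E n) x₀).target)
    (hf : DifferentiableAt ℝ (fun y => f ((chartAt (E n) x₀).symm y)) y) (v : E n) :
    fderiv ℝ (fun y => f ((chartAt (E n) x₀).symm y)) y v =
      regDiff (n := n) f ((chartAt (E n) x₀).symm y)
        (mfderiv 𝓘(ℝ, E n) (𝓡 n) (chartAt (E n) x₀).symm y v) := by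
  set φ := chartAt (E n) x₀
  have hx : φ.symm y ∈ φ.source := φ.map_target hy
  have h1 : MDifferentiableAt (𝓡 n) 𝓘(ℝ, ℝ) (fun x : Mreg => f x) (φ.symm y) := by
    have hφ : MDifferentiableAt (𝓡 n) 𝓘(ℝ, E n) φ (φ.symm y) :=
      ((contMDiffOn_chart' x₀).contMDiffAt (φ.open_source.mem_nhds hx)).mdifferentiableAt
        one_ne_zero
    have := MDifferentiableAt.comp (I' := 𝓘(ℝ, E n)) (φ.symm y)
      (g := fun y => f (φ.symm y)) (f := φ)
      (by rw [φ.right_inv hy]; exact hf.mdifferentiableAt) hφ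
    refine this.congr_of_eventuallyEq ?_
    filter_upwards [φ.open_source.mem_nhds hx] with z hz
    simp [φ.left_inv hz]
  have h2 : MDifferentiableAt 𝓘(ℝ, E n) (𝓡 n) φ.symm y :=
    ((contMDiffOn_chartSymm x₀).contMDiffAt (φ.open_target.mem_nhds hy)).mdifferentiableAt
      one_ne_zero
  have hc := mfderiv_comp (I' := 𝓡 n) y h1 h2
  rw [← mfderiv_eq_fderiv]
  exact congrArg (fun L : E n →L[ℝ] ℝ => L v) hc

/-- If `f` varies near `x` at most `κ` times as fast as the distance, then `|df| ≤ κ`. -/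
theorem IsConicManifold.abs_regDiff_le (hM : IsConicManifold 𝒜) {f : M → ℝ} {x : Mreg} {κ : ℝ}
    (hκ : 0 ≤ κ) (hf : ∀ᶠ x' in 𝓝 (x : M), |f x' - f x| ≤ κ * dist x' (x : M))
    (v : TangentSpace (𝓡 n) x) : |regDiff (n := n) f x v| ≤ κ * ‖v‖ := by
  by_cases hd : MDifferentiableAt (𝓡 n) 𝓘(ℝ, ℝ) (fun x : Mreg => f x) x
  swap
  · rw [regDiff, mfderiv_zero_of_not_mdifferentiableAt hd]
    have : |((0 : TangentSpace (𝓡 n) x →L[ℝ] ℝ) v)| ≤ κ * ‖v‖ := by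
      simp; positivity
    exact this
  set φ := chartAt (E n) x with hφ
  have hxs : x ∈ φ.source := mem_chart_source _ x
  have hyt : φ x ∈ φ.target := φ.map_source hxs
  have hxy : φ.symm (φ x) = x := φ.left_inv hxs
  have hs : MDifferentiableAt 𝓘(ℝ, E n) (𝓡 n) φ.symm (φ x) :=
    ((contMDiffOn_chartSymm x).contMDiffAt (φ.open_target.mem_nhds hyt)).mdifferentiableAt
      one_ne_zero
  have hdiff : DifferentiableAt ℝ (fun y => f (φ.symm y)) (φ x) := by
    rw [← mdifferentiableAt_iff_differentiableAt]
    exact MDifferentiableAt.comp (I' := 𝓡 n) (φ x) (g := fun x : Mreg => f x) (f := φ.symm)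
      (by rw [hxy]; exact hd) hs
  -- it is enough to bound the derivative on the image of the coordinate vectors
  suffices H : ∀ w : E n, |fderiv ℝ (fun y => f (φ.symm y)) (φ x) w| ≤
      κ * ‖mfderiv 𝓘(ℝ, E n) (𝓡 n) φ.symm (φ x) w‖ by
    have key : ∀ x' : Mreg, φ.symm (φ x) = x' → ∀ v : TangentSpace (𝓡 n) x',
        (∀ w : E n, |regDiff (n := n) f (φ.symm (φ x))
          (mfderiv 𝓘(ℝ, E n) (𝓡 n) φ.symm (φ x) w)| ≤
          κ * ‖mfderiv 𝓘(ℝ, E n) (𝓡 n) φ.symm (φ x) w‖) →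
        |regDiff (n := n) f x' v| ≤ κ * ‖v‖ := by
      rintro x' rfl v hw
      obtain ⟨w, rfl⟩ := surjective_mfderiv_chartSymm x hyt v
      exact hw w
    refine key x hxy v fun w => ?_
    rw [← hasFDerivAt_regDiff hyt hdiff]
    exact H w
  intro w
  have hline := (hdiff.hasFDerivAt.hasLineDerivAt w).tendsto_slope_zero_right
  have hcont := ((continuousOn_norm_mfderiv φ.open_target (contMDiffOn_chartSymm x) w).continuousAt
      (φ.open_target.mem_nhds hyt))
  refine le_of_forall_pos_le_add fun ε hε => ?_
  -- near `φ x` the speed of the straight line is at most `‖w‖_g + ε'`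
  obtain ⟨ε', hε', hεκ⟩ : ∃ ε' > 0, κ * ε' ≤ ε :=
    ⟨ε / (κ + 1), by positivity, by
      rw [mul_div_assoc', div_le_iff₀ (by positivity)]; nlinarith⟩
  have hev : ∀ᶠ z in 𝓝 (φ x), z ∈ φ.target ∧ ‖mfderiv 𝓘(ℝ, E n) (𝓡 n) φ.symm z w‖ <
      ‖mfderiv 𝓘(ℝ, E n) (𝓡 n) φ.symm (φ x) w‖ + ε' :=
    (φ.open_target.eventually_mem hyt).and (hcont.eventually (gt_mem_nhds (by linarith)))
  obtain ⟨r, hr, hball⟩ := Metric.eventually_nhds_iff_ball.1 hev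
  have hpath : Tendsto (fun t : ℝ => φ x + t • w) (𝓝[>] 0) (𝓝 (φ x)) := by
    have : Continuous fun t : ℝ => φ x + t • w := by fun_prop
    simpa using (this.tendsto 0).mono_left nhdsWithin_le_nhds
  have hfev : ∀ᶠ z in 𝓝 (φ x), |f (φ.symm z) - f x| ≤ κ * dist (φ.symm z : M) (x : M) := by
    have : Tendsto (fun z => (φ.symm z : M)) (𝓝 (φ x)) (𝓝 (x : M)) := by
      have h := (continuous_subtype_val.tendsto (φ.symm (φ x))).comp
        (φ.continuousAt_symm hyt).tendsto
      rwa [hxy] at h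
    exact this.eventually hf
  refine le_of_tendsto hline.abs ?_
  filter_upwards [hpath.eventually (Metric.ball_mem_nhds _ hr), hpath.eventually hfev,
    self_mem_nhdsWithin] with t ht htf ht0
  have ht0 : 0 < t := ht0
  have hseg : segment ℝ (φ x) (φ x + t • w) ⊆ Metric.ball (φ x) r :=
    (convex_ball _ r).segment_subset (Metric.mem_ball_self hr) ht
  have hd := hM.dist_le_of_segment φ.open_target (contMDiffOn_chartSymm x)
    (fun z hz => (hball z (hseg hz)).1)
    (L := t * (‖mfderiv 𝓘(ℝ, E n) (𝓡 n) φ.symm (φ x) w‖ + ε')) fun z hz => by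
      have e : (mfderiv 𝓘(ℝ, E n) (𝓡 n) φ.symm z (φ x + t • w - φ x) :
          TangentSpace (𝓡 n) (φ.symm z)) = t • mfderiv 𝓘(ℝ, E n) (𝓡 n) φ.symm z w := by
        rw [add_sub_cancel_left]
        exact (mfderiv 𝓘(ℝ, E n) (𝓡 n) φ.symm z : E n →L[ℝ] E n).map_smul t w
      rw [e, norm_smul, Real.norm_of_nonneg ht0.le]
      exact mul_le_mul_of_nonneg_left (hball z (hseg hz)).2.le ht0.le
  have hd' : dist (φ.symm (φ x + t • w) : M) x ≤
      t * (‖mfderiv 𝓘(ℝ, E n) (𝓡 n) φ.symm (φ x) w‖ + ε') := by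
    rw [dist_comm]
    have e : dist (x : M) (φ.symm (φ x + t • w)) =
      dist (φ.symm (φ x) : M) (φ.symm (φ x + t • w)) := by rw [hxy]
    rw [e]
    exact hd
  have e : f (φ.symm (φ x)) = f x := by rw [hxy]
  rw [e, smul_eq_mul, abs_mul, abs_of_pos (inv_pos.2 ht0), inv_mul_le_iff₀ ht0]
  calc _ ≤ κ * dist (φ.symm (φ x + t • w) : M) x := htf
    _ ≤ κ * (t * (‖mfderiv 𝓘(ℝ, E n) (𝓡 n) φ.symm (φ x) w‖ + ε')) := by gcongr
    _ = t * (κ * ‖mfderiv 𝓘(ℝ, E n) (𝓡 n) φ.symm (φ x) w‖ + κ * ε') := by ring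
    _ ≤ _ := by gcongr

end Smooth

end Geometry

/-! ### The Riemannian volume in charts and near the singular part -/

section Volume

open scoped Matrix

variable {n : ℕ} {M : Type*} [MetricSpace M] {Mreg : TopologicalSpace.Opens M}
  [ChartedSpace (E n) Mreg] [IsManifold (𝓡 n) ∞ Mreg]
  [RiemannianBundle (fun x : Mreg => TangentSpace (𝓡 n) x)]
  [IsContMDiffRiemannianBundle (𝓡 n) ∞ (E n) (fun x : Mreg => TangentSpace (𝓡 n) x)]
  {𝒜 : Set (ConicChart n Mreg)}

/-- The Gram matrix of the coordinate vector fields of a parametrization `F`. -/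
def gramOf (F : E n → Mreg) (y : E n) : Matrix (Fin n) (Fin n) ℝ :=
  Matrix.of fun i j => inner ℝ
    (mfderiv 𝓘(ℝ, E n) (𝓡 n) F y (EuclideanSpace.single i (1 : ℝ)))
    (mfderiv 𝓘(ℝ, E n) (𝓡 n) F y (EuclideanSpace.single j (1 : ℝ)))

variable (n Mreg) in
/-- The metric tensor at `x`, on the coordinate space `ℝⁿ` underlying the tangent space. -/
def metricAt (x : Mreg) (v w : E n) : ℝ :=
  @inner ℝ (TangentSpace (𝓡 n) x) _ v w

theorem gramOf_congr {F F' : E n → Mreg} {y : E n} (h : F =ᶠ[𝓝 y] F') :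
    gramOf F y = gramOf F' y := by
  ext i j
  have e : (mfderiv 𝓘(ℝ, E n) (𝓡 n) F y : E n →L[ℝ] E n) = mfderiv 𝓘(ℝ, E n) (𝓡 n) F' y :=
    h.mfderiv_eq
  change metricAt n Mreg (F y)
      ((mfderiv 𝓘(ℝ, E n) (𝓡 n) F y : E n →L[ℝ] E n) (EuclideanSpace.single i (1 : ℝ)))
      ((mfderiv 𝓘(ℝ, E n) (𝓡 n) F y : E n →L[ℝ] E n) (EuclideanSpace.single j (1 : ℝ))) =
    metricAt n Mreg (F' y)
      ((mfderiv 𝓘(ℝ, E n) (𝓡 n) F' y : E n →L[ℝ] E n) (EuclideanSpace.single i (1 : ℝ)))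
      ((mfderiv 𝓘(ℝ, E n) (𝓡 n) F' y : E n →L[ℝ] E n) (EuclideanSpace.single j (1 : ℝ)))
  rw [e, h.eq_of_nhds]

theorem inner_sum_smul {V : Type*} [NormedAddCommGroup V] [InnerProductSpace ℝ V]
    (a b : Fin n → ℝ) (f : Fin n → V) :
    inner ℝ (∑ k, a k • f k) (∑ l, b l • f l) = ∑ k, ∑ l, a k * inner ℝ (f k) (f l) * b l := by
  rw [sum_inner]
  refine Finset.sum_congr rfl fun k _ => ?_
  rw [inner_sum]
  refine Finset.sum_congr rfl fun l _ => ?_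
  rw [inner_smul_left, inner_smul_right, conj_trivial]
  ring

/-- The transformation rule of the metric tensor under a change of coordinates `g`. -/
theorem gramOf_comp {F : E n → Mreg} {g : E n → E n} {y : E n} {g' : E n →L[ℝ] E n}
    (hF : MDifferentiableAt 𝓘(ℝ, E n) (𝓡 n) F (g y)) (hg : HasFDerivAt g g' y) :
    gramOf (F ∘ g) y =
      (LinearMap.toMatrix (EuclideanSpace.basisFun (Fin n) ℝ).toBasis
        (EuclideanSpace.basisFun (Fin n) ℝ).toBasis (g' : E n →ₗ[ℝ] E n))ᵀ * gramOf F (g y) *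
      (LinearMap.toMatrix (EuclideanSpace.basisFun (Fin n) ℝ).toBasis
        (EuclideanSpace.basisFun (Fin n) ℝ).toBasis (g' : E n →ₗ[ℝ] E n)) := by
  set P := LinearMap.toMatrix (EuclideanSpace.basisFun (Fin n) ℝ).toBasis
        (EuclideanSpace.basisFun (Fin n) ℝ).toBasis (g' : E n →ₗ[ℝ] E n) with hP
  have hPe : ∀ k i, P k i = g' (EuclideanSpace.single i (1 : ℝ)) k := fun k i => by
    simp [hP, LinearMap.toMatrix_apply]
  let D : E n →L[ℝ] E n := mfderiv 𝓘(ℝ, E n) (𝓡 n) F (g y)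
  have hc : (mfderiv 𝓘(ℝ, E n) (𝓡 n) (F ∘ g) y : E n →L[ℝ] E n) = D.comp g' := by
    refine (mfderiv_comp (I' := 𝓘(ℝ, E n)) y hF hg.differentiableAt.mdifferentiableAt).trans ?_
    rw [mfderiv_eq_fderiv, hg.fderiv]
    rfl
  have hsum : ∀ i, D (g' (EuclideanSpace.single i (1 : ℝ))) =
      ∑ k, P k i • D (EuclideanSpace.single k (1 : ℝ)) := fun i => by
    have h1 : g' (EuclideanSpace.single i (1 : ℝ)) =
        ∑ k, P k i • EuclideanSpace.single k (1 : ℝ) := by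
      simp_rw [hPe]
      simpa using ((EuclideanSpace.basisFun (Fin n) ℝ).sum_repr
        (g' (EuclideanSpace.single i (1 : ℝ)))).symm
    conv_lhs => rw [h1]
    rw [map_sum]
    exact Finset.sum_congr rfl fun k _ => D.map_smul _ _
  ext i j
  let f : Fin n → TangentSpace (𝓡 n) (F (g y)) := fun k => D (EuclideanSpace.single k (1 : ℝ))
  have e1 : gramOf (F ∘ g) y i j = inner ℝ (∑ k, P k i • f k) (∑ l, P l j • f l) := by
    change metricAt n Mreg (F (g y))
      ((mfderiv 𝓘(ℝ, E n) (𝓡 n) (F ∘ g) y : E n →L[ℝ] E n) (EuclideanSpace.single i (1 : ℝ)))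
      ((mfderiv 𝓘(ℝ, E n) (𝓡 n) (F ∘ g) y : E n →L[ℝ] E n) (EuclideanSpace.single j (1 : ℝ))) =
      metricAt n Mreg (F (g y)) (∑ k, P k i • D (EuclideanSpace.single k (1 : ℝ)))
        (∑ l, P l j • D (EuclideanSpace.single l (1 : ℝ)))
    rw [hc, ← hsum, ← hsum]
    rfl
  rw [e1, inner_sum_smul, Matrix.mul_apply]
  simp only [Matrix.mul_apply, Matrix.transpose_apply, Finset.sum_mul]
  rw [Finset.sum_comm]
  rfl

theorem sqrt_det_gramOf_comp {F : E n → Mreg} {g : E n → E n} {y : E n} {g' : E n →L[ℝ] E n}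
    (hF : MDifferentiableAt 𝓘(ℝ, E n) (𝓡 n) F (g y)) (hg : HasFDerivAt g g' y) :
    Real.sqrt (gramOf (F ∘ g) y).det = |g'.det| * Real.sqrt (gramOf F (g y)).det := by
  rw [gramOf_comp hF hg, Matrix.det_mul, Matrix.det_mul, Matrix.det_transpose,
    LinearMap.det_toMatrix]
  rw [show ∀ a b : ℝ, a * b * a = a ^ 2 * b from fun a b => by ring,
    Real.sqrt_mul (sq_nonneg _), Real.sqrt_sq_eq_abs]

theorem continuousOn_gramOf {F : E n → Mreg} {U : Set (E n)} (hU : IsOpen U)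
    (hF : ContMDiffOn 𝓘(ℝ, E n) (𝓡 n) 1 F U) : ContinuousOn (gramOf F) U :=
  continuousOn_pi.2 fun _ => continuousOn_pi.2 fun _ => continuousOn_inner_mfderiv hU hF _ _

theorem linearIndependent_coordVec (x₀ : Mreg) {y : E n} (hy : y ∈ (chartAt (E n) x₀).target) :
    LinearIndependent ℝ fun i => coordVec (n := n) x₀ i y := by
  have h := (EuclideanSpace.basisFun (Fin n) ℝ).toBasis.linearIndependent.map'
    (show E n →L[ℝ] E n from mfderiv 𝓘(ℝ, E n) (𝓡 n) (chartAt (E n) x₀).symm y).toLinearMap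
    (LinearMap.ker_eq_bot.2 (injective_mfderiv_chartSymm x₀ hy))
  have e : (fun i => coordVec (n := n) x₀ i y) = (show E n →L[ℝ] E n from
      mfderiv 𝓘(ℝ, E n) (𝓡 n) (chartAt (E n) x₀).symm y).toLinearMap ∘
        (EuclideanSpace.basisFun (Fin n) ℝ).toBasis := by
    funext i
    simp only [Function.comp, OrthonormalBasis.coe_toBasis, EuclideanSpace.basisFun_apply]
    rfl
  rw [e]
  exact h

theorem posDef_gram_of_linearIndependent {V : Type*} [NormedAddCommGroup V] [InnerProductSpace ℝ V]
    {f : Fin n → V} (hf : LinearIndependent ℝ f) :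
    (Matrix.of fun i j => (inner ℝ (f i) (f j) : ℝ)).PosDef := by
  have := Matrix.posDef_gram_of_linearIndependent (𝕜 := ℝ) hf
  exact this

theorem det_chartGram_pos (x₀ : Mreg) {y : E n} (hy : y ∈ (chartAt (E n) x₀).target) :
    0 < (chartGram x₀ y).det :=
  (posDef_gram_of_linearIndependent (V := TangentSpace (𝓡 n) ((chartAt (E n) x₀).symm y))
    (f := fun i => coordVec x₀ i y) (linearIndependent_coordVec x₀ hy)).det_pos

/-- The density of the Riemannian volume in the chart at `x₀`. -/
def chartDensity (x₀ : Mreg) (y : E n) : ENNReal := ENNReal.ofReal (Real.sqrt (chartGram x₀ y).det)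

theorem continuousOn_sqrt_det_chartGram (x₀ : Mreg) :
    ContinuousOn (fun y => Real.sqrt (chartGram x₀ y).det) (chartAt (E n) x₀).target := by
  have := continuousOn_gramOf (chartAt (E n) x₀).open_target (contMDiffOn_chartSymm x₀)
  exact ((continuous_id.matrix_det).comp_continuousOn this).sqrt

theorem aemeasurable_chartDensity (x₀ : Mreg) :
    AEMeasurable (chartDensity x₀) (volume.restrict (chartAt (E n) x₀).target) :=
  ENNReal.measurable_ofReal.comp_aemeasurable
    ((continuousOn_sqrt_det_chartGram x₀).aemeasurable (chartAt (E n) x₀).open_target.measurableSet)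

variable [MeasurableSpace M] [BorelSpace M]

theorem measurableSet_target_inter_preimage (x₀ : Mreg) {S : Set Mreg} (hS : MeasurableSet S) :
    MeasurableSet ((chartAt (E n) x₀).target ∩ (chartAt (E n) x₀).symm ⁻¹' S) := by
  have h := (continuousOn_iff_continuous_domRestrict.1
    (chartAt (E n) x₀).continuousOn_symm).measurable hS
  have h2 := (chartAt (E n) x₀).open_target.measurableSet.subtype_image h
  convert h2 using 1
  ext y
  simp [Set.domRestrict, and_comm]

theorem aemeasurable_chartSymm (x₀ : Mreg) :
    AEMeasurable (chartAt (E n) x₀).symm (volume.restrict (chartAt (E n) x₀).target) :=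
  (chartAt (E n) x₀).continuousOn_symm.aemeasurable (chartAt (E n) x₀).open_target.measurableSet

theorem chartVolume_apply (x₀ : Mreg) {S : Set Mreg} (hS : MeasurableSet S) :
    chartVolume (n := n) x₀ S =
      ∫⁻ y in (chartAt (E n) x₀).target ∩ (chartAt (E n) x₀).symm ⁻¹' S, chartDensity x₀ y := by
  have hm : MeasurableSet (chartAt (E n) x₀).target := (chartAt (E n) x₀).open_target.measurableSet
  rw [chartVolume, Measure.map_apply_of_aemeasurable _ hS, withDensity_apply',
    Measure.restrict_restrict' hm, inter_comm]
  · rfl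
  · exact (aemeasurable_chartSymm x₀).mono_ac (withDensity_absolutelyContinuous _ _)

theorem chartVolume_inter_source (x₀ : Mreg) {S : Set Mreg} (hS : MeasurableSet S) :
    chartVolume (n := n) x₀ S = chartVolume (n := n) x₀ (S ∩ (chartAt (E n) x₀).source) := by
  rw [chartVolume_apply x₀ hS,
    chartVolume_apply x₀ (hS.inter (chartAt (E n) x₀).open_source.measurableSet)]
  congr 2
  ext y
  simp only [mem_inter_iff, mem_preimage]
  exact ⟨fun h => ⟨h.1, h.2, (chartAt (E n) x₀).map_target h.1⟩, fun h => ⟨h.1, h.2.1⟩⟩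

/-- Change of variables: the volume of an injectively parametrized set inside a chart domain. -/
theorem chartVolume_image (x₀ : Mreg) {F : E n → Mreg} {U S : Set (E n)} (hU : IsOpen U)
    (hF : ContMDiffOn 𝓘(ℝ, E n) (𝓡 n) 1 F U) (hS : MeasurableSet S) (hSU : S ⊆ U)
    (hinj : InjOn F S) (hFS : F '' S ⊆ (chartAt (E n) x₀).source) :
    chartVolume (n := n) x₀ (F '' S) = ∫⁻ y in S, ENNReal.ofReal (Real.sqrt (gramOf F y).det) := by
  set φ := chartAt (E n) x₀ with hφ
  have hFm : MeasurableSet (F '' S) :=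
    hS.image_of_continuousOn_injOn (hF.continuousOn.mono hSU) hinj
  let g : E n → E n := fun y => φ (F y)
  have hmem : ∀ y ∈ S, F y ∈ φ.source := fun y hy => hFS (mem_image_of_mem _ hy)
  have hFd : ∀ y ∈ S, MDifferentiableAt 𝓘(ℝ, E n) (𝓡 n) F y := fun y hy =>
    (hF.contMDiffAt (hU.mem_nhds (hSU hy))).mdifferentiableAt one_ne_zero
  have hgd : ∀ y ∈ S, HasFDerivAt g (fderiv ℝ g y) y := fun y hy => by
    have h1 : MDifferentiableAt (𝓡 n) 𝓘(ℝ, E n) φ (F y) :=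
      ((contMDiffOn_chart' x₀).contMDiffAt (φ.open_source.mem_nhds (hmem y hy))).mdifferentiableAt
        one_ne_zero
    exact (mdifferentiableAt_iff_differentiableAt.1
      (MDifferentiableAt.comp (I' := 𝓡 n) y h1 (hFd y hy))).hasFDerivAt
  have hginj : InjOn g S := fun y hy y' hy' h =>
    hinj hy hy' (φ.injOn (hmem y hy) (hmem y' hy') h)
  have hset : φ.target ∩ φ.symm ⁻¹' (F '' S) = g '' S := by
    ext z
    constructor
    · rintro ⟨hz, y, hy, hyz⟩
      exact ⟨y, hy, by simp only [g]; rw [hyz, φ.right_inv hz]⟩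
    · rintro ⟨y, hy, rfl⟩
      exact ⟨φ.map_source (hmem y hy), y, hy, (φ.left_inv (hmem y hy)).symm⟩
  rw [chartVolume_apply x₀ hFm, ← hφ, hset,
    lintegral_image_eq_lintegral_abs_det_fderiv_mul volume hS
      (fun y hy => (hgd y hy).hasFDerivWithinAt) hginj]
  refine setLIntegral_congr_fun hS fun y hy => ?_
  have hev : F =ᶠ[𝓝 y] φ.symm ∘ g := by
    have hc : ContinuousAt F y := hF.continuousOn.continuousAt (hU.mem_nhds (hSU hy))
    filter_upwards [hc.preimage_mem_nhds (φ.open_source.mem_nhds (hmem y hy))] with z hz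
    exact (φ.left_inv hz).symm
  have hs : MDifferentiableAt 𝓘(ℝ, E n) (𝓡 n) φ.symm (g y) :=
    ((contMDiffOn_chartSymm x₀).contMDiffAt
      (φ.open_target.mem_nhds (φ.map_source (hmem y hy)))).mdifferentiableAt one_ne_zero
  rw [gramOf_congr hev, sqrt_det_gramOf_comp hs (hgd y hy), ENNReal.ofReal_mul (abs_nonneg _)]
  rfl

/-- Different charts give the same volume on the overlap of their domains. -/
theorem chartVolume_eq_of_subset (x₀ x₁ : Mreg) {S : Set Mreg} (hS : MeasurableSet S)
    (h₀ : S ⊆ (chartAt (E n) x₀).source) (h₁ : S ⊆ (chartAt (E n) x₁).source) :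
    chartVolume (n := n) x₁ S = chartVolume (n := n) x₀ S := by
  set φ := chartAt (E n) x₁ with hφ
  have him : φ.symm '' (φ.target ∩ φ.symm ⁻¹' S) = S := by
    ext x
    constructor
    · rintro ⟨y, hy, rfl⟩; exact hy.2
    · intro hx
      exact ⟨φ x, ⟨φ.map_source (h₁ hx), by rwa [mem_preimage, φ.left_inv (h₁ hx)]⟩,
        φ.left_inv (h₁ hx)⟩
  have h := chartVolume_image x₀ φ.open_target (contMDiffOn_chartSymm x₁)
    (measurableSet_target_inter_preimage x₁ hS) inter_subset_left
    (φ.symm.injOn.mono inter_subset_left) (by rw [him]; exact h₀)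
  rw [← hφ, him] at h
  rw [h, chartVolume_apply x₁ hS]
  rfl

/-- On a chart domain the Riemannian volume is given by the coordinate formula. -/
theorem regVolume_eq_chartVolume (x₀ : Mreg) {S : Set Mreg} (hS : MeasurableSet S)
    (h₀ : S ⊆ (chartAt (E n) x₀).source) :
    regVolume n Mreg S = chartVolume (n := n) x₀ S := by
  refine le_antisymm ?_ (le_iSup (fun x : Mreg => chartVolume (n := n) x) x₀ S)
  set U := (chartAt (E n) x₀).source with hU
  have hUm : MeasurableSet U := (chartAt (E n) x₀).open_source.measurableSet
  -- all chart volumes are dominated by the one at `x₀`, made infinite off its domain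
  have hle : regVolume n Mreg ≤ chartVolume (n := n) x₀ + (⊤ : Measure Mreg).restrict Uᶜ := by
    refine iSup_le fun x => Measure.le_iff.2 fun A hA => ?_
    rw [← measure_inter_add_sdiff A hUm, Measure.add_apply, Measure.restrict_apply hA]
    refine add_le_add ?_ ?_
    · rw [chartVolume_inter_source x (hA.inter hUm),
        chartVolume_eq_of_subset x₀ x ((hA.inter hUm).inter
          (chartAt (E n) x).open_source.measurableSet)
          (inter_subset_left.trans inter_subset_right) inter_subset_right]
      exact measure_mono (inter_subset_left.trans inter_subset_left)
    · rw [← sdiff_eq]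
      exact (le_top : chartVolume (n := n) x ≤ ⊤) _
  refine (hle S).trans ?_
  rw [Measure.add_apply, Measure.restrict_apply hS]
  have : S ∩ Uᶜ = ∅ := by rw [← sdiff_eq, sdiff_eq_empty]; exact h₀
  simp [this]

theorem regVolume_restrict_source (x₀ : Mreg) :
    (regVolume n Mreg).restrict (chartAt (E n) x₀).source = chartVolume (n := n) x₀ := by
  ext S hS
  rw [Measure.restrict_apply hS, regVolume_eq_chartVolume x₀
    (hS.inter (chartAt (E n) x₀).open_source.measurableSet) inter_subset_right,
    ← chartVolume_inter_source x₀ hS]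

end Volume

/-! ### Finiteness of the volume of compact sets -/

section FiniteVolume

variable {n : ℕ} {M : Type*} [MetricSpace M] {Mreg : TopologicalSpace.Opens M}
  [ChartedSpace (E n) Mreg] [IsManifold (𝓡 n) ∞ Mreg]
  [RiemannianBundle (fun x : Mreg => TangentSpace (𝓡 n) x)]
  [IsContMDiffRiemannianBundle (𝓡 n) ∞ (E n) (fun x : Mreg => TangentSpace (𝓡 n) x)]
  {𝒜 : Set (ConicChart n Mreg)}

theorem norm_mfderiv_add_smul_add_le {X : Type*} [NormedAddCommGroup X] [NormedSpace ℝ X]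
    (F : X → Mreg) (p u v w : X) (s : ℝ) :
    ‖mfderiv 𝓘(ℝ, X) (𝓡 n) F p (u + s • v + w)‖ ≤ ‖mfderiv 𝓘(ℝ, X) (𝓡 n) F p u‖ +
      |s| * ‖mfderiv 𝓘(ℝ, X) (𝓡 n) F p v‖ + ‖mfderiv 𝓘(ℝ, X) (𝓡 n) F p w‖ := by
  let D : X →L[ℝ] E n := mfderiv 𝓘(ℝ, X) (𝓡 n) F p
  have e : D (u + s • v + w) = D u + s • D v + D w := by
    rw [map_add, map_add, map_smul]
  have h := norm_add₃_le (a := (show TangentSpace (𝓡 n) (F p) from D u))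
    (b := s • (show TangentSpace (𝓡 n) (F p) from D v))
    (c := (show TangentSpace (𝓡 n) (F p) from D w))
  rw [norm_smul, Real.norm_eq_abs] at h
  refine le_trans (le_of_eq ?_) h
  exact congrArg (fun x : E n => @norm (TangentSpace (𝓡 n) (F p)) _ x) e

/-- Near the singular part the differential of a conic coordinate system is bounded, although it
need not have a limit there. -/
theorem ConicChart.norm_mfderiv_projReg_le (c : ConicChart n Mreg) {K : Set (E c.k)}
    (hKW : K ⊆ c.W) (hK : IsCompact K) :
    ∃ δ ∈ Ioc 0 c.R, ∀ w : E c.k × E c.m, ∃ B, ∀ p : E c.k × E c.m, p.1 ∈ K → p.2 ≠ 0 → ‖p.2‖ < δ →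
      ‖mfderiv 𝓘(ℝ, E c.k × E c.m) (𝓡 n) c.projReg p w‖ ≤ B := by
  obtain ⟨a, ha, -⟩ := c.conic.limit_a
  obtain ⟨b, hb, _, -, c₁, hc₁, τ, hτ⟩ := c.conic.limit_b
  obtain ⟨δ₁, hδ₁, ha⟩ := ha K hKW hK 1 one_pos
  obtain ⟨δ₂, hδ₂, hb⟩ := hb K hKW hK 1 one_pos
  refine ⟨min δ₁ δ₂, ⟨lt_min hδ₁.1 hδ₂.1, (min_le_left _ _).trans hδ₁.2⟩, ?_⟩
  rintro ⟨η, ζ⟩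
  let D : E c.k × E c.m → E c.k × E c.m → ℝ := fun p w =>
    ‖mfderiv 𝓘(ℝ, E c.k × E c.m) (𝓡 n) c.projReg p w‖
  have hDD : ∀ p w, D p w ^ 2 = inner ℝ (mfderiv 𝓘(ℝ, E c.k × E c.m) (𝓡 n) c.projReg p w)
      (mfderiv 𝓘(ℝ, E c.k × E c.m) (𝓡 n) c.projReg p w) := fun p w =>
    (real_inner_self_eq_norm_sq _).symm
  have : Nontrivial (E c.m) := by
    have : Nonempty (Fin c.m) := ⟨⟨0, by have := c.two_le; omega⟩⟩
    infer_instance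
  obtain ⟨σ₀, hσ₀⟩ := exists_norm_eq (E c.m) zero_le_one
  have hr₀ : δ₁ / 2 ∈ Ioo 0 δ₁ := ⟨half_pos hδ₁.1, half_lt_self hδ₁.1⟩
  -- the coefficient `a` is compared with its values on the slice `z = r₀ σ₀`, a compact set
  obtain ⟨C₁, hC₁⟩ : ∃ C₁, ∀ y ∈ K, D (y, (δ₁ / 2) • σ₀) (η, 0) ≤ C₁ := by
    have hc : ContinuousOn (fun y => D (y, (δ₁ / 2) • σ₀) (η, 0)) K := by
      refine (continuousOn_norm_mfderiv c.isOpen_domainReg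
        ((c.localDiffeo.contMDiffOn).of_le (by simp)) (η, 0)).comp (by fun_prop) fun y hy => ?_
      refine ⟨⟨hKW hy, ?_⟩, ?_⟩
      · rw [mem_ball_zero_iff, norm_smul, hσ₀, mul_one, Real.norm_of_nonneg hr₀.1.le]
        exact hr₀.2.trans_le hδ₁.2
      · exact smul_ne_zero hr₀.1.ne' (norm_ne_zero_iff.1 (by rw [hσ₀]; exact one_ne_zero))
    obtain ⟨C, hC⟩ := (hK.image_of_continuousOn hc).bddAbove
    exact ⟨C, fun y hy => hC (mem_image_of_mem _ hy)⟩
  refine ⟨Real.sqrt (C₁ ^ 2 + 2 * ‖η‖ ^ 2) + ‖ζ‖ + Real.sqrt (c₁ ^ 2 + 1) * (2 * ‖ζ‖), ?_⟩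
  rintro ⟨y, z⟩ hy hz hzδ
  simp only at hy hz hzδ
  have hzn : 0 < ‖z‖ := norm_pos_iff.2 hz
  set σ : E c.m := ‖z‖⁻¹ • z with hσ
  have hσn : ‖σ‖ = 1 := by rw [hσ, norm_smul, norm_inv, norm_norm, inv_mul_cancel₀ hzn.ne']
  have hzσ : z = ‖z‖ • σ := by rw [hσ, smul_smul, mul_inv_cancel₀ hzn.ne', one_smul]
  have hz1 : ‖z‖ ∈ Ioo 0 δ₁ := ⟨hzn, hzδ.trans_le (min_le_left _ _)⟩
  have hz2 : ‖z‖ ∈ Ioo 0 δ₂ := ⟨hzn, hzδ.trans_le (min_le_right _ _)⟩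
  set s : ℝ := inner ℝ σ ζ with hs
  have hsζ : |s| ≤ ‖ζ‖ := by
    have := abs_real_inner_le_norm σ ζ
    rwa [hσn, one_mul] at this
  set θ : E c.m := ζ - s • σ with hθ
  have hθσ : inner ℝ σ θ = 0 := by
    rw [hθ, inner_sub_right, inner_smul_right, real_inner_self_eq_norm_sq, hσn, ← hs]; ring
  have hθn : ‖θ‖ ≤ 2 * ‖ζ‖ := by
    refine (norm_sub_le _ _).trans ?_
    rw [norm_smul, hσn, mul_one, Real.norm_eq_abs]
    linarith
  -- split the vector into parts along the singular stratum, radial, and angular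
  have hdec : ((η, ζ) : E c.k × E c.m) = (η, 0) + s • (0, σ) + (0, θ) := by
    rw [hθ]; ext1 <;> simp
  have h1 : D (y, z) (η, 0) ≤ Real.sqrt (C₁ ^ 2 + 2 * ‖η‖ ^ 2) := by
    refine Real.le_sqrt_of_sq_le ?_
    have e1 := ha y hy σ hσn ‖z‖ hz1 η η
    have e2 := ha y hy σ₀ hσ₀ (δ₁ / 2) hr₀ η η
    rw [← hzσ, ← hDD, abs_le] at e1
    rw [← hDD, abs_le] at e2
    have e3 : D (y, (δ₁ / 2) • σ₀) (η, 0) ^ 2 ≤ C₁ ^ 2 :=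
      pow_le_pow_left₀ (norm_nonneg _) (hC₁ y hy) 2
    nlinarith [e1.2, e2.1]
  have h2 : D (y, z) (0, σ) = 1 := by
    have e := c.conic.radial (y, z) ⟨⟨hKW hy, by
      rw [mem_ball_zero_iff]; exact hz1.2.trans_le hδ₁.2⟩, hz⟩ (0, σ)
    simp only at e
    rw [← hσ, ← hDD, real_inner_self_eq_norm_sq, hσn] at e
    have : 0 ≤ D (y, z) (0, σ) := norm_nonneg _
    nlinarith
  have h3 : D (y, z) (0, θ) ≤ Real.sqrt (c₁ ^ 2 + 1) * ‖θ‖ := by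
    have e := hb y hy σ hσn ‖z‖ hz2 θ θ hθσ hθσ
    rw [← hzσ, ← hDD, abs_le] at e
    have e' := ((hτ y (hKW hy)).2 σ hσn θ hθσ).2
    have e'' : τ y ^ 2 ≤ c₁ ^ 2 :=
      pow_le_pow_left₀ (hτ y (hKW hy)).1.1.le (hτ y (hKW hy)).1.2 2
    rw [← Real.sqrt_sq (norm_nonneg θ), ← Real.sqrt_mul (by positivity)]
    refine Real.le_sqrt_of_sq_le ?_
    nlinarith [e.2, sq_nonneg ‖θ‖]
  have h4 := norm_mfderiv_add_smul_add_le (n := n) c.projReg (y, z) (η, 0) (0, σ) (0, θ) s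
  rw [← hdec] at h4
  refine h4.trans ?_
  change D (y, z) (η, 0) + |s| * D (y, z) (0, σ) + D (y, z) (0, θ) ≤ _
  rw [h2, mul_one]
  have := mul_le_mul_of_nonneg_left hθn (Real.sqrt_nonneg (c₁ ^ 2 + 1))
  linarith

theorem det_gramOf_le {F : E n → Mreg} {y : E n} {B : ℝ} (hB0 : 0 ≤ B)
    (hB : ∀ i, ‖mfderiv 𝓘(ℝ, E n) (𝓡 n) F y (EuclideanSpace.single i (1 : ℝ))‖ ≤ B) :
    (gramOf F y).det ≤ n.factorial • (B ^ 2) ^ n := by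
  have h := Matrix.det_le (A := gramOf F y) (abv := (AbsoluteValue.abs : AbsoluteValue ℝ ℝ))
    (x := B ^ 2) fun i j => by
      change |gramOf F y i j| ≤ B ^ 2
      refine (abs_real_inner_le_norm (F := TangentSpace (𝓡 n) (F y)) _ _).trans ?_
      rw [sq]
      exact mul_le_mul (hB i) (hB j) (norm_nonneg _) hB0
  rw [Fintype.card_fin] at h
  exact (le_abs_self _).trans h

variable [MeasurableSpace M] [BorelSpace M]

/-- The area formula, as an inequality, for a parametrization that need only be locally
injective. -/
theorem regVolume_image_le {F : E n → Mreg} {U S : Set (E n)} (hU : IsOpen U)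
    (hF : ContMDiffOn 𝓘(ℝ, E n) (𝓡 n) 1 F U) (hinj : ∀ y ∈ U, ∃ V ∈ 𝓝 y, InjOn F V)
    (hS : MeasurableSet S) (hSU : S ⊆ U) {C : ENNReal}
    (hC : ∀ y ∈ S, ENNReal.ofReal (Real.sqrt (gramOf F y).det) ≤ C) :
    regVolume n Mreg (F '' S) ≤ C * volume S := by
  -- cut `S` into countably many pieces on which `F` is injective with values in one chart
  have hloc : ∀ y ∈ U, ∃ V, IsOpen V ∧ y ∈ V ∧ V ⊆ U ∧ InjOn F V ∧
      F '' V ⊆ (chartAt (E n) (F y)).source := fun y hy => by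
    obtain ⟨V, hV, hVi⟩ := hinj y hy
    have h1 : F ⁻¹' (chartAt (E n) (F y)).source ∈ 𝓝 y :=
      (hF.continuousOn.continuousAt (hU.mem_nhds hy)).preimage_mem_nhds
        ((chartAt (E n) (F y)).open_source.mem_nhds (mem_chart_source _ _))
    obtain ⟨V', hV', hV'o, hyV'⟩ := mem_nhds_iff.1
      (inter_mem (inter_mem hV h1) (hU.mem_nhds hy))
    exact ⟨V', hV'o, hyV', fun z hz => (hV' hz).2, hVi.mono fun z hz => (hV' hz).1.1,
      image_subset_iff.2 fun z hz => (hV' hz).1.2⟩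
  choose! V hVo hyV hVU hVi hVs using hloc
  obtain ⟨t, htU, htc, hcov⟩ := TopologicalSpace.countable_cover_nhdsWithin
    (f := V) (s := U) fun y hy => mem_nhdsWithin_of_mem_nhds ((hVo y hy).mem_nhds (hyV y hy))
  rcases t.eq_empty_or_nonempty with rfl | htn
  · have : S = ∅ := subset_empty_iff.1 (hSU.trans (hcov.trans (by simp)))
    simp [this]
  obtain ⟨q, rfl⟩ := htc.exists_eq_range htn
  have hqU : ∀ k, q k ∈ U := fun k => htU (mem_range_self k)
  let A : ℕ → Set (E n) := fun k => S ∩ V (q k)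
  have hA : ∀ k, MeasurableSet (A k) := fun k => hS.inter (hVo _ (hqU k)).measurableSet
  have hSA : S = ⋃ k, disjointed A k := by
    rw [iUnion_disjointed]
    refine Subset.antisymm (fun y hy => ?_) (iUnion_subset fun k => inter_subset_left)
    have := hcov (hSU hy)
    simp only [mem_range, iUnion_exists, iUnion_iUnion_eq', mem_iUnion] at this
    obtain ⟨k, hk⟩ := this
    exact mem_iUnion.2 ⟨k, hy, hk⟩
  have hB : ∀ k, disjointed A k ⊆ V (q k) := fun k =>
    (disjointed_subset A k).trans inter_subset_right
  have hBS : ∀ k, disjointed A k ⊆ S := fun k =>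
    (disjointed_subset A k).trans inter_subset_left
  have hBm : ∀ k, MeasurableSet (disjointed A k) := fun k => MeasurableSet.disjointed hA k
  have hk : ∀ k, regVolume n Mreg (F '' disjointed A k) ≤ C * volume (disjointed A k) := fun k => by
    have him : F '' disjointed A k ⊆ (chartAt (E n) (F (q k))).source :=
      (image_mono (hB k)).trans (hVs _ (hqU k))
    have hik : InjOn F (disjointed A k) := (hVi _ (hqU k)).mono (hB k)
    rw [regVolume_eq_chartVolume (F (q k)) ((hBm k).image_of_continuousOn_injOn
      (hF.continuousOn.mono ((hBS k).trans hSU)) hik) him,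
      chartVolume_image (F (q k)) hU hF (hBm k) ((hBS k).trans hSU) hik him]
    refine (setLIntegral_mono' (hBm k) fun y hy => hC y (hBS k hy)).trans ?_
    rw [setLIntegral_const]
  calc regVolume n Mreg (F '' S) = regVolume n Mreg (⋃ k, F '' disjointed A k) := by
        rw [← image_iUnion, ← hSA]
    _ ≤ ∑' k, regVolume n Mreg (F '' disjointed A k) := measure_iUnion_le _
    _ ≤ ∑' k, C * volume (disjointed A k) := ENNReal.tsum_le_tsum hk
    _ = C * volume S := by
        rw [ENNReal.tsum_mul_left, ← measure_iUnion (disjoint_disjointed A) hBm, ← hSA]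

theorem vol_image_val_le {S : Set M} {S' : Set Mreg} (h : ∀ x : Mreg, (x : M) ∈ S → x ∈ S')
    (hS : MeasurableSet S) : vol n Mreg S ≤ regVolume n Mreg S' := by
  rw [vol, Measure.map_apply measurable_subtype_coe hS]
  exact measure_mono h

theorem exists_nhds_vol_lt_top_of_regular (x₀ : Mreg) : ∃ S ∈ 𝓝 (x₀ : M), vol n Mreg S < ⊤ := by
  set φ := chartAt (E n) x₀ with hφ
  have hy : φ x₀ ∈ φ.target := φ.map_source (mem_chart_source _ _)
  obtain ⟨r, hr, hrt⟩ := Metric.nhds_basis_closedBall.mem_iff.1 (φ.open_target.mem_nhds hy)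
  have hb : Metric.ball (φ x₀) r ⊆ φ.target := Metric.ball_subset_closedBall.trans hrt
  have hc : ContinuousOn (fun y => ENNReal.ofReal (Real.sqrt (gramOf φ.symm y).det))
      (Metric.closedBall (φ x₀) r) :=
    ENNReal.continuous_ofReal.comp_continuousOn ((continuousOn_sqrt_det_chartGram x₀).mono hrt)
  obtain ⟨y₁, -, hmax⟩ := (isCompact_closedBall (φ x₀) r).exists_isMaxOn
    ⟨φ x₀, Metric.mem_closedBall_self hr.le⟩ hc
  have hopen : IsOpen (φ.symm '' Metric.ball (φ x₀) r) :=
    φ.isOpen_image_symm_of_subset_target Metric.isOpen_ball hb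
  have hopen' : IsOpen (Subtype.val '' (φ.symm '' Metric.ball (φ x₀) r) : Set M) :=
    Mreg.isOpen.isOpenMap_subtype_val _ hopen
  refine ⟨_, hopen'.mem_nhds ⟨x₀, ⟨φ x₀, Metric.mem_ball_self hr,
    φ.left_inv (mem_chart_source _ _)⟩, rfl⟩, ?_⟩
  refine (vol_image_val_le (n := n) (S' := φ.symm '' Metric.ball (φ x₀) r) ?_
    hopen'.measurableSet).trans_lt ?_
  · rintro x ⟨x', hx', e⟩
    rwa [← Subtype.ext e]
  refine (regVolume_image_le φ.open_target (contMDiffOn_chartSymm x₀)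
    (fun y hy => ⟨_, φ.open_target.mem_nhds hy, φ.symm.injOn⟩) measurableSet_ball hb
    fun y hy => hmax (Metric.ball_subset_closedBall hy)).trans_lt ?_
  exact ENNReal.mul_lt_top ENNReal.ofReal_lt_top measure_ball_lt_top

/-- The image of a small conic neighbourhood has finite volume, by the area formula and the bound on
the differential. The linear isomorphism `ℓ` only identifies the model spaces. -/
theorem ConicChart.exists_nhds_vol_lt_top (c : ConicChart n Mreg) {p : E c.k × E c.m}
    (hp : p ∈ conicDomain c.W c.R) (hp0 : p.2 = 0) : ∃ S ∈ 𝓝 (c.proj p), vol n Mreg S < ⊤ := by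
  obtain ⟨ρ, hρ, hρW⟩ := Metric.nhds_basis_closedBall.mem_iff.1 (c.isOpen_W.mem_nhds hp.1)
  obtain ⟨δ, hδ, hB⟩ := c.norm_mfderiv_projReg_le hρW (isCompact_closedBall p.1 ρ)
  choose B hB using hB
  let N : Set (E c.k × E c.m) := Metric.ball p.1 ρ ×ˢ Metric.ball 0 δ
  have hN : N ⊆ conicDomain c.W c.R := prod_mono (Metric.ball_subset_closedBall.trans hρW)
    (Metric.ball_subset_ball hδ.2)
  have hNo : IsOpen N := Metric.isOpen_ball.prod Metric.isOpen_ball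
  have hpN : p ∈ N := ⟨Metric.mem_ball_self hρ, by rw [hp0]; exact Metric.mem_ball_self hδ.1⟩
  have hNreg : ∀ q ∈ N, q.2 ≠ 0 → q ∈ conicDomainReg c.W c.R := fun q hq h => ⟨hN hq, h⟩
  have hopen := c.isOpen_image N hN hNo
  have hfr : Module.finrank ℝ (E n) = Module.finrank ℝ (E c.k × E c.m) := by
    simp [c.dim_eq]
  let ℓ : E n ≃L[ℝ] E c.k × E c.m := ContinuousLinearEquiv.ofFinrankEq hfr
  let F : E n → Mreg := fun y => c.projReg (ℓ y)
  let U : Set (E n) := ℓ ⁻¹' conicDomainReg c.W c.R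
  let S : Set (E n) := ℓ ⁻¹' (N ∩ {q | q.2 ≠ 0})
  have hU : IsOpen U := c.isOpen_domainReg.preimage ℓ.continuous
  have hSU : S ⊆ U := fun y hy => hNreg _ hy.1 hy.2
  have hSm : IsOpen S :=
    (hNo.inter (isOpen_ne_fun continuous_snd continuous_const)).preimage ℓ.continuous
  have hproj : ContMDiffOn 𝓘(ℝ, E c.k × E c.m) (𝓡 n) 1 c.projReg (conicDomainReg c.W c.R) :=
    c.localDiffeo.contMDiffOn.of_le (by simp)
  have hℓ : ContMDiff 𝓘(ℝ, E n) 𝓘(ℝ, E c.k × E c.m) 1 ℓ := ℓ.contDiff.contMDiff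
  have hF : ContMDiffOn 𝓘(ℝ, E n) (𝓡 n) 1 F U := hproj.comp hℓ.contMDiffOn fun _ h => h
  have hinj : ∀ y ∈ U, ∃ V ∈ 𝓝 y, InjOn F V := fun y hy => by
    obtain ⟨Φ, hyΦ, hΦ⟩ := c.localDiffeo ⟨ℓ y, hy⟩
    refine ⟨ℓ ⁻¹' Φ.source, ℓ.continuous.continuousAt.preimage_mem_nhds
      (Φ.open_source.mem_nhds hyΦ), fun z hz z' hz' h => ℓ.injective ?_⟩
    refine Φ.toPartialEquiv.injOn hz hz' ?_
    exact (hΦ hz).symm.trans (Eq.trans h (hΦ hz'))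
  have hSvol : volume S < ⊤ := by
    have h1 : Bornology.IsBounded (ℓ.symm '' N) :=
      ℓ.symm.lipschitz.isBounded_image (Metric.isBounded_ball.prod Metric.isBounded_ball)
    refine (h1.subset ?_).measure_lt_top
    intro y hy
    exact ⟨ℓ y, hy.1, ℓ.symm_apply_apply y⟩
  set B₀ : ℝ := ∑ i : Fin n, |B (ℓ (EuclideanSpace.single i (1 : ℝ)))| with hB₀
  have hgram : ∀ y ∈ S, (gramOf F y).det ≤ n.factorial • (B₀ ^ 2) ^ n := fun y hy => by
    refine det_gramOf_le (Finset.sum_nonneg fun i _ => abs_nonneg _) fun i => ?_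
    have hcomp : (mfderiv 𝓘(ℝ, E n) (𝓡 n) F y : E n →L[ℝ] E n) =
        (mfderiv 𝓘(ℝ, E c.k × E c.m) (𝓡 n) c.projReg (ℓ y) : E c.k × E c.m →L[ℝ] E n).comp
          (ℓ : E n →L[ℝ] E c.k × E c.m) := by
      refine (mfderiv_comp (I' := 𝓘(ℝ, E c.k × E c.m)) y
        ((hproj.contMDiffAt (c.isOpen_domainReg.mem_nhds (hSU hy))).mdifferentiableAt one_ne_zero)
        ℓ.differentiableAt.mdifferentiableAt).trans ?_
      rw [mfderiv_eq_fderiv, ℓ.fderiv]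
      rfl
    have h1 := hB (ℓ (EuclideanSpace.single i (1 : ℝ))) (ℓ y)
      (Metric.ball_subset_closedBall hy.1.1) hy.2 (mem_ball_zero_iff.1 hy.1.2)
    refine (le_trans (le_of_eq ?_) h1).trans ((le_abs_self _).trans
      (Finset.single_le_sum (f := fun i => |B (ℓ (EuclideanSpace.single i (1 : ℝ)))|)
        (fun i _ => abs_nonneg _) (Finset.mem_univ i)))
    exact congrArg (fun L : E n →L[ℝ] E n => @norm (TangentSpace (𝓡 n) (F y)) _
      (L (EuclideanSpace.single i (1 : ℝ)))) hcomp
  refine ⟨_, hopen.mem_nhds (mem_image_of_mem _ hpN), ?_⟩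
  refine (vol_image_val_le (n := n) (S' := F '' S) ?_ hopen.measurableSet).trans_lt ?_
  · rintro x ⟨q, hq, e⟩
    have hq2 : q.2 ≠ 0 := (c.mem_reg q (hN hq)).1 (e ▸ x.2)
    refine ⟨ℓ.symm q, ?_, Subtype.ext ?_⟩
    · simp only [S, mem_preimage, ContinuousLinearEquiv.apply_symm_apply]
      exact ⟨hq, hq2⟩
    · simp only [F, ContinuousLinearEquiv.apply_symm_apply]
      rw [c.coe_projReg q (hNreg q hq hq2), e]
  refine (regVolume_image_le hU hF hinj hSm.measurableSet hSU fun y hy =>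
    ENNReal.ofReal_le_ofReal (Real.sqrt_le_sqrt (hgram y hy))).trans_lt ?_
  exact ENNReal.mul_lt_top ENNReal.ofReal_lt_top hSvol

/-- The Riemannian volume is finite on compact subsets of the conic manifold. -/
theorem IsConicManifold.isLocallyFiniteMeasure_vol (hM : IsConicManifold 𝒜) :
    IsLocallyFiniteMeasure (vol n Mreg) where
  finiteAtNhds x := by
    by_cases hx : x ∈ Mreg
    · exact exists_nhds_vol_lt_top_of_regular ⟨x, hx⟩
    · obtain ⟨c, -, p, hp, rfl⟩ := hM.cover x hx
      refine c.exists_nhds_vol_lt_top hp ?_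
      by_contra h
      exact hx ((c.mem_reg p hp).2 h)

end FiniteVolume

/-! ### Measurable orthonormal frames -/

section GramSchmidt

open InnerProductSpace

variable {n : ℕ} {X : Type*} [MeasurableSpace X] {μ : Measure X} {V : X → Type*}
  [∀ x, NormedAddCommGroup (V x)] [∀ x, InnerProductSpace ℝ (V x)]

/-- The induction step: the `k`-th vector is measurable if the preceding ones are. -/
theorem aestronglyMeasurable_gramSchmidt_of_lt {f : Fin n → ∀ x, V x} (k : Fin n)
    (hf : ∀ i j, AEStronglyMeasurable (fun x => (inner ℝ (f i x) (f j x) : ℝ)) μ)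
    (h : ∀ j < k, ∀ α : ∀ x, V x →ₗ[ℝ] ℝ, (∀ i, AEStronglyMeasurable (fun x => α x (f i x)) μ) →
      AEStronglyMeasurable (fun x => α x (gramSchmidt ℝ (fun i => f i x) j)) μ)
    {𝔽 : Type*} [NormedAddCommGroup 𝔽] [NormedSpace ℝ 𝔽] (α : ∀ x, V x →ₗ[ℝ] 𝔽)
    (hα : ∀ i, AEStronglyMeasurable (fun x => α x (f i x)) μ)
    (hα' : ∀ j < k, AEStronglyMeasurable (fun x => α x (gramSchmidt ℝ (fun i => f i x) j)) μ) :
    AEStronglyMeasurable (fun x => α x (gramSchmidt ℝ (fun i => f i x) k)) μ := by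
  have h1 : ∀ j < k, ∀ i, AEStronglyMeasurable
      (fun x => (inner ℝ (gramSchmidt ℝ (fun i => f i x) j) (f i x) : ℝ)) μ := fun j hj i => by
    refine (h j hj (fun x => (innerSL ℝ (f i x)).toLinearMap) fun l => hf i l).congr
      (Eventually.of_forall fun x => ?_)
    exact real_inner_comm _ _
  have h2 : ∀ j < k, AEStronglyMeasurable
      (fun x => ‖gramSchmidt ℝ (fun i => f i x) j‖ ^ 2) μ := fun j hj => by
    refine (h j hj (fun x => (innerSL ℝ (gramSchmidt ℝ (fun i => f i x) j)).toLinearMap)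
      fun l => h1 j hj l).congr (Eventually.of_forall fun x => ?_)
    exact real_inner_self_eq_norm_sq _
  have e : ∀ x, α x (gramSchmidt ℝ (fun i => f i x) k) = α x (f k x) -
      ∑ j ∈ Finset.Iio k, ((inner ℝ (gramSchmidt ℝ (fun i => f i x) j) (f k x) : ℝ) *
        (‖gramSchmidt ℝ (fun i => f i x) j‖ ^ 2)⁻¹) •
          α x (gramSchmidt ℝ (fun i => f i x) j) := fun x => by
    conv_lhs => rw [gramSchmidt_def]
    rw [map_sub, map_sum]
    simp only [Submodule.starProjection_singleton, map_smul, div_eq_mul_inv]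
    rfl
  simp_rw [e]
  refine (hα k).sub (Finset.aestronglyMeasurable_fun_sum _ fun j hj => ?_)
  have hj' := Finset.mem_Iio.1 hj
  exact ((h1 j hj' k).mul (h2 j hj').inv₀).smul (hα' j hj')

/-- Gram–Schmidt orthogonalization preserves measurability. Vectors of the varying spaces `V x`
are measured by testing them against a family `α` of linear forms. -/
theorem aestronglyMeasurable_gramSchmidt {f : Fin n → ∀ x, V x}
    (hf : ∀ i j, AEStronglyMeasurable (fun x => (inner ℝ (f i x) (f j x) : ℝ)) μ)
    {𝔽 : Type*} [NormedAddCommGroup 𝔽] [NormedSpace ℝ 𝔽] (α : ∀ x, V x →ₗ[ℝ] 𝔽)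
    (hα : ∀ i, AEStronglyMeasurable (fun x => α x (f i x)) μ) (k : Fin n) :
    AEStronglyMeasurable (fun x => α x (gramSchmidt ℝ (fun i => f i x) k)) μ := by
  have hreal : ∀ k : Fin n, ∀ α : ∀ x, V x →ₗ[ℝ] ℝ,
      (∀ i, AEStronglyMeasurable (fun x => α x (f i x)) μ) →
      AEStronglyMeasurable (fun x => α x (gramSchmidt ℝ (fun i => f i x) k)) μ := by
    intro k
    induction k using WellFoundedLT.induction with
    | ind k ih =>
      intro α hα
      exact aestronglyMeasurable_gramSchmidt_of_lt k hf ih α hα fun j hj => ih j hj α hα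
  induction k using WellFoundedLT.induction with
  | ind k ih => exact aestronglyMeasurable_gramSchmidt_of_lt k hf (fun j _ => hreal j) α hα ih

theorem aestronglyMeasurable_gramSchmidtNormed {f : Fin n → ∀ x, V x}
    (hf : ∀ i j, AEStronglyMeasurable (fun x => (inner ℝ (f i x) (f j x) : ℝ)) μ)
    {𝔽 : Type*} [NormedAddCommGroup 𝔽] [NormedSpace ℝ 𝔽] (α : ∀ x, V x →ₗ[ℝ] 𝔽)
    (hα : ∀ i, AEStronglyMeasurable (fun x => α x (f i x)) μ) (k : Fin n) :
    AEStronglyMeasurable (fun x => α x (gramSchmidtNormed ℝ (fun i => f i x) k)) μ := by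
  have h1 : ∀ i, AEStronglyMeasurable
      (fun x => (inner ℝ (gramSchmidt ℝ (fun i => f i x) k) (f i x) : ℝ)) μ := fun i => by
    refine (aestronglyMeasurable_gramSchmidt hf (fun x => (innerSL ℝ (f i x)).toLinearMap)
      (fun l => hf i l) k).congr (Eventually.of_forall fun x => ?_)
    exact real_inner_comm _ _
  have h2 : AEStronglyMeasurable (fun x => ‖gramSchmidt ℝ (fun i => f i x) k‖ ^ 2) μ := by
    refine (aestronglyMeasurable_gramSchmidt hf
      (fun x => (innerSL ℝ (gramSchmidt ℝ (fun i => f i x) k)).toLinearMap)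
      (fun l => h1 l) k).congr (Eventually.of_forall fun x => ?_)
    exact real_inner_self_eq_norm_sq _
  have h3 : AEStronglyMeasurable (fun x => ‖gramSchmidt ℝ (fun i => f i x) k‖) μ :=
    (Real.continuous_sqrt.comp_aestronglyMeasurable h2).congr
      (Eventually.of_forall fun x => Real.sqrt_sq (norm_nonneg _))
  refine (h3.inv₀.smul (aestronglyMeasurable_gramSchmidt hf α hα k)).congr
    (Eventually.of_forall fun x => ?_)
  simp [gramSchmidtNormed, map_smul]

theorem gramSchmidtOrthonormalBasis_apply_of_linearIndependent {V : Type*} [NormedAddCommGroup V]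
    [InnerProductSpace ℝ V] [FiniteDimensional ℝ V] {f : Fin n → V}
    (h : Module.finrank ℝ V = Fintype.card (Fin n)) (hf : LinearIndependent ℝ f) (k : Fin n) :
    gramSchmidtOrthonormalBasis h f k = gramSchmidtNormed ℝ f k := by
  refine gramSchmidtOrthonormalBasis_apply h fun h0 => ?_
  have h1 := gramSchmidtNormed_unit_length (𝕜 := ℝ) k hf
  rw [h0, norm_zero] at h1
  exact zero_ne_one h1

end GramSchmidt

section Frame

variable {n : ℕ} {M : Type*} [MetricSpace M] {Mreg : TopologicalSpace.Opens M}
  [ChartedSpace (E n) Mreg] [IsManifold (𝓡 n) ∞ Mreg]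
  [RiemannianBundle (fun x : Mreg => TangentSpace (𝓡 n) x)]
  [IsContMDiffRiemannianBundle (𝓡 n) ∞ (E n) (fun x : Mreg => TangentSpace (𝓡 n) x)]
  [MeasurableSpace M] [BorelSpace M] {𝕜 : Type*} [RCLike 𝕜]

/-- Null sets may be computed in a chart: the volume is absolutely continuous there. -/
theorem ae_restrict_source {x₀ : Mreg} {p : Mreg → Prop}
    (h : ∀ᵐ y ∂(volume.restrict (chartAt (E n) x₀).target), p ((chartAt (E n) x₀).symm y)) :
    ∀ᵐ x ∂((regVolume n Mreg).restrict (chartAt (E n) x₀).source), p x := by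
  set φ := chartAt (E n) x₀ with hφ
  set N := toMeasurable (volume.restrict φ.target) {y | ¬ p (φ.symm y)} with hN
  have hN0 : volume.restrict φ.target N = 0 := by rw [hN, measure_toMeasurable]; exact h
  have hNm : MeasurableSet N := measurableSet_toMeasurable _ _
  have hcont : ContinuousOn φ φ.source := φ.continuousOn
  have hSm : MeasurableSet (φ.source ∩ φ ⁻¹' N) := by
    have h1 := (continuousOn_iff_continuous_domRestrict.1 hcont).measurable hNm
    have h2 := φ.open_source.measurableSet.subtype_image h1
    convert h2 using 1
    ext y
    simp [Set.domRestrict, and_comm]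
  have hS0 : (regVolume n Mreg).restrict φ.source (φ.source ∩ φ ⁻¹' N) = 0 := by
    rw [regVolume_restrict_source, chartVolume_apply x₀ hSm]
    refine setLIntegral_measure_zero _ _ ?_
    rw [Measure.restrict_apply hNm] at hN0
    refine measure_mono_null ?_ hN0
    rintro y ⟨hy, -, hyN⟩
    rw [mem_preimage, φ.right_inv hy] at hyN
    exact ⟨hyN, hy⟩
  rw [ae_restrict_iff' φ.open_source.measurableSet]
  rw [Measure.restrict_apply hSm] at hS0
  refine measure_mono_null ?_ hS0
  intro x hx
  simp only [mem_compl_iff, mem_ofPred_eq, not_forall] at hx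
  obtain ⟨hxs, hxp⟩ := hx
  refine ⟨⟨hxs, subset_toMeasurable _ _ ?_⟩, hxs⟩
  simpa [φ.left_inv hxs] using hxp

/-- The converse of `ae_restrict_source`, as the density of the volume is positive. -/
theorem ae_chart_of_ae_regVolume {p : Mreg → Prop} (h : ∀ᵐ x ∂(regVolume n Mreg), p x)
    (x₀ : Mreg) :
    ∀ᵐ y ∂(volume.restrict (chartAt (E n) x₀).target), p ((chartAt (E n) x₀).symm y) := by
  have hm : MeasurableSet (chartAt (E n) x₀).target := (chartAt (E n) x₀).open_target.measurableSet
  have h1 : ∀ᵐ x ∂(chartVolume (n := n) x₀), p x := by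
    rw [← regVolume_restrict_source]
    exact ae_restrict_of_ae h
  have h2 := ae_of_ae_map ((aemeasurable_chartSymm x₀).mono_ac
    (withDensity_absolutelyContinuous _ _)) h1
  refine (withDensity_absolutelyContinuous' (aemeasurable_chartDensity x₀) ?_) h2
  refine (ae_restrict_iff' hm).2 (Eventually.of_forall fun y hy => ?_)
  exact (ENNReal.ofReal_pos.2 (Real.sqrt_pos.2 (det_chartGram_pos x₀ hy))).ne'

theorem aestronglyMeasurable_restrict_source {x₀ : Mreg} {𝔽 : Type*} [NormedAddCommGroup 𝔽]
    {g : Mreg → 𝔽} (h : AEStronglyMeasurable (fun y => g ((chartAt (E n) x₀).symm y))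
      (volume.restrict (chartAt (E n) x₀).target)) :
    AEStronglyMeasurable g ((regVolume n Mreg).restrict (chartAt (E n) x₀).source) := by
  set φ := chartAt (E n) x₀ with hφ
  obtain ⟨g', hg', hgg'⟩ := h
  have h1 : AEMeasurable φ ((regVolume n Mreg).restrict φ.source) :=
    φ.continuousOn.aemeasurable φ.open_source.measurableSet
  have h2 : AEStronglyMeasurable (fun x => g' (φ x)) ((regVolume n Mreg).restrict φ.source) :=
    hg'.aestronglyMeasurable.comp_aemeasurable h1
  refine h2.congr ?_
  refine ae_restrict_source (p := fun x => g' (φ x) = g x) ?_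
  filter_upwards [hgg', ae_restrict_mem φ.open_target.measurableSet] with y hy hyt
  rw [φ.right_inv hyt]
  exact hy.symm

section Center

variable [SecondCountableTopology M]

variable (n Mreg) in
/-- By second countability, countably many charts cover the regular part. -/
theorem exists_measurable_center : ∃ ctr : Mreg → Mreg, (range ctr).Countable ∧
    (∀ x, x ∈ (chartAt (E n) (ctr x)).source) ∧ ∀ z, MeasurableSet (ctr ⁻¹' {z}) := by
  rcases isEmpty_or_nonempty Mreg with he | hne
  · exact ⟨id, (Set.to_countable _), fun x => (he.false x).elim, fun z => (he.false z).elim⟩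
  obtain ⟨t, htc, ht⟩ := TopologicalSpace.countable_cover_nhds
    (f := fun x : Mreg => (chartAt (E n) x).source) fun x =>
      (chartAt (E n) x).open_source.mem_nhds (mem_chart_source _ x)
  have htn : t.Nonempty := by
    by_contra h
    rw [not_nonempty_iff_eq_empty] at h
    subst h
    simp only [mem_empty_iff_false, iUnion_of_empty, iUnion_empty] at ht
    exact (hne.elim fun x => (ht ▸ mem_univ x : x ∈ (∅ : Set Mreg)))
  obtain ⟨q, rfl⟩ := htc.exists_eq_range htn
  have hex : ∀ x : Mreg, ∃ k, x ∈ (chartAt (E n) (q k)).source := fun x => by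
    have := ht ▸ mem_univ x
    simpa using this
  classical
  refine ⟨fun x => q (Nat.find (hex x)), (countable_range q).mono ?_, fun x =>
    Nat.find_spec (hex x), fun z => ?_⟩
  · rintro _ ⟨x, rfl⟩
    exact mem_range_self _
  have hk : Measurable fun x => Nat.find (hex x) :=
    measurable_find hex fun k => (chartAt (E n) (q k)).open_source.measurableSet
  exact hk (.of_discrete (s := q ⁻¹' {z}))

variable (n) in
/-- A choice of chart around each regular point, with countably many values. -/
def chartCenter (x : Mreg) : Mreg := (exists_measurable_center n Mreg).choose x

theorem mem_source_chartCenter (x : Mreg) : x ∈ (chartAt (E n) (chartCenter n x)).source :=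
  (exists_measurable_center n Mreg).choose_spec.2.1 x

/-- Functions that are measurable on every chart domain may be glued along `chartCenter`. -/
theorem aestronglyMeasurable_chartCenter {𝔽 : Type*} [NormedAddCommGroup 𝔽]
    {Φ : Mreg → Mreg → 𝔽} (h : ∀ z, AEStronglyMeasurable (Φ z)
      ((regVolume n Mreg).restrict (chartAt (E n) z).source)) :
    AEStronglyMeasurable (fun x => Φ (chartCenter n x) x) (regVolume n Mreg) := by
  have hc : Countable (range (chartCenter n (Mreg := Mreg))) :=
    (exists_measurable_center n Mreg).choose_spec.1.to_subtype
  have hm : ∀ z, MeasurableSet (chartCenter n (Mreg := Mreg) ⁻¹' {z}) :=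
    (exists_measurable_center n Mreg).choose_spec.2.2
  have hU : (⋃ z : range (chartCenter n (Mreg := Mreg)),
      chartCenter n (Mreg := Mreg) ⁻¹' {z.1}) = univ :=
    eq_univ_of_forall fun x => mem_iUnion.2 ⟨⟨_, mem_range_self x⟩, rfl⟩
  rw [← Measure.restrict_univ (μ := regVolume n Mreg), ← hU, aestronglyMeasurable_iUnion_iff]
  intro z
  have hs : chartCenter n (Mreg := Mreg) ⁻¹' {z.1} ⊆ (chartAt (E n) z.1).source := fun x hx => by
    have := mem_source_chartCenter (n := n) x
    rwa [show chartCenter n x = z.1 from hx] at this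
  refine ((h z.1).mono_measure (Measure.restrict_mono hs le_rfl)).congr ?_
  refine (ae_restrict_iff' (hm _)).2 (Eventually.of_forall fun x hx => ?_)
  exact congrArg (fun w => Φ w x) (show chartCenter n x = z.1 from hx).symm

theorem ae_regVolume_of_chart {p : Mreg → Prop}
    (h : ∀ x₀ : Mreg, ∀ᵐ y ∂(volume.restrict (chartAt (E n) x₀).target),
      p ((chartAt (E n) x₀).symm y)) : ∀ᵐ x ∂(regVolume n Mreg), p x := by
  have hc : Countable (range (chartCenter n (Mreg := Mreg))) :=
    (exists_measurable_center n Mreg).choose_spec.1.to_subtype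
  have hall : ∀ᵐ x ∂(regVolume n Mreg), ∀ z : range (chartCenter n (Mreg := Mreg)),
      x ∈ (chartAt (E n) z.1).source → p x := by
    rw [ae_all_iff]
    intro z
    exact (ae_restrict_iff' (chartAt (E n) z.1).open_source.measurableSet).1
      (ae_restrict_source (h z.1))
  filter_upwards [hall] with x hx
  exact hx ⟨_, mem_range_self x⟩ (mem_source_chartCenter x)

end Center

/-- The coordinate vector field of the chart at `x₀`, as a vector field on the chart domain. -/
def frameVec (x₀ : Mreg) (i : Fin n) (x : Mreg) : TangentSpace (𝓡 n) x :=
  (show E n from coordVec x₀ i (chartAt (E n) x₀ x))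

theorem frameVec_chartSymm (x₀ : Mreg) (i : Fin n) {y : E n}
    (hy : y ∈ (chartAt (E n) x₀).target) :
    frameVec x₀ i ((chartAt (E n) x₀).symm y) = coordVec x₀ i y := by
  have h := (chartAt (E n) x₀).right_inv hy
  exact congrArg (fun z => (show E n from coordVec x₀ i z)) h

/-- Measurability of a covector field: its components in each chart are measurable. -/
def IsMeasurableField (A : CovectorField n Mreg 𝕜) : Prop :=
  ∀ (x₀ : Mreg) (i : Fin n), AEStronglyMeasurable
    (fun y => A ((chartAt (E n) x₀).symm y) (coordVec x₀ i y))
    (volume.restrict (chartAt (E n) x₀).target)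

theorem linearIndependent_frameVec {x₀ x : Mreg} (hx : x ∈ (chartAt (E n) x₀).source) :
    LinearIndependent ℝ fun i => frameVec (n := n) x₀ i x := by
  have h := linearIndependent_coordVec x₀ ((chartAt (E n) x₀).map_source hx)
  exact h

instance (x : Mreg) : FiniteDimensional ℝ (TangentSpace (𝓡 n) x) :=
  inferInstanceAs (FiniteDimensional ℝ (E n))

theorem finrank_tangentSpace (x : Mreg) : 
    Module.finrank ℝ (TangentSpace (𝓡 n) x) = Fintype.card (Fin n) := by
  rw [Fintype.card_fin]
  exact finrank_euclideanSpace_fin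

variable [SecondCountableTopology M]

variable (n) in
/-- A measurable orthonormal frame of the regular part. -/
def orthoFrame (x : Mreg) : OrthonormalBasis (Fin n) ℝ (TangentSpace (𝓡 n) x) :=
  InnerProductSpace.gramSchmidtOrthonormalBasis (finrank_tangentSpace x)
    fun i => frameVec (chartCenter n x) i x

theorem orthoFrame_apply (x : Mreg) (k : Fin n) :
    orthoFrame n x k = InnerProductSpace.gramSchmidtNormed ℝ (E := TangentSpace (𝓡 n) x)
      (fun i => frameVec (chartCenter n x) i x) k :=
  gramSchmidtOrthonormalBasis_apply_of_linearIndependent (V := TangentSpace (𝓡 n) x)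
    (f := fun i => frameVec (chartCenter n x) i x) (finrank_tangentSpace x)
    (linearIndependent_frameVec (mem_source_chartCenter (n := n) x)) k

theorem IsMeasurableField.aestronglyMeasurable {A : CovectorField n Mreg 𝕜}
    (hA : IsMeasurableField A) (k : Fin n) :
    AEStronglyMeasurable (fun x => A x (orthoFrame n x k)) (regVolume n Mreg) := by
  simp_rw [orthoFrame_apply]
  refine aestronglyMeasurable_gramSchmidtNormed (V := fun x : Mreg => TangentSpace (𝓡 n) x)
    (f := fun i x => frameVec (chartCenter n x) i x) (fun i j => ?_)
    (fun x => (A x).toLinearMap) (fun i => ?_) k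
  · refine aestronglyMeasurable_chartCenter
      (Φ := fun z x => (inner ℝ (frameVec z i x) (frameVec z j x) : ℝ)) fun z => ?_
    refine aestronglyMeasurable_restrict_source ?_
    have hc : ContinuousOn (fun y => chartGram z y i j) (chartAt (E n) z).target :=
      continuousOn_inner_mfderiv (chartAt (E n) z).open_target (contMDiffOn_chartSymm z) _ _
    refine (hc.aestronglyMeasurable (chartAt (E n) z).open_target.measurableSet).congr ?_
    filter_upwards [ae_restrict_mem (chartAt (E n) z).open_target.measurableSet] with y hy
    rw [frameVec_chartSymm z i hy, frameVec_chartSymm z j hy]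
    rfl
  · refine aestronglyMeasurable_chartCenter (Φ := fun z x => A x (frameVec z i x)) fun z => ?_
    refine aestronglyMeasurable_restrict_source ((hA z i).congr ?_)
    filter_upwards [ae_restrict_mem (chartAt (E n) z).open_target.measurableSet] with y hy
    rw [frameVec_chartSymm z i hy]

end Frame

section Cometric

variable {n : ℕ} {M : Type*} [MetricSpace M] {Mreg : TopologicalSpace.Opens M}
  [ChartedSpace (E n) Mreg] [RiemannianBundle (fun x : Mreg => TangentSpace (𝓡 n) x)]
  {𝕜 : Type*} [RCLike 𝕜]

open scoped Matrix in
/-- In an orthonormal basis the pairing of covectors is the standard one. -/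
theorem cometric_eq_sum {x : Mreg} (b : OrthonormalBasis (Fin n) ℝ (TangentSpace (𝓡 n) x))
    (α β : TangentSpace (𝓡 n) x →L[ℝ] 𝕜) :
    cometric x α β = ∑ k, α (b k) * (starRingEnd 𝕜) (β (b k)) := by
  let Q : Matrix (Fin n) (Fin n) ℝ := Matrix.of fun i k => (show E n from b k) i
  have hb : ∀ k, b k = ∑ i, Q i k • tangentBasis x i := fun k => by
    have := ((EuclideanSpace.basisFun (Fin n) ℝ).sum_repr (show E n from b k)).symm
    simp only [EuclideanSpace.basisFun_apply] at this
    exact this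
  have hQ : Qᵀ * gram x * Q = 1 := by
    ext k l
    have h := b.inner_eq_ite k l
    rw [hb k, hb l, inner_sum_smul] at h
    rw [Matrix.one_apply, ← h, Matrix.mul_apply]
    simp only [Matrix.mul_apply, Matrix.transpose_apply, Finset.sum_mul]
    rw [Finset.sum_comm]
    rfl
  have hinv : (gram x)⁻¹ = Q * Qᵀ := by
    refine Matrix.inv_eq_left_inv ?_
    rw [Matrix.mul_assoc]
    exact mul_eq_one_comm.1 hQ
  have hαb : ∀ (γ : TangentSpace (𝓡 n) x →L[ℝ] 𝕜) k,
      γ (b k) = ∑ i, algebraMap ℝ 𝕜 (Q i k) * γ (tangentBasis x i) := fun γ k => by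
    rw [hb k, map_sum]
    exact Finset.sum_congr rfl fun i _ => by rw [map_smul, Algebra.smul_def]
  have hk : ∀ k, α (b k) * (starRingEnd 𝕜) (β (b k)) = ∑ i, ∑ j,
      algebraMap ℝ 𝕜 (Q i k * Q j k) * α (tangentBasis x i) *
        (starRingEnd 𝕜) (β (tangentBasis x j)) := fun k => by
    rw [hαb α, hαb β, map_sum, Finset.sum_mul_sum]
    refine Finset.sum_congr rfl fun i _ => Finset.sum_congr rfl fun j _ => ?_
    simp only [map_mul, RCLike.algebraMap_eq_ofReal, RCLike.conj_ofReal]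
    ring
  simp_rw [hk, cometric, hinv]
  refine (Finset.sum_comm.trans (Finset.sum_congr rfl fun i _ =>
    Finset.sum_comm.trans (Finset.sum_congr rfl fun j _ => ?_))).symm
  rw [Matrix.mul_apply, map_sum, Finset.sum_mul, Finset.sum_mul]
  rfl

end Cometric

/-! ### Linear operations on weak derivatives -/

section WeakDeriv

variable {n : ℕ} {F : Type*} [NormedAddCommGroup F] [NormedSpace ℝ F]
  {U : Set (E n)} {u u' A A' : E n → F} {v : E n}

theorem integrable_smul_of_locallyIntegrableOn (hu : LocallyIntegrableOn u U volume)
    {c : E n → ℝ} (hc : Continuous c) (hcc : HasCompactSupport c) (hcU : tsupport c ⊆ U) :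
    Integrable (fun y => c y • u y) := by
  refine (integrableOn_iff_integrable_of_support_subset (s := tsupport c) ?_).1
    ((hu.integrableOn_compact_subset hcU hcc.isCompact).continuousOn_smul hc.continuousOn
      hcc.isCompact)
  exact (Function.support_smul_subset_left c u).trans (subset_tsupport c)

theorem continuous_fderiv_apply' {ψ : E n → ℝ} (hψ : ContDiff ℝ ∞ ψ) (v : E n) :
    Continuous fun y => fderiv ℝ ψ y v :=
  (hψ.continuous_fderiv (by simp)).clm_apply continuous_const

theorem hasCompactSupport_fderiv_apply' {ψ : E n → ℝ} (hψ : HasCompactSupport ψ) (v : E n) :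
    HasCompactSupport fun y => fderiv ℝ ψ y v :=
  hψ.fderiv_apply (𝕜 := ℝ) v

namespace HasWeakDeriv

theorem integrable_fderiv_smul (h : HasWeakDeriv U u v A) {ψ : E n → ℝ} (hψ : ContDiff ℝ ∞ ψ)
    (hψc : HasCompactSupport ψ) (hψU : tsupport ψ ⊆ U) :
    Integrable fun y => fderiv ℝ ψ y v • u y :=
  integrable_smul_of_locallyIntegrableOn h.locallyIntegrableOn (continuous_fderiv_apply' hψ v)
    (hasCompactSupport_fderiv_apply' hψc v) ((tsupport_fderiv_apply_subset ℝ v).trans hψU)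

theorem integrable_smul (h : HasWeakDeriv U u v A) {ψ : E n → ℝ} (hψ : ContDiff ℝ ∞ ψ)
    (hψc : HasCompactSupport ψ) (hψU : tsupport ψ ⊆ U) : Integrable fun y => ψ y • A y :=
  integrable_smul_of_locallyIntegrableOn h.locallyIntegrableOn_deriv hψ.continuous hψc hψU

theorem add (h : HasWeakDeriv U u v A) (h' : HasWeakDeriv U u' v A') :
    HasWeakDeriv U (fun y => u y + u' y) v (fun y => A y + A' y) where
  locallyIntegrableOn := h.locallyIntegrableOn.add h'.locallyIntegrableOn
  locallyIntegrableOn_deriv := h.locallyIntegrableOn_deriv.add h'.locallyIntegrableOn_deriv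
  integral_eq ψ hψ hψc hψU := by
    simp only [smul_add]
    rw [integral_add (h.integrable_fderiv_smul hψ hψc hψU) (h'.integrable_fderiv_smul hψ hψc hψU),
      integral_add (h.integrable_smul hψ hψc hψU) (h'.integrable_smul hψ hψc hψU),
      h.integral_eq ψ hψ hψc hψU, h'.integral_eq ψ hψ hψc hψU, neg_add]

theorem const_smul {𝕜 : Type*} [RCLike 𝕜] [NormedSpace 𝕜 F] [SMulCommClass ℝ 𝕜 F]
    (h : HasWeakDeriv U u v A) (c : 𝕜) :
    HasWeakDeriv U (fun y => c • u y) v (fun y => c • A y) where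
  locallyIntegrableOn := h.locallyIntegrableOn.smul c
  locallyIntegrableOn_deriv := h.locallyIntegrableOn_deriv.smul c
  integral_eq ψ hψ hψc hψU := by
    simp only [smul_comm _ c]
    rw [integral_smul, integral_smul, h.integral_eq ψ hψ hψc hψU, smul_neg]

theorem congr (hU : IsOpen U) (h : HasWeakDeriv U u v A) (hu : u =ᵐ[volume.restrict U] u')
    (hA : A =ᵐ[volume.restrict U] A') : HasWeakDeriv U u' v A' where
  locallyIntegrableOn := h.locallyIntegrableOn.congr hu
  locallyIntegrableOn_deriv := h.locallyIntegrableOn_deriv.congr hA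
  integral_eq ψ hψ hψc hψU := by
    have key : ∀ {c : E n → ℝ} {w w' : E n → F}, w =ᵐ[volume.restrict U] w' →
        (∀ y ∉ U, c y = 0) → ∫ y, c y • w y = ∫ y, c y • w' y := fun {c w w'} hw hc => by
      refine integral_congr_ae ?_
      filter_upwards [(ae_restrict_iff' hU.measurableSet).1 hw] with y hy
      by_cases hyU : y ∈ U
      · rw [hy hyU]
      · rw [hc y hyU, zero_smul, zero_smul]
    rw [← key hu, ← key hA, h.integral_eq ψ hψ hψc hψU]
    · intro y hy
      exact image_eq_zero_of_notMem_tsupport fun h => hy (hψU h)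
    · intro y hy
      exact image_eq_zero_of_notMem_tsupport (f := fun y => fderiv ℝ ψ y v)
        fun h => hy (hψU (tsupport_fderiv_apply_subset ℝ v h))

theorem const [CompleteSpace F] (c : F) : HasWeakDeriv U (fun _ => c) v (fun _ => 0) where
  locallyIntegrableOn := locallyIntegrableOn_const c
  locallyIntegrableOn_deriv := locallyIntegrableOn_zero
  integral_eq ψ hψ hψc hψU := by
    obtain ⟨C, hC⟩ := (hψ.of_le (by simp) : ContDiff ℝ 1 ψ).lipschitzWith_of_hasCompactSupport
      hψc one_ne_zero
    have h := LipschitzWith.integral_lineDeriv_mul_eq (μ := volume) (LipschitzWith.const (1 : ℝ)) hC hψc (-v)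
    have e : ∀ y, lineDeriv ℝ ψ y v = fderiv ℝ ψ y v := fun y =>
      ((hψ.differentiable (by simp)) y).lineDeriv_eq_fderiv
    have e0 : ∀ y, lineDeriv ℝ (fun _ : E n => (1 : ℝ)) y (-v) = 0 := fun y => by simp [lineDeriv]
    simp only [neg_neg, e, e0, zero_mul, mul_one, integral_zero] at h
    rw [integral_smul_const, ← h]
    simp

/-- The weak derivative is unique. -/
theorem ae_eq_zero (hU : IsOpen U) [CompleteSpace F] (h : HasWeakDeriv U (fun _ => (0 : F)) v A) :
    ∀ᵐ y ∂(volume.restrict U), A y = 0 := by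
  refine (ae_restrict_iff' hU.measurableSet).2 ?_
  refine hU.ae_eq_zero_of_integral_contDiff_smul_eq_zero h.locallyIntegrableOn_deriv
    fun ψ hψ hψc hψU => ?_
  have := h.integral_eq ψ hψ hψc hψU
  simpa using this.symm

end HasWeakDeriv

end WeakDeriv

/-- Rademacher's theorem for locally Lipschitz functions. -/
theorem ae_differentiableAt_of_locallyLipschitzOn {n : ℕ} {U : Set (E n)} (hU : IsOpen U)
    {a : E n → ℝ} (ha : LocallyLipschitzOn U a) : ∀ᵐ y, y ∈ U → DifferentiableAt ℝ a y := by
  refine measure_null_of_locally_null _ fun x hx => ?_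
  have hxU : x ∈ U := by
    by_contra h
    exact hx fun h' => (h h').elim
  obtain ⟨C, t, ht, hC⟩ := ha hxU
  rw [hU.nhdsWithin_eq hxU] at ht
  obtain ⟨t', ht', ht'o, hxt'⟩ := mem_nhds_iff.1 ht
  refine ⟨{y | ¬ (y ∈ U → DifferentiableAt ℝ a y)} ∩ t',
    inter_mem_nhdsWithin _ (ht'o.mem_nhds hxt'), ?_⟩
  refine measure_mono_null ?_ ((hC.mono ht').ae_differentiableWithinAt_of_mem (μ := volume))
  intro y hy h
  exact hy.1 fun _ => (h hy.2).differentiableAt (ht'o.mem_nhds hy.2)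

/-! ### The gradient as a square integrable field -/

section Gradient

variable {n : ℕ} {M : Type*} [MetricSpace M] {Mreg : TopologicalSpace.Opens M}
  [ChartedSpace (E n) Mreg] [IsManifold (𝓡 n) ∞ Mreg]
  [RiemannianBundle (fun x : Mreg => TangentSpace (𝓡 n) x)]
  [IsContMDiffRiemannianBundle (𝓡 n) ∞ (E n) (fun x : Mreg => TangentSpace (𝓡 n) x)]
  [MeasurableSpace M] [BorelSpace M] {𝕜 : Type*} [RCLike 𝕜]

theorem ae_vol_iff {p : M → Prop} : (∀ᵐ x ∂(vol n Mreg), p x) ↔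
    ∀ᵐ x : Mreg ∂(regVolume n Mreg), p x :=
  (MeasurableEmbedding.subtype_coe (s := (Mreg : Set M)) Mreg.isOpen.measurableSet).ae_map_iff

theorem hasWeakDifferential_iff {u : M → 𝕜} {A : CovectorField n Mreg 𝕜} :
    HasWeakDifferential u A ↔ ∀ x₀ : Mreg,
      LocallyIntegrableOn (fun y => u ((chartAt (E n) x₀).symm y)) (chartAt (E n) x₀).target
        volume ∧
      ∀ i, HasWeakDeriv (chartAt (E n) x₀).target (fun y => u ((chartAt (E n) x₀).symm y))
        (EuclideanSpace.single i (1 : ℝ))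
        (fun y => A ((chartAt (E n) x₀).symm y) (coordVec x₀ i y)) :=
  forall_congr' fun _ => and_congr_right fun h => forall_congr' fun _ =>
    ⟨fun h' => ⟨h, h'.1, h'.2⟩, fun h' => ⟨h'.2, h'.3⟩⟩

namespace HasWeakDifferential

variable {u u' : M → 𝕜} {A A' : CovectorField n Mreg 𝕜}

theorem isMeasurableField (h : HasWeakDifferential u A) : IsMeasurableField A := fun x₀ i =>
  ((h x₀).2 i).1.aestronglyMeasurable

theorem add (h : HasWeakDifferential u A) (h' : HasWeakDifferential u' A') :
    HasWeakDifferential (fun x => u x + u' x) (fun x => A x + A' x) := by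
  rw [hasWeakDifferential_iff] at *
  exact fun x₀ => ⟨(h x₀).1.add (h' x₀).1, fun i => ((h x₀).2 i).add ((h' x₀).2 i)⟩

theorem const_smul (h : HasWeakDifferential u A) (c : 𝕜) :
    HasWeakDifferential (fun x => c • u x) (fun x => c • A x) := by
  rw [hasWeakDifferential_iff] at *
  exact fun x₀ => ⟨(h x₀).1.smul c, fun i => ((h x₀).2 i).const_smul c⟩

theorem congr (h : HasWeakDifferential u A) (hu : u =ᵐ[vol n Mreg] u') :
    HasWeakDifferential u' A := by
  rw [hasWeakDifferential_iff] at *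
  intro x₀
  have := ae_chart_of_ae_regVolume (n := n) (ae_vol_iff.1 hu) x₀
  exact ⟨(h x₀).1.congr this, fun i =>
    ((h x₀).2 i).congr (chartAt (E n) x₀).open_target this (EventuallyEq.refl _ _)⟩

theorem const (c : 𝕜) : HasWeakDifferential (fun _ : M => c) (0 : CovectorField n Mreg 𝕜) :=
  hasWeakDifferential_iff.2 fun _ => ⟨locallyIntegrableOn_const c, fun _ => HasWeakDeriv.const c⟩

/-- The product rule for the product of a locally Lipschitz function and a weakly differentiable
one. -/
theorem lipschitz_mul (h : HasWeakDifferential u A) {a : M → ℝ}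
    (ha : ∀ x₀ : Mreg, LocallyLipschitzOn (chartAt (E n) x₀).target
      (fun y => a ((chartAt (E n) x₀).symm y))) :
    HasWeakDifferential (fun x => a x • u x)
      (fun x => a x • A x + (regDiff (n := n) a x).smulRight (u x)) := by
  rw [hasWeakDifferential_iff] at *
  intro x₀
  have hU := (chartAt (E n) x₀).open_target
  refine ⟨(h x₀).1.continuousOn_smul hU.isLocallyClosed (ha x₀).continuousOn, fun i => ?_⟩
  refine ((h x₀).2 i).lipschitz_mul hU (da := fun y =>
    regDiff (n := n) a ((chartAt (E n) x₀).symm y) (coordVec x₀ i y)) (ha x₀) ?_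
  filter_upwards [ae_differentiableAt_of_locallyLipschitzOn hU (ha x₀)] with y hy hyU
  have := (hy hyU).hasFDerivAt.hasLineDerivAt (EuclideanSpace.single i (1 : ℝ))
  rwa [hasFDerivAt_regDiff hyU (hy hyU)] at this

/-- The weak differential is unique. -/
theorem ae_eq_zero [SecondCountableTopology M] (h : HasWeakDifferential u A)
    (hu : u =ᵐ[vol n Mreg] 0) : ∀ᵐ x ∂(regVolume n Mreg), A x = 0 := by
  have h' := h.congr hu
  rw [hasWeakDifferential_iff] at h'
  refine ae_regVolume_of_chart fun x₀ => ?_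
  have hall := ae_all_iff.2 fun i => ((h' x₀).2 i).ae_eq_zero (chartAt (E n) x₀).open_target
  filter_upwards [hall, ae_restrict_mem (chartAt (E n) x₀).open_target.measurableSet] with y hy hyt
  have hsp : ∀ v : E n, A ((chartAt (E n) x₀).symm y)
      (mfderiv 𝓘(ℝ, E n) (𝓡 n) (chartAt (E n) x₀).symm y v) = 0 := fun v => by
    let L : E n →L[ℝ] 𝕜 := (show E n →L[ℝ] 𝕜 from A ((chartAt (E n) x₀).symm y)).comp
      (show E n →L[ℝ] E n from mfderiv 𝓘(ℝ, E n) (𝓡 n) (chartAt (E n) x₀).symm y)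
    have hL : ∀ i, L (EuclideanSpace.single i (1 : ℝ)) = 0 := hy
    have hv : v = ∑ i, v i • EuclideanSpace.single i (1 : ℝ) := by
      simpa using ((EuclideanSpace.basisFun (Fin n) ℝ).sum_repr v).symm
    change L v = 0
    rw [hv, map_sum]
    exact Finset.sum_eq_zero fun i _ => by rw [map_smul, hL, smul_zero]
  ext w
  obtain ⟨v, rfl⟩ := surjective_mfderiv_chartSymm x₀ hyt w
  exact hsp v

end HasWeakDifferential

/-! Square integrable covector fields are identified with their components in an orthonormal
frame. -/

variable [SecondCountableTopology M]

/-- The components of a covector field in the measurable orthonormal frame. -/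
def components (A : CovectorField n Mreg 𝕜) (x : Mreg) : EuclideanSpace 𝕜 (Fin n) :=
  WithLp.toLp 2 fun k => A x (orthoFrame n x k)

theorem inner_components (A B : CovectorField n Mreg 𝕜) (x : Mreg) :
    inner 𝕜 (components B x) (components A x) = cometric x (A x) (B x) := by
  rw [cometric_eq_sum (orthoFrame n x), PiLp.inner_apply]
  rfl

theorem norm_components_sq (A : CovectorField n Mreg 𝕜) (x : Mreg) :
    ‖components A x‖ ^ 2 = RCLike.re (cometric x (A x) (A x)) := by
  rw [← inner_components, inner_self_eq_norm_sq]

theorem IsMeasurableField.aestronglyMeasurable_components {A : CovectorField n Mreg 𝕜}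
    (hA : IsMeasurableField A) : AEStronglyMeasurable (components A) (regVolume n Mreg) :=
  (PiLp.continuous_toLp 2 _).comp_aestronglyMeasurable
    (aemeasurable_pi_iff.2 fun k => (hA.aestronglyMeasurable k).aemeasurable).aestronglyMeasurable

theorem energy_eq (A : CovectorField n Mreg 𝕜) :
    energy A = ∫⁻ x, ‖components A x‖ₑ ^ 2 ∂(regVolume n Mreg) := by
  refine lintegral_congr fun x => ?_
  rw [← norm_components_sq, ENNReal.ofReal_pow (norm_nonneg _), ofReal_norm]

theorem eLpNorm_components_sq (A : CovectorField n Mreg 𝕜) :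
    eLpNorm (components A) 2 (regVolume n Mreg) ^ 2 = energy A := by
  rw [energy_eq, eLpNorm_eq_lintegral_rpow_enorm_toReal two_ne_zero ENNReal.ofNat_ne_top]
  rw [← ENNReal.rpow_natCast, ← ENNReal.rpow_mul]
  simp

theorem IsMeasurableField.memLp_components {A : CovectorField n Mreg 𝕜}
    (hA : IsMeasurableField A) (hE : energy A < ⊤) : MemLp (components A) 2 (regVolume n Mreg) := by
  refine ⟨hA.aestronglyMeasurable_components, ?_⟩
  rw [← eLpNorm_components_sq] at hE
  exact (ENNReal.pow_lt_top_iff.1 hE).resolve_right two_ne_zero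

variable (n Mreg 𝕜) in
/-- The Hilbert space of square integrable covector fields. -/
abbrev GradSpace := Lp (EuclideanSpace 𝕜 (Fin n)) 2 (regVolume n Mreg)

open Classical in
/-- The class of a square integrable covector field. -/
def gradL2 (A : CovectorField n Mreg 𝕜) : GradSpace n Mreg 𝕜 :=
  if h : MemLp (components A) 2 (regVolume n Mreg) then h.toLp _ else 0

theorem coeFn_gradL2 {A : CovectorField n Mreg 𝕜}
    (h : MemLp (components A) 2 (regVolume n Mreg)) :
    gradL2 A =ᵐ[regVolume n Mreg] components A := by
  rw [gradL2, dif_pos h]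
  exact h.coeFn_toLp

variable {u u' : Lp 𝕜 2 (vol n Mreg)} {A A' : CovectorField n Mreg 𝕜}

theorem IsH1.memLp (h : IsH1 u A) : MemLp (components A) 2 (regVolume n Mreg) :=
  h.1.isMeasurableField.memLp_components h.2

theorem inner_gradL2 (h : MemLp (components A) 2 (regVolume n Mreg))
    (h' : MemLp (components A') 2 (regVolume n Mreg)) :
    inner 𝕜 (gradL2 A') (gradL2 A) = dirichletForm A A' := by
  rw [L2.inner_def, dirichletForm]
  refine integral_congr_ae ?_
  filter_upwards [coeFn_gradL2 h, coeFn_gradL2 h'] with x hx hx'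
  rw [hx, hx', inner_components]

theorem components_add (A A' : CovectorField n Mreg 𝕜) (x : Mreg) :
    components (fun x => A x + A' x) x = components A x + components A' x := by
  ext k; rfl

theorem components_const_smul (c : 𝕜) (A : CovectorField n Mreg 𝕜) (x : Mreg) :
    components (fun x => c • A x) x = c • components A x := by
  ext k; rfl

theorem gradL2_sub_norm_sq (h : MemLp (components A) 2 (regVolume n Mreg))
    (h' : MemLp (components A') 2 (regVolume n Mreg)) :
    ENNReal.ofReal (‖gradL2 A - gradL2 A'‖ ^ 2) = energy (fun x => A x - A' x) := by
  have e : gradL2 A - gradL2 A' = (h.sub h').toLp _ := by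
    rw [gradL2, gradL2, dif_pos h, dif_pos h', MemLp.toLp_sub]
  rw [e, Lp.norm_toLp, ENNReal.ofReal_pow ENNReal.toReal_nonneg,
    ENNReal.ofReal_toReal (h.sub h').2.ne, ← eLpNorm_components_sq]
  congr 2

theorem IsH1.add (h : IsH1 u A) (h' : IsH1 u' A') : IsH1 (u + u') (fun x => A x + A' x) := by
  have hw := (h.1.add h'.1).congr (u' := (u + u' : Lp 𝕜 2 (vol n Mreg))) (Lp.coeFn_add u u').symm
  refine ⟨hw, ?_⟩
  rw [← eLpNorm_components_sq]
  refine ENNReal.pow_lt_top ?_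
  rw [show components (fun x => A x + A' x) = components A + components A' from
    funext (components_add A A')]
  exact (h.memLp.add h'.memLp).2

theorem IsH1.const_smul (h : IsH1 u A) (c : 𝕜) : IsH1 (c • u) (fun x => c • A x) := by
  have hw := (h.1.const_smul c).congr (u' := (c • u : Lp 𝕜 2 (vol n Mreg)))
    (Lp.coeFn_smul c u).symm
  refine ⟨hw, ?_⟩
  rw [← eLpNorm_components_sq]
  refine ENNReal.pow_lt_top ?_
  rw [show components (fun x => c • A x) = c • components A from
    funext (components_const_smul c A)]
  exact (h.memLp.const_smul c).2

variable (n Mreg 𝕜) in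
theorem isH1_zero : IsH1 (0 : Lp 𝕜 2 (vol n Mreg)) (0 : CovectorField n Mreg 𝕜) := by
  have hw := (HasWeakDifferential.const (n := n) (Mreg := Mreg) (0 : 𝕜)).congr
    (u' := (0 : Lp 𝕜 2 (vol n Mreg))) (Lp.coeFn_zero _ _ _).symm
  refine ⟨hw, ?_⟩
  rw [energy_eq]
  have : ∀ x, components (0 : CovectorField n Mreg 𝕜) x = 0 := fun x => by ext k; rfl
  simp [this]

theorem IsH1.gradL2_eq_zero (h : IsH1 (0 : Lp 𝕜 2 (vol n Mreg)) A) : gradL2 A = 0 := by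
  have h0 := h.1.ae_eq_zero (Lp.coeFn_zero _ _ _)
  refine (Lp.eq_zero_iff_ae_eq_zero).2 ?_
  filter_upwards [coeFn_gradL2 h.memLp, h0] with x hx hx0
  rw [hx]
  ext k
  change A x (orthoFrame n x k) = 0
  rw [hx0]; rfl

variable (n Mreg 𝕜) in
/-- The graph of the gradient. -/
def gradGraph : Submodule 𝕜 (Lp 𝕜 2 (vol n Mreg) × GradSpace n Mreg 𝕜) where
  carrier := {p | ∃ A, IsH1 p.1 A ∧ p.2 = gradL2 A}
  zero_mem' := ⟨0, isH1_zero n Mreg 𝕜, (isH1_zero n Mreg 𝕜).gradL2_eq_zero.symm⟩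
  add_mem' := by
    rintro p q ⟨A, hA, hpA⟩ ⟨B, hB, hqB⟩
    refine ⟨_, hA.add hB, ?_⟩
    rw [Prod.snd_add, hpA, hqB]
    refine Lp.ext ?_
    filter_upwards [coeFn_gradL2 hA.memLp, coeFn_gradL2 hB.memLp, coeFn_gradL2 (hA.add hB).memLp,
      Lp.coeFn_add (gradL2 A) (gradL2 B)] with x h1 h2 h3 h4
    rw [h3, h4, Pi.add_apply, h1, h2, components_add]
  smul_mem' := by
    rintro c p ⟨A, hA, hpA⟩
    refine ⟨_, hA.const_smul c, ?_⟩
    rw [Prod.smul_snd, hpA]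
    refine Lp.ext ?_
    filter_upwards [coeFn_gradL2 hA.memLp, coeFn_gradL2 (hA.const_smul c).memLp,
      Lp.coeFn_smul c (gradL2 A)] with x h1 h2 h3
    rw [h2, h3, Pi.smul_apply, h1, components_const_smul]

end Gradient

/-! ### Multiplication operators and weights -/

section Multiplication

variable {X : Type*} [MeasurableSpace X] {μ : Measure X} {𝕜 : Type*} [RCLike 𝕜]
  {F : Type*} [NormedAddCommGroup F] [InnerProductSpace 𝕜 F]

theorem norm_ofReal_smul_le {a : X → ℝ} {C : ℝ} (hC : ∀ x, |a x| ≤ C) (w : X → F) (x : X) :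
    ‖(a x : 𝕜) • w x‖ ≤ C * ‖w x‖ := by
  rw [norm_smul, RCLike.norm_ofReal]
  exact mul_le_mul_of_nonneg_right (hC x) (norm_nonneg _)

theorem memLp_ofReal_smul {a : X → ℝ} (ha : AEStronglyMeasurable a μ) {C : ℝ}
    (hC : ∀ x, |a x| ≤ C) {w : X → F} (hw : MemLp w 2 μ) :
    MemLp (fun x => (a x : 𝕜) • w x) 2 μ :=
  hw.of_le_mul ((RCLike.continuous_ofReal.comp_aestronglyMeasurable ha).smul hw.1)
    (Eventually.of_forall (norm_ofReal_smul_le hC w))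

variable (𝕜 F) in
/-- Multiplication by a bounded measurable real function, on `L²`. -/
def mulLp {a : X → ℝ} (ha : AEStronglyMeasurable a μ) {C : ℝ} (hC : ∀ x, |a x| ≤ C) :
    Lp F 2 μ →L[𝕜] Lp F 2 μ :=
  LinearMap.mkContinuous
    { toFun := fun w => (memLp_ofReal_smul (𝕜 := 𝕜) ha hC (Lp.memLp w)).toLp _
      map_add' := fun w w' => by
        refine Lp.ext ?_
        filter_upwards [(memLp_ofReal_smul (𝕜 := 𝕜) ha hC (Lp.memLp w)).coeFn_toLp,
          (memLp_ofReal_smul (𝕜 := 𝕜) ha hC (Lp.memLp w')).coeFn_toLp,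
          (memLp_ofReal_smul (𝕜 := 𝕜) ha hC (Lp.memLp (w + w'))).coeFn_toLp, Lp.coeFn_add w w',
          Lp.coeFn_add ((memLp_ofReal_smul (𝕜 := 𝕜) ha hC (Lp.memLp w)).toLp _)
            ((memLp_ofReal_smul (𝕜 := 𝕜) ha hC (Lp.memLp w')).toLp _)] with x h1 h2 h3 h4 h5
        rw [h3, h5, Pi.add_apply, h1, h2, h4, Pi.add_apply, smul_add]
      map_smul' := fun c w => by
        refine Lp.ext ?_
        filter_upwards [(memLp_ofReal_smul (𝕜 := 𝕜) ha hC (Lp.memLp w)).coeFn_toLp,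
          (memLp_ofReal_smul (𝕜 := 𝕜) ha hC (Lp.memLp (c • w))).coeFn_toLp, Lp.coeFn_smul c w,
          Lp.coeFn_smul c ((memLp_ofReal_smul (𝕜 := 𝕜) ha hC (Lp.memLp w)).toLp _)]
          with x h1 h2 h3 h4
        rw [h2, RingHom.id_apply, h4, Pi.smul_apply, h1, h3, Pi.smul_apply, smul_comm] }
    C fun w => by
      refine Lp.norm_le_mul_norm_of_ae_le_mul ?_
      filter_upwards [(memLp_ofReal_smul (𝕜 := 𝕜) ha hC (Lp.memLp w)).coeFn_toLp] with x h1
      refine (congrArg norm h1).trans_le (norm_ofReal_smul_le hC _ x)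

variable {a : X → ℝ} (ha : AEStronglyMeasurable a μ) {C : ℝ} (hC : ∀ x, |a x| ≤ C)

theorem coeFn_mulLp (w : Lp F 2 μ) : mulLp 𝕜 F ha hC w =ᵐ[μ] fun x => (a x : 𝕜) • w x :=
  (memLp_ofReal_smul (𝕜 := 𝕜) ha hC (Lp.memLp w)).coeFn_toLp

theorem inner_mulLp_symm (w w' : Lp F 2 μ) :
    inner 𝕜 (mulLp 𝕜 F ha hC w) w' = inner 𝕜 w (mulLp 𝕜 F ha hC w') := by
  rw [L2.inner_def, L2.inner_def]
  refine integral_congr_ae ?_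
  filter_upwards [coeFn_mulLp (𝕜 := 𝕜) ha hC w, coeFn_mulLp (𝕜 := 𝕜) ha hC w'] with x h1 h2
  rw [h1, h2, inner_smul_left, inner_smul_right, RCLike.conj_ofReal]

theorem mulLp_inner_ae (w : Lp F 2 μ) :
    (fun x => RCLike.re (inner 𝕜 (mulLp 𝕜 F ha hC w x) (w x))) =ᵐ[μ]
      fun x => a x * ‖w x‖ ^ 2 := by
  filter_upwards [coeFn_mulLp (𝕜 := 𝕜) ha hC w] with x h1
  rw [h1, inner_smul_left, RCLike.conj_ofReal, RCLike.re_ofReal_mul, inner_self_eq_norm_sq]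

theorem integrable_mul_norm_sq (𝕜 : Type*) [RCLike 𝕜] [InnerProductSpace 𝕜 F]
    (ha : AEStronglyMeasurable a μ) (hC : ∀ x, |a x| ≤ C) (w : Lp F 2 μ) :
    Integrable (fun x => a x * ‖w x‖ ^ 2) μ :=
  ((L2.integrable_inner (mulLp 𝕜 F ha hC w) w).re).congr (mulLp_inner_ae (𝕜 := 𝕜) ha hC w)

theorem re_inner_mulLp (w : Lp F 2 μ) :
    RCLike.re (inner 𝕜 (mulLp 𝕜 F ha hC w) w) = ∫ x, a x * ‖w x‖ ^ 2 ∂μ := by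
  rw [L2.inner_def, ← integral_re (L2.integrable_inner (mulLp 𝕜 F ha hC w) w)]
  exact integral_congr_ae (mulLp_inner_ae (𝕜 := 𝕜) ha hC w)

/-- The inequality `2 |u| |Z| ≤ |u|² + |Z|²`, integrated against the weight. -/
theorem two_norm_inner_le_of_le {a : X → ℝ} (h0 : ∀ x, 0 ≤ a x) {lam : ℝ} (hlam : 0 ≤ lam)
    {Y Z : Lp F 2 μ} {u : X → 𝕜} (hY : ∀ᵐ x ∂μ, ‖Y x‖ ≤ lam * a x * ‖u x‖)
    (hI₁ : Integrable (fun x => a x * ‖Z x‖ ^ 2) μ)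
    (hI₂ : Integrable (fun x => a x * ‖u x‖ ^ 2) μ) :
    2 * ‖inner 𝕜 Y Z‖ ≤ lam * ((∫ x, a x * ‖Z x‖ ^ 2 ∂μ) + ∫ x, a x * ‖u x‖ ^ 2 ∂μ) := by
  rw [← integral_add hI₁ hI₂, ← integral_const_mul, L2.inner_def, ← le_div_iff₀' two_pos,
    ← integral_div]
  refine norm_integral_le_of_norm_le (((hI₁.add hI₂).const_mul _).div_const _) ?_
  filter_upwards [hY] with x hx
  refine (norm_inner_le_norm _ _).trans ?_
  have h1 := mul_le_mul_of_nonneg_right hx (norm_nonneg (Z x))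
  have h2 := mul_nonneg (mul_nonneg hlam (h0 x)) (sq_nonneg (‖u x‖ - ‖Z x‖))
  change _ ≤ lam * (a x * ‖Z x‖ ^ 2 + a x * ‖u x‖ ^ 2) / 2
  nlinarith

end Multiplication

section Weight

variable {n : ℕ} {M : Type*} [MetricSpace M] {Mreg : TopologicalSpace.Opens M}
  [ChartedSpace (E n) Mreg] [IsManifold (𝓡 n) ∞ Mreg]
  [RiemannianBundle (fun x : Mreg => TangentSpace (𝓡 n) x)]
  [IsContMDiffRiemannianBundle (𝓡 n) ∞ (E n) (fun x : Mreg => TangentSpace (𝓡 n) x)]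
  [MeasurableSpace M] [BorelSpace M] {𝕜 : Type*} [RCLike 𝕜] {𝒜 : Set (ConicChart n Mreg)}

theorem integral_vol (f : M → ℝ) : ∫ x, f x ∂(vol n Mreg) = ∫ x : Mreg, f x ∂(regVolume n Mreg) :=
  (MeasurableEmbedding.subtype_coe (s := (Mreg : Set M)) Mreg.isOpen.measurableSet).integral_map f

theorem integrable_vol_iff (f : M → ℝ) :
    Integrable f (vol n Mreg) ↔ Integrable (fun x : Mreg => f x) (regVolume n Mreg) :=
  (MeasurableEmbedding.subtype_coe (s := (Mreg : Set M))
    Mreg.isOpen.measurableSet).integrable_map_iff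

theorem IsConicManifold.locallyLipschitzOn_chartSymm_comp (hM : IsConicManifold 𝒜) {a : M → ℝ}
    {K : NNReal} (ha : LipschitzWith K a) (x₀ : Mreg) :
    LocallyLipschitzOn (chartAt (E n) x₀).target (fun y => a ((chartAt (E n) x₀).symm y)) := by
  intro y hy
  obtain ⟨C, s, hs, h⟩ := hM.exists_lipschitzOnWith_chartSymm x₀ hy
  exact ⟨K * C, s, hs, ha.comp_lipschitzOnWith h⟩

/-- The components of a covector in an orthonormal basis have the norm of the covector. -/
theorem norm_toLp_smul_le {V : Type*} [NormedAddCommGroup V] [InnerProductSpace ℝ V]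
    (b : OrthonormalBasis (Fin n) ℝ V) {L : V →ₗ[ℝ] ℝ} {κ : ℝ} (hκ : 0 ≤ κ)
    (h : ∀ v, |L v| ≤ κ * ‖v‖) (z : 𝕜) :
    ‖(WithLp.toLp 2 fun k => L (b k) • z : EuclideanSpace 𝕜 (Fin n))‖ ≤ κ * ‖z‖ := by
  set s : ℝ := ∑ k, L (b k) ^ 2 with hs
  have hs0 : 0 ≤ s := Finset.sum_nonneg fun _ _ => sq_nonneg _
  have hv : ‖∑ k, L (b k) • b k‖ ^ 2 = s := by
    rw [← real_inner_self_eq_norm_sq, b.orthonormal.inner_sum, hs]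
    simp [sq]
  have hL : L (∑ k, L (b k) • b k) = s := by
    rw [map_sum]
    simp [sq, hs]
  have hsκ : s ≤ κ ^ 2 := by
    have h1 := h (∑ k, L (b k) • b k)
    rw [hL, abs_of_nonneg hs0] at h1
    by_contra hlt
    rw [not_le] at hlt
    have h2 : κ < ‖∑ k, L (b k) • b k‖ := lt_of_pow_lt_pow_left₀ 2 (norm_nonneg _) (by rwa [hv])
    nlinarith [norm_nonneg (∑ k, L (b k) • b k)]
  rw [EuclideanSpace.norm_eq]
  refine Real.sqrt_le_iff.2 ⟨by positivity, ?_⟩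
  have : ∑ k, ‖(WithLp.toLp 2 fun k => L (b k) • z : EuclideanSpace 𝕜 (Fin n)) k‖ ^ 2 =
      s * ‖z‖ ^ 2 := by
    rw [hs, Finset.sum_mul]
    refine Finset.sum_congr rfl fun k _ => ?_
    simp [norm_smul, mul_pow]
  rw [this, mul_pow]
  exact mul_le_mul_of_nonneg_right hsκ (sq_nonneg _)

variable [SecondCountableTopology M]

theorem norm_components_smulRight_le {L : (x : Mreg) → TangentSpace (𝓡 n) x →L[ℝ] ℝ} {x : Mreg}
    {κ : ℝ} (hκ : 0 ≤ κ) (h : ∀ v, |L x v| ≤ κ * ‖v‖) (u : Mreg → 𝕜) :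
    ‖components (fun x => (L x).smulRight (u x)) x‖ ≤ κ * ‖u x‖ :=
  norm_toLp_smul_le (orthoFrame n x) (L := (L x).toLinearMap) hκ h (u x)

theorem components_mul (a : Mreg → ℝ) (A : CovectorField n Mreg 𝕜) (x : Mreg) :
    components (fun x => a x • A x) x = (a x : 𝕜) • components A x := by
  ext k
  change a x • A x (orthoFrame n x k) = (a x : 𝕜) * A x (orthoFrame n x k)
  rw [RCLike.real_smul_eq_coe_mul]

theorem memLp_comp_val (u : Lp 𝕜 2 (vol n Mreg)) :
    MemLp (fun x : Mreg => u x) 2 (regVolume n Mreg) :=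
  (MeasurableEmbedding.subtype_coe (s := (Mreg : Set M))
    Mreg.isOpen.measurableSet).memLp_map_measure_iff.1 (Lp.memLp u)

/-- A bounded Lipschitz function `a` whose differential is dominated by `lam * a` is a weight for
the wave equation. -/
theorem IsConicManifold.isWeight_mulLp (hM : IsConicManifold 𝒜) {a : M → ℝ} {K : NNReal}
    (hK : LipschitzWith K a) (h0 : ∀ x, 0 ≤ a x) {C : ℝ} (hC : ∀ x, |a x| ≤ C) {lam : ℝ}
    (hlam0 : 0 ≤ lam)
    (hlam : ∀ (x : Mreg) (v : TangentSpace (𝓡 n) x),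
      |regDiff (n := n) a x v| ≤ lam * a x * ‖v‖) :
    EnergyWave.IsWeight (gradGraph n Mreg 𝕜)
      (mulLp 𝕜 𝕜 hK.continuous.aestronglyMeasurable hC)
      (mulLp 𝕜 (EuclideanSpace 𝕜 (Fin n)) (a := fun x : Mreg => a x)
        (hK.continuous.comp continuous_subtype_val).aestronglyMeasurable fun x => hC x) lam where
  m_symm := inner_mulLp_symm _ _
  M_symm := inner_mulLp_symm _ _
  m_nonneg w := by
    rw [re_inner_mulLp]
    exact integral_nonneg fun x => mul_nonneg (h0 x) (sq_nonneg _)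
  M_nonneg w := by
    rw [re_inner_mulLp]
    exact integral_nonneg fun x => mul_nonneg (h0 x) (sq_nonneg _)
  mul_mem := by
    rintro ⟨u, Z⟩ ⟨A, hA, hZ⟩
    simp only at hA hZ
    subst hZ
    have hC0 : ∀ x : Mreg, 0 ≤ lam * a x := fun x => mul_nonneg hlam0 (h0 x)
    -- the commutator of the weight with the gradient is `u da`
    let Cf : CovectorField n Mreg 𝕜 := fun x => (regDiff (n := n) a x).smulRight (u x)
    let B : CovectorField n Mreg 𝕜 := fun x => a x • A x + Cf x
    have hBw : HasWeakDifferential (fun x => a x • u x) B :=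
      hA.1.lipschitz_mul (hM.locallyLipschitzOn_chartSymm_comp hK)
    have hcB : ∀ x, components B x = (a x : 𝕜) • components A x + components Cf x := fun x => by
      rw [← components_mul (fun x => a x) A x]
      exact components_add (fun x => a x • A x) Cf x
    have hCn : ∀ x : Mreg, ‖components Cf x‖ ≤ lam * a x * ‖u x‖ := fun x =>
      norm_components_smulRight_le (hC0 x) (hlam x) (fun x => u x)
    have haA : MemLp (fun x : Mreg => (a x : 𝕜) • components A x) 2 (regVolume n Mreg) :=
      memLp_ofReal_smul (hK.continuous.comp continuous_subtype_val).aestronglyMeasurable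
        (fun x => hC x) hA.memLp
    have hCm : MemLp (components Cf) 2 (regVolume n Mreg) := by
      refine (memLp_comp_val u).of_le_mul (c := lam * C) ?_ (Eventually.of_forall fun x => ?_)
      · refine (hBw.isMeasurableField.aestronglyMeasurable_components.sub haA.1).congr
          (Eventually.of_forall fun x => ?_)
        simp [hcB]
      · refine (hCn x).trans ?_
        gcongr
        exact (le_abs_self _).trans (hC x)
    have hBm : MemLp (components B) 2 (regVolume n Mreg) := by
      rw [show components B = _ from funext hcB]
      exact haA.add hCm
    have hBu : HasWeakDifferential (mulLp 𝕜 𝕜 hK.continuous.aestronglyMeasurable hC u) B := by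
      refine hBw.congr ?_
      filter_upwards [coeFn_mulLp (𝕜 := 𝕜) (μ := vol n Mreg) hK.continuous.aestronglyMeasurable
        hC u] with x hx
      rw [hx, RCLike.real_smul_eq_coe_mul, smul_eq_mul]
    have hBH : IsH1 (mulLp 𝕜 𝕜 hK.continuous.aestronglyMeasurable hC u) B := by
      refine ⟨hBu, ?_⟩
      rw [← eLpNorm_components_sq]
      exact ENNReal.pow_lt_top hBm.2
    refine ⟨gradL2 Cf, ⟨B, hBH, ?_⟩, fun Z => ?_⟩
    · refine Lp.ext ?_
      refine (Lp.coeFn_add _ _).trans ?_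
      filter_upwards [coeFn_gradL2 hA.memLp, coeFn_gradL2 hCm, coeFn_gradL2 hBm,
        coeFn_mulLp (𝕜 := 𝕜) (μ := regVolume n Mreg) (a := fun x : Mreg => a x)
          (hK.continuous.comp continuous_subtype_val).aestronglyMeasurable (fun x => hC x)
          (gradL2 A)] with x h1 h2 h3 h4
      rw [Pi.add_apply, h4, h1, h2, h3, hcB]
    · have hKa : AEStronglyMeasurable (fun x : Mreg => a x) (regVolume n Mreg) :=
        (hK.continuous.comp continuous_subtype_val).aestronglyMeasurable
      have hI₁ : Integrable (fun x : Mreg => a x * ‖Z x‖ ^ 2) (regVolume n Mreg) :=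
        integrable_mul_norm_sq 𝕜 (F := EuclideanSpace 𝕜 (Fin n)) (a := fun x : Mreg => a x)
          (C := C) hKa (fun x => hC x) Z
      have hI₂ : Integrable (fun x : Mreg => a x * ‖u x‖ ^ 2) (regVolume n Mreg) :=
        (integrable_vol_iff (n := n) (fun x => a x * ‖u x‖ ^ 2)).1
          (integrable_mul_norm_sq 𝕜 (F := 𝕜) (μ := vol n Mreg) (a := a) (C := C)
            hK.continuous.aestronglyMeasurable hC u)
      rw [re_inner_mulLp, re_inner_mulLp, integral_vol]
      change _ ≤ lam * ((∫ x : Mreg, a x * ‖Z x‖ ^ 2 ∂(regVolume n Mreg)) +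
        ∫ x : Mreg, a x * ‖u x‖ ^ 2 ∂(regVolume n Mreg))
      refine two_norm_inner_le_of_le (h0 := fun x : Mreg => h0 x) hlam0 ?_ hI₁ hI₂
      filter_upwards [coeFn_gradL2 hCm] with x hx
      rw [hx]
      exact hCn x

end Weight

section ExponentialWeight

variable {M : Type*} [MetricSpace M]

/-- The weight `exp (lam * min ((dist x x₀ - r)⁺) R)`. -/
def expWeight (x₀ : M) (r R lam : ℝ) (x : M) : ℝ :=
  Real.exp (lam * min (max (dist x x₀ - r) 0) R)

variable (x₀ : M) {r R lam : ℝ}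

theorem abs_exp_sub_exp_le (s t : ℝ) :
    |Real.exp s - Real.exp t| ≤ max (Real.exp s) (Real.exp t) * |s - t| := by
  have key : ∀ s t : ℝ, t ≤ s → |Real.exp s - Real.exp t| ≤ Real.exp s * |s - t| := fun s t h => by
    rw [abs_of_nonneg (sub_nonneg.2 (Real.exp_le_exp.2 h)), abs_of_nonneg (sub_nonneg.2 h)]
    have h1 := Real.add_one_le_exp (t - s)
    have h2 : Real.exp t = Real.exp s * Real.exp (t - s) := by rw [← Real.exp_add]; congr 1; ring
    have h3 := mul_le_mul_of_nonneg_left h1 (Real.exp_pos s).le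
    rw [h2]
    linarith
  rcases le_total t s with h | h
  · exact (key s t h).trans (mul_le_mul_of_nonneg_right (le_max_left _ _) (abs_nonneg _))
  · rw [abs_sub_comm, abs_sub_comm s]
    exact (key t s h).trans (mul_le_mul_of_nonneg_right (le_max_right _ _) (abs_nonneg _))

theorem expWeight_pos (x : M) : 0 < expWeight x₀ r R lam x := Real.exp_pos _

theorem abs_expWeight_le (hlam : 0 ≤ lam) (x : M) :
    |expWeight x₀ r R lam x| ≤ Real.exp (lam * R) := by
  rw [abs_of_pos (expWeight_pos x₀ x)]
  exact Real.exp_le_exp.2 (mul_le_mul_of_nonneg_left (min_le_right _ _) hlam)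

theorem abs_truncatedDist_sub_le (x x' : M) :
    |min (max (dist x x₀ - r) 0) R - min (max (dist x' x₀ - r) 0) R| ≤ dist x x' := by
  refine (abs_min_sub_min_le_max _ _ _ _).trans ?_
  rw [sub_self, abs_zero]
  refine max_le ((abs_max_sub_max_le_max _ _ _ _).trans ?_) dist_nonneg
  rw [sub_self, abs_zero]
  refine max_le ?_ dist_nonneg
  rw [sub_sub_sub_cancel_right]
  exact abs_dist_sub_le x x' x₀

theorem abs_expWeight_sub_le (hlam : 0 ≤ lam) (x x' : M) :
    |expWeight x₀ r R lam x' - expWeight x₀ r R lam x| ≤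
      max (expWeight x₀ r R lam x') (expWeight x₀ r R lam x) * lam * dist x' x := by
  refine (abs_exp_sub_exp_le _ _).trans ?_
  rw [← mul_sub, abs_mul, abs_of_nonneg hlam, ← mul_assoc]
  exact mul_le_mul_of_nonneg_left (abs_truncatedDist_sub_le x₀ x' x)
    (mul_nonneg ((Real.exp_pos _).le.trans (le_max_left _ _)) hlam)

theorem lipschitzWith_expWeight (hlam : 0 ≤ lam) :
    LipschitzWith (Real.exp (lam * R) * lam).toNNReal (expWeight x₀ r R lam) := by
  refine LipschitzWith.of_dist_le_mul fun x x' => ?_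
  rw [Real.dist_eq, Real.coe_toNNReal _ (by positivity)]
  refine (abs_expWeight_sub_le x₀ hlam x' x).trans ?_
  gcongr
  exact max_le ((le_abs_self _).trans (abs_expWeight_le x₀ hlam x))
    ((le_abs_self _).trans (abs_expWeight_le x₀ hlam x'))

variable {n : ℕ} {Mreg : TopologicalSpace.Opens M}
  [ChartedSpace (E n) Mreg] [IsManifold (𝓡 n) ∞ Mreg]
  [RiemannianBundle (fun x : Mreg => TangentSpace (𝓡 n) x)]
  [IsContMDiffRiemannianBundle (𝓡 n) ∞ (E n) (fun x : Mreg => TangentSpace (𝓡 n) x)]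
  {𝒜 : Set (ConicChart n Mreg)}

theorem IsConicManifold.abs_regDiff_expWeight_le (hM : IsConicManifold 𝒜) (hlam : 0 ≤ lam)
    (x : Mreg) (v : TangentSpace (𝓡 n) x) :
    |regDiff (n := n) (expWeight x₀ r R lam) x v| ≤ lam * expWeight x₀ r R lam x * ‖v‖ := by
  -- near `x` the weight has Lipschitz constant `(a x + ε) * lam`
  have hcont : Continuous (expWeight x₀ r R lam) := (lipschitzWith_expWeight x₀ hlam).continuous
  have h : ∀ ε > 0, |regDiff (n := n) (expWeight x₀ r R lam) x v| ≤
      (expWeight x₀ r R lam x + ε) * lam * ‖v‖ := fun ε hε => by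
    have hpos := expWeight_pos x₀ (r := r) (R := R) (lam := lam) (x : M)
    refine hM.abs_regDiff_le (by positivity) ?_ v
    have hev := hcont.continuousAt.eventually (gt_mem_nhds
      (show expWeight x₀ r R lam (x : M) < expWeight x₀ r R lam x + ε by linarith))
    filter_upwards [hev] with x' hx'
    refine (abs_expWeight_sub_le x₀ hlam _ _).trans ?_
    gcongr
    exact max_le hx'.le (by linarith)
  have hlim : Tendsto (fun ε : ℝ => (expWeight x₀ r R lam x + ε) * lam * ‖v‖) (𝓝[>] 0)
      (𝓝 ((expWeight x₀ r R lam x + 0) * lam * ‖v‖)) :=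
    Tendsto.mono_left (Continuous.tendsto (by fun_prop) 0) nhdsWithin_le_nhds
  refine (ge_of_tendsto hlim ?_).trans (by rw [add_zero, mul_comm lam])
  filter_upwards [self_mem_nhdsWithin] with ε hε using h ε hε

end ExponentialWeight

/-! ### Cutoff functions -/

section Cutoff

variable {M : Type*} [MetricSpace M]

/-- The cutoff function that is `1` on the ball of radius `ρ - 1` and `0` off the ball of
radius `ρ`. -/
def cutoff (x₀ : M) (ρ : ℝ) (x : M) : ℝ := max 0 (min 1 (ρ - dist x x₀))

variable (x₀ : M) (ρ : ℝ)

theorem abs_cutoff_sub_le (x x' : M) : |cutoff x₀ ρ x - cutoff x₀ ρ x'| ≤ dist x x' := by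
  refine (abs_max_sub_max_le_max _ _ _ _).trans ?_
  rw [sub_self, abs_zero]
  refine max_le dist_nonneg ((abs_min_sub_min_le_max _ _ _ _).trans ?_)
  rw [sub_self, abs_zero]
  refine max_le dist_nonneg ?_
  rw [sub_sub_sub_cancel_left, dist_comm x x']
  exact abs_dist_sub_le x' x x₀

theorem lipschitzWith_cutoff : LipschitzWith 1 (cutoff x₀ ρ) :=
  LipschitzWith.of_dist_le_mul fun x x' => by
    rw [Real.dist_eq, NNReal.coe_one, one_mul]
    exact abs_cutoff_sub_le x₀ ρ x x'

variable {x₀ ρ}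

theorem cutoff_eq_one {x : M} (h : dist x x₀ ≤ ρ - 1) : cutoff x₀ ρ x = 1 := by
  rw [cutoff, min_eq_left (by linarith), max_eq_right zero_le_one]

theorem cutoff_eq_zero {x : M} (h : ρ ≤ dist x x₀) : cutoff x₀ ρ x = 0 := by
  rw [cutoff, max_eq_left]
  exact (min_le_right _ _).trans (by linarith)

variable {n : ℕ} {Mreg : TopologicalSpace.Opens M}
  [ChartedSpace (E n) Mreg] [IsManifold (𝓡 n) ∞ Mreg]
  [RiemannianBundle (fun x : Mreg => TangentSpace (𝓡 n) x)]
  [IsContMDiffRiemannianBundle (𝓡 n) ∞ (E n) (fun x : Mreg => TangentSpace (𝓡 n) x)]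
  {𝒜 : Set (ConicChart n Mreg)}

theorem IsConicManifold.regDiff_eq_zero (hM : IsConicManifold 𝒜) {f : M → ℝ} {x : Mreg}
    (h : ∀ᶠ x' in 𝓝 (x : M), f x' = f x) : regDiff (n := n) f x = 0 := by
  ext v
  have := hM.abs_regDiff_le le_rfl (f := f) (x := x) (by
    filter_upwards [h] with x' hx'
    simp [hx']) v
  rw [zero_mul] at this
  exact abs_eq_zero.1 (le_antisymm this (abs_nonneg _))

theorem IsConicManifold.regDiff_cutoff_eq_zero (hM : IsConicManifold 𝒜) {x : Mreg}
    (h : dist (x : M) x₀ < ρ - 1 ∨ ρ < dist (x : M) x₀) :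
    regDiff (n := n) (cutoff x₀ ρ) x = 0 := by
  refine hM.regDiff_eq_zero ?_
  have hc : Continuous fun x : M => dist x x₀ := by fun_prop
  rcases h with h | h
  · filter_upwards [hc.continuousAt.eventually (gt_mem_nhds h)] with x' hx'
    rw [cutoff_eq_one hx'.le, cutoff_eq_one h.le]
  · filter_upwards [hc.continuousAt.eventually (lt_mem_nhds h)] with x' hx'
    rw [cutoff_eq_zero hx'.le, cutoff_eq_zero h.le]

variable [MeasurableSpace M] [BorelSpace M] {𝕜 : Type*} [RCLike 𝕜] [ProperSpace M]

theorem IsConicManifold.memLp_cutoff (hM : IsConicManifold 𝒜) (x₀ : M) (ρ : ℝ) :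
    MemLp (fun x => (cutoff x₀ ρ x : 𝕜)) 2 (vol n Mreg) := by
  have := hM.isLocallyFiniteMeasure_vol
  refine Continuous.memLp_of_hasCompactSupport ?_ ?_
  · exact RCLike.continuous_ofReal.comp (lipschitzWith_cutoff x₀ ρ).continuous
  · refine HasCompactSupport.intro (isCompact_closedBall x₀ ρ) fun x hx => ?_
    rw [Metric.mem_closedBall, not_le] at hx
    rw [cutoff_eq_zero hx.le, RCLike.ofReal_zero]

/-- Cutoff functions belong to `H¹`, as bounded sets have finite volume. -/
theorem IsConicManifold.exists_isH1_cutoff (hM : IsConicManifold 𝒜) (x₀ : M) (ρ : ℝ) :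
    ∃ B : CovectorField n Mreg 𝕜, IsH1 ((hM.memLp_cutoff (𝕜 := 𝕜) x₀ ρ).toLp _) B ∧
      ∀ x : Mreg, dist (x : M) x₀ < ρ - 1 → B x = 0 := by
  have hfin := hM.isLocallyFiniteMeasure_vol
  let B : CovectorField n Mreg 𝕜 := fun x => (regDiff (n := n) (cutoff x₀ ρ) x).smulRight (1 : 𝕜)
  have hB0 : ∀ x : Mreg, (dist (x : M) x₀ < ρ - 1 ∨ ρ < dist (x : M) x₀) → B x = 0 := fun x h => by
    ext v
    simp [B, hM.regDiff_cutoff_eq_zero h]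
  have h1 : HasWeakDifferential (fun x : M => (cutoff x₀ ρ x : 𝕜)) B := by
    have h := (HasWeakDifferential.const (n := n) (Mreg := Mreg) (1 : 𝕜)).lipschitz_mul
      (hM.locallyLipschitzOn_chartSymm_comp (lipschitzWith_cutoff x₀ ρ))
    have e1 : (fun x : M => cutoff x₀ ρ x • (1 : 𝕜)) = fun x => (cutoff x₀ ρ x : 𝕜) := by
      funext x
      rw [RCLike.real_smul_eq_coe_mul, mul_one]
    have e2 : (fun x : Mreg => cutoff x₀ ρ x • (0 : CovectorField n Mreg 𝕜) x +
        (regDiff (n := n) (cutoff x₀ ρ) x).smulRight (1 : 𝕜)) = B := by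
      funext x
      ext v
      change cutoff x₀ ρ x • (0 : 𝕜) + B x v = B x v
      rw [smul_zero, zero_add]
    rwa [e1, e2] at h
  refine ⟨B, ⟨h1.congr (MemLp.coeFn_toLp _).symm, ?_⟩, fun x hx => hB0 x (Or.inl hx)⟩
  rw [energy_eq]
  have hle : ∀ x : Mreg, ‖components B x‖ₑ ^ 2 ≤
      (Subtype.val ⁻¹' Metric.closedBall x₀ ρ : Set Mreg).indicator 1 x := fun x => by
    by_cases hx : (x : M) ∈ Metric.closedBall x₀ ρ
    · have hx' : x ∈ (Subtype.val ⁻¹' Metric.closedBall x₀ ρ : Set Mreg) := hx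
      rw [indicator_of_mem hx', Pi.one_apply]
      have hn : ‖components B x‖ ≤ 1 := by
        refine (norm_components_smulRight_le zero_le_one (fun v => hM.abs_regDiff_le zero_le_one
          (Eventually.of_forall fun x' => ?_) v) (fun _ => (1 : 𝕜))).trans (by simp)
        rw [one_mul]
        exact abs_cutoff_sub_le x₀ ρ x' x
      refine pow_le_one₀ (zero_le) ?_
      rw [← ofReal_norm]
      exact ENNReal.ofReal_le_one.2 hn
    · have : components B x = 0 := by
        have hB := hB0 x (Or.inr (not_le.1 hx))
        ext k
        change B x (orthoFrame n x k) = 0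
        rw [hB]; rfl
      simp [this]
  refine (lintegral_mono hle).trans_lt ?_
  rw [lintegral_indicator_one (measurable_subtype_coe Metric.isClosed_closedBall.measurableSet),
    ← Measure.map_apply measurable_subtype_coe Metric.isClosed_closedBall.measurableSet]
  exact (isCompact_closedBall x₀ ρ).measure_lt_top (μ := vol n Mreg)

end Cutoff

/-! ### Test sources as continuous curves in `L²` -/

section Source

variable {n : ℕ} {M : Type*} [MetricSpace M] {Mreg : TopologicalSpace.Opens M}
  [ChartedSpace (E n) Mreg] [RiemannianBundle (fun x : Mreg => TangentSpace (𝓡 n) x)]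
  {𝕜 : Type*} [RCLike 𝕜] {𝒜 : Set (ConicChart n Mreg)} {O : Set M} {f : M × ℝ → 𝕜}

/-- Test sources are continuous up to the singular part, since the conic coordinate systems are
open maps. -/
theorem IsTestSource.continuous (hM : IsConicManifold 𝒜) (hf : IsTestSource 𝒜 O f) :
    Continuous f := by
  refine continuous_iff_continuousAt.2 ?_
  rintro ⟨x, t⟩
  by_cases hx : x ∈ Mreg
  · have hopen : IsOpenEmbedding (fun p : Mreg × ℝ => ((p.1 : M), p.2)) :=
      (Mreg.isOpen.isOpenEmbedding_subtypeVal).prodMap .id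
    exact (hopen.continuousAt_iff (x := (⟨x, hx⟩, t))).1 hf.smooth_reg.continuous.continuousAt
  · obtain ⟨c, hc, p, hp, rfl⟩ := hM.cover x hx
    have hdom : IsOpen (conicDomain c.W c.R ×ˢ (univ : Set ℝ)) := c.isOpen_domain.prod isOpen_univ
    have hmem : ((p, t) : (E c.k × E c.m) × ℝ) ∈ conicDomain c.W c.R ×ˢ (univ : Set ℝ) :=
      ⟨hp, mem_univ t⟩
    have hcont := (hf.smooth_lift c hc).continuousOn.continuousAt (hdom.mem_nhds hmem)
    intro N hN
    obtain ⟨V, hV, I, hI, hVI⟩ := mem_nhds_prod_iff.1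
      (inter_mem (hcont hN) (hdom.mem_nhds hmem))
    obtain ⟨V', hV'V, hV'o, hpV'⟩ := mem_nhds_iff.1 hV
    have hV'd : V' ⊆ conicDomain c.W c.R := fun q hq =>
      (hVI (⟨hV'V hq, mem_of_mem_nhds hI⟩ : (q, t) ∈ V ×ˢ I)).2.1
    refine mem_map.2 (mem_of_superset (prod_mem_nhds
      ((c.isOpen_image V' hV'd hV'o).mem_nhds (mem_image_of_mem _ hpV')) hI) ?_)
    rintro ⟨_, s⟩ ⟨⟨q, hq, rfl⟩, hs⟩
    exact (hVI (⟨hV'V hq, hs⟩ : (q, s) ∈ V ×ˢ I)).1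

theorem IsTestSource.exists_compact (hf : IsTestSource 𝒜 O f) :
    ∃ K, IsCompact K ∧ K ⊆ O ∧ ∀ x t, x ∉ K → f (x, t) = 0 := by
  refine ⟨Prod.fst '' tsupport f, hf.hasCompactSupport.isCompact.image continuous_fst, ?_, ?_⟩
  · rintro _ ⟨p, hp, rfl⟩
    exact (hf.tsupport_subset hp).1
  · intro x t hx
    exact image_eq_zero_of_notMem_tsupport fun h => hx ⟨_, h, rfl⟩

theorem IsTestSource.eq_zero_of_notMem (hf : IsTestSource 𝒜 O f) {x : M} (hx : x ∉ O) (t : ℝ) :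
    f (x, t) = 0 :=
  image_eq_zero_of_notMem_tsupport fun h => hx (hf.tsupport_subset h).1

variable [IsManifold (𝓡 n) ∞ Mreg]
  [IsContMDiffRiemannianBundle (𝓡 n) ∞ (E n) (fun x : Mreg => TangentSpace (𝓡 n) x)]
  [MeasurableSpace M] [BorelSpace M]

theorem IsTestSource.memLp (hM : IsConicManifold 𝒜) (hf : IsTestSource 𝒜 O f) (t : ℝ) :
    MemLp (fun x => f (x, t)) 2 (vol n Mreg) := by
  have := hM.isLocallyFiniteMeasure_vol
  obtain ⟨K, hK, -, h0⟩ := hf.exists_compact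
  refine Continuous.memLp_of_hasCompactSupport ?_ (HasCompactSupport.intro hK fun x => h0 x t)
  exact (hf.continuous hM).comp (by fun_prop)

theorem coeFn_toL2 {X : Type*} [MeasurableSpace X] {μ : Measure X} {g : X → 𝕜} (hg : MemLp g 2 μ) :
    toL2 μ g =ᵐ[μ] g := by
  rw [toL2, dif_pos hg]
  exact hg.coeFn_toLp

/-- By uniform continuity, as the support is compact and has finite volume. -/
theorem IsTestSource.continuous_toL2 (hM : IsConicManifold 𝒜) (hf : IsTestSource 𝒜 O f) :
    Continuous fun t => toL2 (vol n Mreg) (fun x => f (x, t)) := by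
  have := hM.isLocallyFiniteMeasure_vol
  obtain ⟨K, hK, -, h0⟩ := hf.exists_compact
  have huc : UniformContinuous f :=
    (hf.continuous hM).uniformContinuous_of_tendsto_cocompact (x := 0) ?_
  swap
  · exact hf.hasCompactSupport.is_zero_at_infty
  have hsupp : ∀ t, Function.support (fun x => f (x, t)) ⊆ K := fun t x hx => by
    by_contra h
    exact hx (h0 x t h)
  set V : ℝ := ((vol n Mreg K) ^ (1 / (2 : ENNReal).toReal)).toReal with hV
  have hVtop : (vol n Mreg K) ^ (1 / (2 : ENNReal).toReal) ≠ ⊤ :=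
    (ENNReal.rpow_lt_top_of_nonneg (by positivity) hK.measure_lt_top.ne).ne
  rw [Metric.continuous_iff]
  intro t ε hε
  obtain ⟨δ, hδ, h⟩ := Metric.uniformContinuous_iff.1 huc (ε / (V + 1)) (by positivity)
  refine ⟨δ, hδ, fun s hs => ?_⟩
  have hd : ∀ x, dist (f (x, s)) (f (x, t)) ≤ ε / (V + 1) := fun x =>
    (h (by rw [Prod.dist_eq, dist_self, max_eq_right dist_nonneg]; exact hs)).le
  have hle := eLpNorm_sub_le_of_dist_bdd (p := 2) (vol n Mreg) ENNReal.ofNat_ne_top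
    hK.measurableSet (by positivity) hd (hsupp s) (hsupp t)
  rw [toL2, toL2, dif_pos (hf.memLp hM s), dif_pos (hf.memLp hM t), dist_eq_norm,
    ← MemLp.toLp_sub, Lp.norm_toLp]
  refine (ENNReal.toReal_mono (ENNReal.mul_ne_top ENNReal.ofReal_ne_top hVtop) hle).trans_lt ?_
  rw [ENNReal.toReal_mul, ENNReal.toReal_ofReal (by positivity), ← hV, div_mul_eq_mul_div,
    div_lt_iff₀ (by positivity)]
  have : 0 ≤ V := ENNReal.toReal_nonneg
  nlinarith

theorem IsTestSource.exists_norm_toL2_le (hM : IsConicManifold 𝒜) (hf : IsTestSource 𝒜 O f) :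
    ∃ F, ∀ t, ‖toL2 (vol n Mreg) (fun x => f (x, t))‖ ≤ F := by
  refine HasCompactSupport.exists_bound_of_continuous ?_ (hf.continuous_toL2 hM)
  refine HasCompactSupport.intro (hf.hasCompactSupport.isCompact.image continuous_snd)
    fun t ht => ?_
  have e : (fun x => f (x, t)) = fun _ => 0 := funext fun x =>
    image_eq_zero_of_notMem_tsupport fun h => ht ⟨_, h, rfl⟩
  rw [e, toL2, dif_pos MemLp.zero']
  exact MemLp.toLp_zero _

/-! ### Finite energy solutions as waves in Hilbert space -/

variable [SecondCountableTopology M]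

theorem continuousOn_gradL2 {u : ℝ → Lp 𝕜 2 (vol n Mreg)} {A : ℝ → CovectorField n Mreg 𝕜}
    (hA : ∀ t ≥ 0, IsH1 (u t) (A t))
    (hc : ∀ t ≥ 0, Tendsto (fun s => energy (fun x => A s x - A t x)) (𝓝[Ici 0] t) (𝓝 0)) :
    ContinuousOn (fun t => gradL2 (A t)) (Ici 0) := by
  intro t ht
  rw [ContinuousWithinAt, tendsto_iff_norm_sub_tendsto_zero]
  have h1 : Tendsto (fun s => ENNReal.ofReal (‖gradL2 (A s) - gradL2 (A t)‖ ^ 2)) (𝓝[Ici 0] t)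
      (𝓝 0) := by
    refine (hc t ht).congr' ?_
    filter_upwards [self_mem_nhdsWithin] with s hs
    exact (gradL2_sub_norm_sq (hA s hs).memLp (hA t ht).memLp).symm
  have h2 := (ENNReal.tendsto_toReal ENNReal.zero_ne_top).comp h1
  have h3 : Tendsto (fun s => ‖gradL2 (A s) - gradL2 (A t)‖ ^ 2) (𝓝[Ici 0] t) (𝓝 0) := by
    refine h2.congr fun s => ?_
    exact ENNReal.toReal_ofReal (sq_nonneg _)
  have h4 := h3.sqrt
  rw [Real.sqrt_zero] at h4
  exact h4.congr fun s => Real.sqrt_sq (norm_nonneg _)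

/-- A finite energy solution is a wave in Hilbert space. The momentum and the differential are
extended to negative times by their values at `0`. -/
theorem IsWave.exists_energyWave (hM : IsConicManifold 𝒜) (hf : IsTestSource 𝒜 O f)
    {u : ℝ → Lp 𝕜 2 (vol n Mreg)} (hu : IsWave f u) :
    ∃ (v : ℝ → Lp 𝕜 2 (vol n Mreg)) (Z : ℝ → GradSpace n Mreg 𝕜),
      EnergyWave (gradGraph n Mreg 𝕜) (fun t => toL2 (vol n Mreg) (fun x => f (x, t))) v Z ∧
      v 0 = 0 ∧ ∀ t ≥ 0, u t = ∫ s in (0 : ℝ)..t, v s := by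
  obtain ⟨v, A, hderiv, hv, hA, hAc, hu0, hv0, hweak⟩ := hu
  have hmax : Continuous fun t : ℝ => max t 0 := by fun_prop
  have hmem : ∀ t : ℝ, max t 0 ∈ Ici (0 : ℝ) := fun t => mem_Ici.2 (le_max_right t 0)
  have hvc : Continuous fun t => v (max t 0) := hv.comp_continuous hmax hmem
  have hAc' : Continuous fun t => gradL2 (A (max t 0)) :=
    (continuousOn_gradL2 hA hAc).comp_continuous hmax hmem
  have hfc := hf.continuous_toL2 hM
  have hint : ∀ t ≥ 0, u t = ∫ s in (0 : ℝ)..t, v (max s 0) := fun t ht => by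
    have h := intervalIntegral.integral_eq_sub_of_hasDeriv_right_of_le (f := u)
      (f' := fun s => v (max s 0)) ht
      (fun s hs => ((hderiv s hs.1).continuousWithinAt).mono fun r hr => hr.1)
      (fun s hs => by
        rw [max_eq_left hs.1.le]
        exact (hderiv s hs.1.le).mono fun r hr => (hs.1.trans hr).le)
      (hvc.intervalIntegrable _ _)
    rw [h, hu0, sub_zero]
  refine ⟨fun t => v (max t 0), fun t => gradL2 (A (max t 0)),
    ⟨hfc, hvc, hAc', ?_, ?_, ?_⟩, by simp [hv0], hint⟩
  · have := hA 0 le_rfl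
    rw [hu0] at this
    simpa using this.gradL2_eq_zero
  · intro t ht
    refine ⟨A t, ?_, by rw [max_eq_left ht]⟩
    rw [← hint t ht]
    exact hA t ht
  · rintro w ⟨B, hB, hwB⟩ t ht
    -- the defect of the integrated equation is continuous with right derivative zero
    let g : ℝ → 𝕜 := fun t => inner 𝕜 w.1 (v (max t 0)) -
      (inner 𝕜 w.1 (∫ s in (0 : ℝ)..t, toL2 (vol n Mreg) (fun x => f (x, s))) -
        inner 𝕜 w.2 (∫ s in (0 : ℝ)..t, gradL2 (A (max s 0))))
    have hF : ∀ t, HasDerivAt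
        (fun t => inner 𝕜 w.1 (∫ s in (0 : ℝ)..t, toL2 (vol n Mreg) (fun x => f (x, s))))
        (inner 𝕜 w.1 (toL2 (vol n Mreg) (fun x => f (x, t)))) t := fun t => by
      simpa using (hasDerivAt_const t w.1).inner 𝕜 (hasDerivAt_primitive hfc 0 t)
    have hG : ∀ t, HasDerivAt (fun t => inner 𝕜 w.2 (∫ s in (0 : ℝ)..t, gradL2 (A (max s 0))))
        (inner 𝕜 w.2 (gradL2 (A (max t 0)))) t := fun t => by
      simpa using (hasDerivAt_const t w.2).inner 𝕜 (hasDerivAt_primitive hAc' 0 t)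
    have hg : ∀ s ∈ Ico 0 t, HasDerivWithinAt g 0 (Ici s) s := fun s hs => by
      have h1 := (hweak w.1 B hB s hs.1).mono (Ici_subset_Ici.2 hs.1)
      have h2 : HasDerivWithinAt (fun r => inner 𝕜 w.1 (v (max r 0)))
          (inner 𝕜 w.1 (toL2 (vol n Mreg) (fun x => f (x, s))) - dirichletForm (A s) B)
          (Ici s) s := by
        refine h1.congr (fun r hr => ?_) ?_
        · rw [max_eq_left (hs.1.trans hr)]; rfl
        · rw [max_eq_left hs.1]; rfl
      refine (h2.sub ((hF s).sub (hG s)).hasDerivWithinAt).congr_deriv ?_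
      rw [hwB, max_eq_left hs.1, inner_gradL2 (hA s hs.1).memLp hB.memLp]
      ring
    have hgc : Continuous g := by
      have h1 := continuous_iff_continuousAt.2 fun t => (hF t).continuousAt
      have h2 := continuous_iff_continuousAt.2 fun t => (hG t).continuousAt
      exact (continuous_const.inner hvc).sub (h1.sub h2)
    have h := constant_of_has_deriv_right_zero hgc.continuousOn hg t ⟨ht, le_rfl⟩
    have h0 : g 0 = 0 := by simp [g, hv0]
    rw [h0] at h
    exact sub_eq_zero.1 h

end Source

/-! ### Inner products of curves -/

section Curves

variable {𝕜 H : Type*} [RCLike 𝕜] [NormedAddCommGroup H] [InnerProductSpace 𝕜 H]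
  [CompleteSpace H] [NormedSpace ℝ H] [IsScalarTower ℝ 𝕜 H]

theorem inner_intervalIntegral (w : H) {g : ℝ → H} {a b : ℝ}
    (hg : IntervalIntegrable g volume a b) :
    inner 𝕜 w (∫ s in a..b, g s) = ∫ s in a..b, inner 𝕜 w (g s) :=
  (((innerSL 𝕜 w).restrictScalars ℝ).intervalIntegral_comp_comm hg).symm

theorem continuous_integral_reflected {g : ℝ → H} (hg : Continuous g) (T : ℝ) :
    Continuous fun t => ∫ r in t..(2 * T - t), g r := by
  have h0 : Continuous fun t => ∫ r in (0 : ℝ)..t, g r :=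
    continuous_iff_continuousAt.2 fun t => (hasDerivAt_primitive hg 0 t).continuousAt
  have e : ∀ t, (∫ r in t..(2 * T - t), g r) =
      (∫ r in (0 : ℝ)..(2 * T - t), g r) - ∫ r in (0 : ℝ)..t, g r := fun t => by
    rw [intervalIntegral.integral_interval_sub_left] <;> exact hg.intervalIntegrable _ _
  simp_rw [e]
  exact (h0.comp (by fun_prop)).sub h0

end Curves

section Restriction

variable {X : Type*} [MeasurableSpace X] {μ : Measure X} {𝕜 : Type*} [RCLike 𝕜] {O : Set X}

theorem inner_restrict_of_ae_eq_zero {b : Lp 𝕜 2 μ}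
    (hb : ∀ᵐ x ∂μ, x ∉ O → b x = 0) (a : Lp 𝕜 2 μ) :
    inner 𝕜 (LpToLpRestrictCLM X 𝕜 𝕜 μ 2 O b) (LpToLpRestrictCLM X 𝕜 𝕜 μ 2 O a) =
      inner 𝕜 b a := by
  have h0 : ∀ᵐ x ∂μ, x ∉ O → (inner 𝕜 (b x) (a x) : 𝕜) = 0 := by
    filter_upwards [hb] with x hx hxO
    rw [hx hxO, inner_zero_left]
  rw [L2.inner_def, L2.inner_def, ← setIntegral_eq_integral_of_ae_compl_eq_zero h0]
  refine integral_congr_ae ?_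
  filter_upwards [LpToLpRestrictCLM_coeFn 𝕜 O a, LpToLpRestrictCLM_coeFn 𝕜 O b] with x h1 h2
  rw [h1, h2]

theorem restrict_eq_zero_iff (hO : MeasurableSet O) {F : Type*} [NormedAddCommGroup F]
    [NormedSpace 𝕜 F] (a : Lp F 2 μ) :
    LpToLpRestrictCLM X F 𝕜 μ 2 O a = 0 ↔ ∀ᵐ x ∂μ, x ∈ O → a x = 0 := by
  rw [Lp.eq_zero_iff_ae_eq_zero, ← ae_restrict_iff' hO]
  have h := LpToLpRestrictCLM_coeFn 𝕜 O a
  constructor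
  · intro h0
    filter_upwards [h, h0] with x h1 h2
    rw [← h1, h2]; rfl
  · intro h0
    filter_upwards [h, h0] with x h1 h2
    rw [h1, h2]; rfl

/-- Functions vanishing on a given set form a closed subspace of `L²`. -/
theorem ae_eq_zero_intervalIntegral (𝕜 : Type*) [RCLike 𝕜] (hO : MeasurableSet O) {F : Type*}
    [NormedAddCommGroup F] [InnerProductSpace 𝕜 F] [CompleteSpace F] [NormedSpace ℝ F]
    [IsScalarTower ℝ 𝕜 F] {g : ℝ → Lp F 2 μ} (hg : Continuous g)
    {t : ℝ} (ht : 0 ≤ t) (h : ∀ s ∈ Icc 0 t, ∀ᵐ x ∂μ, x ∈ O → g s x = 0) :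
    ∀ᵐ x ∂μ, x ∈ O → (∫ s in (0 : ℝ)..t, g s : Lp F 2 μ) x = 0 := by
  rw [← restrict_eq_zero_iff (𝕜 := 𝕜) hO]
  have hc := ((LpToLpRestrictCLM X F 𝕜 μ 2 O).restrictScalars ℝ).intervalIntegral_comp_comm
    (hg.intervalIntegrable (μ := volume) 0 t)
  refine hc.symm.trans ?_
  rw [intervalIntegral.integral_congr (g := fun _ => 0), intervalIntegral.integral_zero]
  intro s hs
  rw [uIcc_of_le ht] at hs
  exact (restrict_eq_zero_iff (𝕜 := 𝕜) hO (g s)).2 (h s hs)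

theorem mul_setIntegral_norm_sq_le {F : Type*} [NormedAddCommGroup F] [InnerProductSpace 𝕜 F]
    {a : X → ℝ} (ha : AEStronglyMeasurable a μ) {C : ℝ} (hC : ∀ x, |a x| ≤ C) (h0 : ∀ x, 0 ≤ a x)
    (hO : MeasurableSet O) {c : ℝ} (hc : ∀ x ∈ O, c ≤ a x) (w : Lp F 2 μ) :
    c * ∫ x in O, ‖w x‖ ^ 2 ∂μ ≤ RCLike.re (inner 𝕜 (mulLp 𝕜 F ha hC w) w) := by
  have hi := integrable_mul_norm_sq 𝕜 ha hC w
  rw [re_inner_mulLp, ← integral_const_mul]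
  refine (setIntegral_mono_on ?_ hi.integrableOn hO fun x hx => ?_).trans
    (setIntegral_le_integral hi (Eventually.of_forall fun x => ?_))
  · exact (((Lp.memLp w).integrable_norm_pow two_ne_zero).const_mul c).integrableOn
  · exact mul_le_mul_of_nonneg_right (hc x hx) (sq_nonneg _)
  · exact mul_nonneg (h0 x) (sq_nonneg _)

theorem ae_eq_zero_of_setIntegral_norm_sq_le_zero {F : Type*} [NormedAddCommGroup F]
    (hO : MeasurableSet O) {w : Lp F 2 μ} (h : ∫ x in O, ‖w x‖ ^ 2 ∂μ ≤ 0) :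
    ∀ᵐ x ∂μ, x ∈ O → w x = 0 := by
  have h0 := le_antisymm h (integral_nonneg fun x => sq_nonneg _)
  rw [setIntegral_eq_zero_iff_of_nonneg_ae (Eventually.of_forall fun x => sq_nonneg _)
    ((Lp.memLp w).integrable_norm_pow two_ne_zero).integrableOn] at h0
  rw [← ae_restrict_iff' hO]
  filter_upwards [h0] with x hx
  exact norm_eq_zero.1 (pow_eq_zero_iff two_ne_zero |>.1 hx)

end Restriction

section Waves

variable {n : ℕ} {M : Type*} [MetricSpace M] {Mreg : TopologicalSpace.Opens M}
  [ChartedSpace (E n) Mreg] [IsManifold (𝓡 n) ∞ Mreg]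
  [RiemannianBundle (fun x : Mreg => TangentSpace (𝓡 n) x)]
  [IsContMDiffRiemannianBundle (𝓡 n) ∞ (E n) (fun x : Mreg => TangentSpace (𝓡 n) x)]
  [MeasurableSpace M] [BorelSpace M]
  {𝕜 : Type*} [RCLike 𝕜] {𝒜 : Set (ConicChart n Mreg)} {O : Set M} {f h : M × ℝ → 𝕜}

/-! ### The identity for inner products of waves -/

theorem IsTestSource.ae_toL2_eq_zero (hM : IsConicManifold 𝒜) (hf : IsTestSource 𝒜 O f) (t : ℝ) :
    ∀ᵐ x ∂(vol n Mreg), x ∉ O → toL2 (vol n Mreg) (fun x => f (x, t)) x = 0 := by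
  filter_upwards [coeFn_toL2 (hf.memLp hM t)] with x hx hxO
  rw [hx, hf.eq_zero_of_notMem hxO]

theorem IsTestSource.sourceOn_eq (hM : IsConicManifold 𝒜) (hf : IsTestSource 𝒜 O f) (t : ℝ) :
    sourceOn n Mreg O f t =
      LpToLpRestrictCLM M 𝕜 𝕜 (vol n Mreg) 2 O (toL2 (vol n Mreg) fun x => f (x, t)) := by
  refine Lp.ext ?_
  filter_upwards [coeFn_toL2 ((hf.memLp hM t).restrict O), LpToLpRestrictCLM_coeFn 𝕜 O
    (toL2 (vol n Mreg) fun x => f (x, t)), ae_restrict_of_ae (coeFn_toL2 (hf.memLp hM t))]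
    with x h1 h2 h3
  rw [h2, h3]
  exact h1

/-- Pairings over `O` with the time average agree with pairings over the whole space, if one of
the two factors is supported in `O`. -/
theorem inner_timeAverage_restrict {T t : ℝ} {φ : ℝ → Lp 𝕜 2 (vol n Mreg)}
    (hφ : Continuous φ) (w : Lp 𝕜 2 (vol n Mreg))
    (hpair : ∀ s, inner 𝕜 (LpToLpRestrictCLM M 𝕜 𝕜 (vol n Mreg) 2 O w)
      (LpToLpRestrictCLM M 𝕜 𝕜 (vol n Mreg) 2 O (φ s)) = inner 𝕜 w (φ s)) :
    2 * l2Inner (LpToLpRestrictCLM M 𝕜 𝕜 (vol n Mreg) 2 O w)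
      (timeAverage T (fun s => LpToLpRestrictCLM M 𝕜 𝕜 (vol n Mreg) 2 O (φ s)) t) =
      inner 𝕜 (∫ r in t..(2 * T - t), φ r) w := by
  have hRφ : Continuous fun s => LpToLpRestrictCLM M 𝕜 𝕜 (vol n Mreg) 2 O (φ s) :=
    (LpToLpRestrictCLM M 𝕜 𝕜 (vol n Mreg) 2 O).continuous.comp hφ
  have e1 : inner 𝕜 (LpToLpRestrictCLM M 𝕜 𝕜 (vol n Mreg) 2 O w)
      (∫ r in t..(2 * T - t), LpToLpRestrictCLM M 𝕜 𝕜 (vol n Mreg) 2 O (φ r)) =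
      inner 𝕜 w (∫ r in t..(2 * T - t), φ r) := by
    rw [inner_intervalIntegral _ (hRφ.intervalIntegrable _ _),
      inner_intervalIntegral _ (hφ.intervalIntegrable _ _)]
    exact intervalIntegral.integral_congr fun s _ => hpair s
  rw [l2Inner, timeAverage, ← algebraMap_smul 𝕜 (1 / 2 : ℝ), inner_smul_left, ← inner_conj_symm,
    e1, inner_conj_symm, RCLike.algebraMap_eq_ofReal, RCLike.conj_ofReal, ← mul_assoc,
    show (2 : 𝕜) = ((2 : ℝ) : 𝕜) from (RCLike.ofReal_ofNat 2).symm, ← RCLike.ofReal_mul]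
  norm_num

/-- The abstract identity, rewritten in terms of the restrictions to `O` and the time average. -/
theorem IsWave.inner_eq [SecondCountableTopology M] (hM : IsConicManifold 𝒜)
    {T : ℝ} (hT : 0 < T) (hf : IsTestSource 𝒜 O f) (hh : IsTestSource 𝒜 O h)
    {uf uh : ℝ → Lp 𝕜 2 (vol n Mreg)} (huf : IsWave f uf) (huh : IsWave h uh) :
    l2Inner (uf T) (uh T) =
      spaceTimeInner T (sourceOn n Mreg O f) (timeAverage T (waveOn O uh)) -
        spaceTimeInner T (waveOn O uf) (timeAverage T (sourceOn n Mreg O h)) := by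
  obtain ⟨v, Z, hv, hv0, hvu⟩ := huf.exists_energyWave hM hf
  obtain ⟨v', Z', hv', -, hvu'⟩ := huh.exists_energyWave hM hh
  have key := hv.blagovestchenskii hv' hv0 hT
  have hprim : ∀ {v : ℝ → Lp 𝕜 2 (vol n Mreg)}, Continuous v →
      Continuous fun t => ∫ s in (0 : ℝ)..t, v s := fun hv =>
    continuous_iff_continuousAt.2 fun t => (hasDerivAt_primitive hv 0 t).continuousAt
  have hcf := hf.continuous_toL2 hM
  have hch := hh.continuous_toL2 hM
  have hcu := hprim hv.cont_v
  have hcu' := hprim hv'.cont_v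
  rw [← hvu T hT.le, ← hvu' T hT.le, intervalIntegral.integral_sub
    (((continuous_integral_reflected hcu' T).inner hcf).intervalIntegrable _ _)
    (((continuous_integral_reflected hch T).inner hcu).intervalIntegrable _ _)] at key
  have e1 : ∫ t in (0 : ℝ)..T, inner 𝕜 (∫ r in t..(2 * T - t), ∫ s in (0 : ℝ)..r, v' s)
      (toL2 (vol n Mreg) fun x => f (x, t)) =
      2 * spaceTimeInner T (sourceOn n Mreg O f) (timeAverage T (waveOn O uh)) := by
    rw [spaceTimeInner, ← intervalIntegral.integral_const_mul]
    refine intervalIntegral.integral_congr fun t ht => ?_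
    rw [uIcc_of_le hT.le] at ht
    have e : timeAverage T (waveOn O uh) t = timeAverage T (fun r =>
        LpToLpRestrictCLM M 𝕜 𝕜 (vol n Mreg) 2 O (∫ s in (0 : ℝ)..r, v' s)) t := by
      rw [timeAverage, timeAverage]
      congr 1
      refine intervalIntegral.integral_congr fun r hr => ?_
      rw [uIcc_of_le (by linarith [ht.2])] at hr
      simp only [waveOn]
      rw [hvu' r (ht.1.trans hr.1)]
    rw [e, hf.sourceOn_eq hM t, inner_timeAverage_restrict hcu']
    exact fun s => inner_restrict_of_ae_eq_zero (hf.ae_toL2_eq_zero hM t) _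
  have e2 : ∫ t in (0 : ℝ)..T, inner 𝕜 (∫ r in t..(2 * T - t), toL2 (vol n Mreg) fun x => h (x, r))
      (∫ s in (0 : ℝ)..t, v s) =
      2 * spaceTimeInner T (waveOn O uf) (timeAverage T (sourceOn n Mreg O h)) := by
    rw [spaceTimeInner, ← intervalIntegral.integral_const_mul]
    refine intervalIntegral.integral_congr fun t ht => ?_
    rw [uIcc_of_le hT.le] at ht
    have e : sourceOn n Mreg O h = fun r =>
        LpToLpRestrictCLM M 𝕜 𝕜 (vol n Mreg) 2 O (toL2 (vol n Mreg) fun x => h (x, r)) :=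
      funext fun r => hh.sourceOn_eq hM r
    simp only [waveOn]
    rw [e, hvu t ht.1, inner_timeAverage_restrict hch]
    intro s
    rw [← inner_conj_symm, inner_restrict_of_ae_eq_zero (hh.ae_toL2_eq_zero hM s),
      inner_conj_symm]
  rw [e1, e2, ← mul_sub] at key
  exact mul_left_cancel₀ two_ne_zero key

/-! ### Finite speed of propagation and the mean of a wave -/

theorem tendsto_exp_neg_mul {c : ℝ} (hc : 0 < c) (K : ℝ) :
    Tendsto (fun lam : ℝ => K * Real.exp (-(lam * c))) atTop (𝓝 0) := by
  have h := (Real.tendsto_exp_neg_atTop_nhds_zero.comp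
    (tendsto_id.atTop_mul_const hc)).const_mul K
  rwa [mul_zero] at h

theorem gronwallBound_zero_le {K F t : ℝ} (hK : 1 ≤ K) (hF : 0 ≤ F) :
    gronwallBound 0 K F t ≤ F * Real.exp (K * t) := by
  rw [gronwallBound_of_K_ne_0 (by linarith)]
  change 0 * Real.exp (K * t) + F / K * (Real.exp (K * t) - 1) ≤ F * Real.exp (K * t)
  have h1 : F / K ≤ F := div_le_self hF hK
  have h2 : 0 ≤ F / K := by positivity
  have h3 := Real.exp_pos (K * t)
  nlinarith

/-- At time `t` a wave with source in the ball of radius `r` vanishes at distance `R > t` from that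
ball. -/
theorem EnergyWave.ae_eq_zero_of_lt [SecondCountableTopology M] (hM : IsConicManifold 𝒜)
    (hf : IsTestSource 𝒜 O f) {v : ℝ → Lp 𝕜 2 (vol n Mreg)} {Z : ℝ → GradSpace n Mreg 𝕜}
    (hv : EnergyWave (gradGraph n Mreg 𝕜) (fun t => toL2 (vol n Mreg) (fun x => f (x, t))) v Z)
    (hv0 : v 0 = 0) {x₀ : M} {r : ℝ} (hO : ∀ x ∈ O, dist x x₀ ≤ r) {t R : ℝ} (ht : 0 ≤ t)
    (htR : t < R) :
    (∀ᵐ x ∂(vol n Mreg), x ∈ {x | r + R ≤ dist x x₀} → v t x = 0) ∧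
    (∀ᵐ x ∂(regVolume n Mreg), x ∈ (Subtype.val ⁻¹' {x | r + R ≤ dist x x₀} : Set Mreg) →
      Z t x = 0) := by
  have hR : 0 < R := ht.trans_lt htR
  obtain ⟨F, hF⟩ := hf.exists_norm_toL2_le hM
  have hSm : MeasurableSet {x : M | r + R ≤ dist x x₀} :=
    (isClosed_le continuous_const (by fun_prop)).measurableSet
  have hSm' : MeasurableSet (Subtype.val ⁻¹' {x | r + R ≤ dist x x₀} : Set Mreg) :=
    measurable_subtype_coe hSm
  have hbound : ∀ lam : ℝ, 0 ≤ lam →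
      (∫ x in {x | r + R ≤ dist x x₀}, ‖v t x‖ ^ 2 ∂(vol n Mreg)) +
        (∫ x in (Subtype.val ⁻¹' {x | r + R ≤ dist x x₀} : Set Mreg), ‖Z t x‖ ^ 2
          ∂(regVolume n Mreg)) ≤ F ^ 2 * Real.exp t * Real.exp (-(lam * (R - t))) := by
    intro lam hlam
    have hL := lipschitzWith_expWeight x₀ (r := r) (R := R) hlam
    have hb := abs_expWeight_le x₀ (r := r) (R := R) hlam
    have hp : ∀ x, 0 ≤ expWeight x₀ r R lam x := fun x => (expWeight_pos x₀ x).le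
    have hw := hM.isWeight_mulLp (𝕜 := 𝕜) hL hp hb hlam
      (hM.abs_regDiff_expWeight_le (n := n) x₀ hlam)
    -- the weight is `1` on the support of the source
    have hmf : ∀ s, mulLp 𝕜 𝕜 (μ := vol n Mreg) hL.continuous.aestronglyMeasurable hb
        (toL2 (vol n Mreg) (fun x => f (x, s))) = toL2 (vol n Mreg) (fun x => f (x, s)) := fun s => by
      refine Lp.ext ?_
      filter_upwards [coeFn_mulLp (𝕜 := 𝕜) (μ := vol n Mreg) hL.continuous.aestronglyMeasurable hb
        (toL2 (vol n Mreg) (fun x => f (x, s))), hf.ae_toL2_eq_zero hM s] with x h1 h2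
      rw [h1]
      by_cases hx : x ∈ O
      · have : expWeight x₀ r R lam x = 1 := by
          rw [expWeight, max_eq_right (by linarith [hO x hx]), min_eq_left hR.le, mul_zero,
            Real.exp_zero]
        rw [this, RCLike.ofReal_one, one_smul]
      · rw [h2 hx, smul_zero]
    have hen := hv.weighted_energy_le hv0 hw hmf hF ht
    -- the weight is `exp (lam * R)` on the set in question
    have hS : ∀ x ∈ {x : M | r + R ≤ dist x x₀}, Real.exp (lam * R) ≤ expWeight x₀ r R lam x := by
      intro x hx
      have hx' : r + R ≤ dist x x₀ := hx
      rw [expWeight, min_eq_right ((by linarith : R ≤ dist x x₀ - r).trans (le_max_left _ _))]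
    have h1 := mul_setIntegral_norm_sq_le (𝕜 := 𝕜) (μ := vol n Mreg)
      hL.continuous.aestronglyMeasurable hb hp hSm hS (v t)
    have h2 := mul_setIntegral_norm_sq_le (𝕜 := 𝕜) (μ := regVolume n Mreg)
      (a := fun x : Mreg => expWeight x₀ r R lam x)
      (hL.continuous.comp continuous_subtype_val).aestronglyMeasurable (fun x => hb x)
      (fun x => hp x) hSm' (fun x hx => hS x hx) (Z t)
    have h3 : gronwallBound 0 (lam + 1) (F ^ 2) t ≤ F ^ 2 * Real.exp ((lam + 1) * t) :=
      gronwallBound_zero_le (by linarith) (sq_nonneg F)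
    have h4 : F ^ 2 * Real.exp ((lam + 1) * t) =
        Real.exp (lam * R) * (F ^ 2 * Real.exp t * Real.exp (-(lam * (R - t)))) := by
      rw [show (lam + 1) * t = lam * R + t + -(lam * (R - t)) by ring, Real.exp_add, Real.exp_add]
      ring
    refine le_of_mul_le_mul_left ?_ (Real.exp_pos (lam * R))
    rw [mul_add, ← h4]
    linarith
  have hlim := le_of_tendsto_of_tendsto tendsto_const_nhds
    (tendsto_exp_neg_mul (sub_pos.2 htR) (F ^ 2 * Real.exp t))
    ((eventually_ge_atTop (0 : ℝ)).mono hbound)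
  have hn1 : 0 ≤ ∫ x in {x | r + R ≤ dist x x₀}, ‖v t x‖ ^ 2 ∂(vol n Mreg) :=
    integral_nonneg fun x => sq_nonneg _
  have hn2 : 0 ≤ ∫ x in (Subtype.val ⁻¹' {x | r + R ≤ dist x x₀} : Set Mreg), ‖Z t x‖ ^ 2
      ∂(regVolume n Mreg) := integral_nonneg fun x => sq_nonneg _
  exact ⟨ae_eq_zero_of_setIntegral_norm_sq_le_zero hSm (by linarith),
    ae_eq_zero_of_setIntegral_norm_sq_le_zero hSm' (by linarith)⟩

/-- The mean of a wave is obtained by testing the equation against a cutoff function that is `1` near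
the support of the wave. -/
theorem IsWave.integrable_and_integral_eq [ProperSpace M] (hM : IsConicManifold 𝒜)
    (hOb : Bornology.IsBounded O) (hf : IsTestSource 𝒜 O f)
    {u : ℝ → Lp 𝕜 2 (vol n Mreg)} (hu : IsWave f u) {t : ℝ} (ht : 0 ≤ t) :
    Integrable (u t) (vol n Mreg) ∧ ∫ x, u t x ∂(vol n Mreg) =
      ∫ t' in (0 : ℝ)..t, ∫ t'' in (0 : ℝ)..t', ∫ x in O, f (x, t'') ∂(vol n Mreg) := by
  rcases isEmpty_or_nonempty M with hempty | ⟨⟨x₀⟩⟩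
  · have : vol n Mreg = 0 := Measure.eq_zero_of_isEmpty _
    simp [this]
  obtain ⟨v, Z, hv, hv0, hvu⟩ := hu.exists_energyWave hM hf
  obtain ⟨r, hr⟩ := hOb.subset_closedBall x₀
  have hO : ∀ x ∈ O, dist x x₀ ≤ r := fun x hx => hr hx
  set R : ℝ := t + 1 with hR
  have hSm : MeasurableSet {x : M | r + R ≤ dist x x₀} :=
    (isClosed_le continuous_const (by fun_prop)).measurableSet
  have hzero : ∀ s ∈ Icc 0 t, _ := fun s hs =>
    hv.ae_eq_zero_of_lt hM hf hv0 hO hs.1 (by linarith [hs.2] : s < R)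
  set ρ : ℝ := r + R + 2 with hρ
  obtain ⟨B, hB, hB0⟩ := hM.exists_isH1_cutoff (n := n) (𝕜 := 𝕜) x₀ ρ
  set χ : Lp 𝕜 2 (vol n Mreg) := (hM.memLp_cutoff (𝕜 := 𝕜) x₀ ρ).toLp _ with hχ
  have hχc : χ =ᵐ[vol n Mreg] fun x => (cutoff x₀ ρ x : 𝕜) := MemLp.coeFn_toLp _
  -- pairing with the cutoff function is integration, for functions supported where it is `1`
  have hpair : ∀ w : Lp 𝕜 2 (vol n Mreg),
      (∀ᵐ x ∂(vol n Mreg), r + R ≤ dist x x₀ → w x = 0) →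
      (fun x => inner 𝕜 (χ x) (w x)) =ᵐ[vol n Mreg] w := fun w hw => by
    filter_upwards [hw, hχc] with x h1 h2
    rw [h2]
    rcases le_or_gt (r + R) (dist x x₀) with h | h
    · rw [h1 h, inner_zero_right]
    · rw [cutoff_eq_one (by linarith)]
      simp
  have hu0 : ∀ᵐ x ∂(vol n Mreg), r + R ≤ dist x x₀ → u t x = 0 := by
    rw [hvu t ht]
    exact ae_eq_zero_intervalIntegral 𝕜 hSm hv.cont_v ht fun s hs => (hzero s hs).1
  have hf0 : ∀ s, inner 𝕜 χ (toL2 (vol n Mreg) fun x => f (x, s)) =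
      ∫ x in O, f (x, s) ∂(vol n Mreg) := fun s => by
    rw [L2.inner_def, setIntegral_eq_integral_of_forall_compl_eq_zero fun x hx =>
      hf.eq_zero_of_notMem hx s]
    refine integral_congr_ae ((hpair _ ?_).trans (coeFn_toL2 (hf.memLp hM s)))
    filter_upwards [hf.ae_toL2_eq_zero hM s] with x hx hxd
    refine hx fun hxO => ?_
    have := hO x hxO
    linarith
  -- the gradients of the wave and of the cutoff function have disjoint supports
  have hgrad : ∀ s ∈ Icc 0 t, inner 𝕜 (gradL2 B) (∫ τ in (0 : ℝ)..s, Z τ) = 0 := fun s hs => by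
    rw [inner_intervalIntegral _ (hv.cont_A.intervalIntegrable _ _),
      intervalIntegral.integral_congr (g := fun _ => (0 : 𝕜)), intervalIntegral.integral_zero]
    intro τ hτ
    rw [uIcc_of_le hs.1] at hτ
    simp only
    rw [L2.inner_def]
    refine integral_eq_zero_of_ae ?_
    filter_upwards [(hzero τ ⟨hτ.1, hτ.2.trans hs.2⟩).2, coeFn_gradL2 hB.memLp] with x h1 h2
    rcases le_or_gt (r + R) (dist (x : M) x₀) with h | h
    · rw [h1 h, inner_zero_right]; rfl
    · have : components B x = 0 := by
        have h0 := hB0 x (by linarith)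
        ext k
        change B x (orthoFrame n x k) = 0
        rw [h0]; rfl
      rw [h2, this, inner_zero_left]; rfl
  have hvs : ∀ s ∈ Icc 0 t, inner 𝕜 χ (v s) =
      ∫ t'' in (0 : ℝ)..s, ∫ x in O, f (x, t'') ∂(vol n Mreg) := fun s hs => by
    have := hv.weak (χ, gradL2 B) ⟨B, hB, rfl⟩ s hs.1
    simp only at this
    rw [this, hgrad s hs, sub_zero,
      inner_intervalIntegral _ ((hf.continuous_toL2 hM).intervalIntegrable _ _)]
    exact intervalIntegral.integral_congr fun r _ => hf0 r
  refine ⟨(L2.integrable_inner χ (u t)).congr (hpair _ hu0), ?_⟩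
  rw [← integral_congr_ae (hpair _ hu0), ← L2.inner_def, hvu t ht,
    inner_intervalIntegral _ (hv.cont_v.intervalIntegrable _ _)]
  refine intervalIntegral.integral_congr fun s hs => ?_
  rw [uIcc_of_le ht] at hs
  exact hvs s hs

end Waves

end ConicWave

end

theorem mainTheorem5 {𝕜 : Type*} [RCLike 𝕜] {n : ℕ} {M : Type*} [MetricSpace M] [CompleteSpace M]
    [MeasurableSpace M] [BorelSpace M]
    (Mreg : TopologicalSpace.Opens M) [ChartedSpace (E n) Mreg] [IsManifold (𝓡 n) ∞ Mreg]
    [RiemannianBundle (fun x : Mreg => TangentSpace (𝓡 n) x)]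
    [IsContMDiffRiemannianBundle (𝓡 n) ∞ (E n) (fun x : Mreg => TangentSpace (𝓡 n) x)]
    (𝒜 : Set (ConicChart n Mreg)) (hM : IsConicManifold 𝒜)
    (O : Set M) (hO : IsOpen O) (hOb : Bornology.IsBounded O) (T : ℝ) (hT : 0 < T) :
    (∀ (f h : M × ℝ → 𝕜), IsTestSource 𝒜 O f → IsTestSource 𝒜 O h →
      ∀ uf uh : ℝ → Lp 𝕜 2 (vol n Mreg), IsWave f uf → IsWave h uh →
        l2Inner (uf T) (uh T) =
          spaceTimeInner T (sourceOn n Mreg O f) (timeAverage T (waveOn O uh)) -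
            spaceTimeInner T (waveOn O uf) (timeAverage T (sourceOn n Mreg O h))) ∧
    (∀ f : M × ℝ → 𝕜, IsTestSource 𝒜 O f →
      ∀ uf : ℝ → Lp 𝕜 2 (vol n Mreg), IsWave f uf →
        ∀ t ≥ 0, Integrable (uf t) (vol n Mreg) ∧
          ∫ x, uf t x ∂(vol n Mreg) =
            ∫ t' in (0 : ℝ)..t, ∫ t'' in (0 : ℝ)..t', ∫ x in O, f (x, t'') ∂(vol n Mreg)) := by
  have := hM.properSpace
  exact ⟨fun f h hf hh uf uh huf huh => huf.inner_eq hM hT hf hh huh,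
    fun f hf uf huf t ht => huf.integrable_and_integral_eq hM hOb hf ht⟩
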